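/- Fix a prime $p$. For a ring $R$ in which $p$ is nilpotent, or $R=W(\mathbb F)$ with $\mathbb F$ a perfect field of characteristic $p$, let $I_R=\ker(W(R)\to R)$, let $F,V$ be the Frobenius and Verschiebung of $W(R)$, and write $M^F$ for the base change of a $W(R)$-module $M$ along $F$. A display $\mathcal P$ over $R$ is a pair $(T,L)$ of finite projective $W(R)$-modules with an isomorphism $\Psi\colon T^F\oplus L^F\to T\oplus L$ of $W(R)$-modules. A morphism $\mathcal P\to\mathcal P'$ is a matrix $f=\begin{bmatrix}a&b\\c&d\end{bmatrix}$ of $W(R)$-linear maps $a\colon T\to T'$, $b\colon L\to I_R\otimes T'$, $c\colon T\to L'$, $d\colon L\to L'$, such that $f\circ\Psi=\Psi'\circ\begin{bmatrix}a^F&b^{F,\mathrm{div}}\\p\,c^F&d^F\end{bmatrix}$, where $b^{F,\mathrm{div}}$ is formed with $V^{-1}\colon I_R\to W(R)$. Matrices are multiplied using $I_R\to W(R)$. The dimension, codimension and height of $\mathcal P$ are $\operatorname{rk}T$, $\operatorname{rk}L$ and $\operatorname{rk}T+\operatorname{rk}L$. For $n\ge 0$, an $n$-truncated display is defined in the same way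 with $(W(R),I_R)$ replaced by $(\mathcal W_n(R),I_{n+1,R})$, where $\mathcal W_n(R)=W_{n+1}(R)/(0,\dots,0,R[p])$ and $I_{n+1,R}=\ker(W_{n+1}(R)\to R)$, and with $\Psi$ an isomorphism $T^F\oplus L^F\to W_n(R)\otimes_{\mathcal W_n(R)}(T\oplus L)$ of $W_n(R)$-modules, formed with $F\colon\mathcal W_n(R)\to W_n(R)$ and $V^{-1}\colon I_{n+1,R}\to W_n(R)$. Displays and their morphisms have base changes along ring homomorphisms, and $n$-truncations $\mathcal P[n]$, $f[n]$, by extension of scalars. Let $\breve z\colon L\to L^F$ be the lower right entry of $\Psi^{-1}$. The display $\mathcal P$ is nilpotent of order $\le e$ if the composite $\breve z^{(p^{e-1})}\circ\dots\circ\breve z\colon R/pR\otimes_{W(R)}L\to(R/pR\otimes_{W(R)}L)^{(p^e)}$ vanishes. Let $f\colon\mathcal P\to\mathcal P'$ be a morphism of displays of the same constant height and dimension. It induces a map $\det f$ of rank one $\mathbb Z_p$-local systems on $\operatorname{Spec}R$, whose $p$-adic valuation at a point $x$ is the $p$-adic valuation of the determinant of $W(k)\otimes f\colon W(k)\otimes(T\oplus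 L)\to W(k)\otimes(T'\oplus L')$, with $k$ an algebraic closure of the residue field of $x$. The morphism $f$ is an isogeny if this valuation is finite at every $x$, and an isogeny of height $m$ if it equals $m$ at every $x$. **Statement.** For all non-negative integers $a,e,c,m$ there is a non-negative integer $n=n(a,e,c,m)$, depending only on these numbers (and the fixed prime $p$), with the following property. Let $\mathbb F$ be a perfect field of characteristic $p$, let $\mathcal P_0$ be a display over $\mathbb F$ of codimension $c$ that is nilpotent of order $\le e$, and let $\widetilde{\mathcal P}_0$ be a display over $W(\mathbb F)$ lifting $\mathcal P_0$. Let $R$ be a $W(\mathbb F)/p^a$-algebra, let $\mathcal P,\mathcal P'$ be displays over $R$ that are nilpotent of order $\le e$, and let $g\colon\mathcal P\to\widetilde{\mathcal P}_{0,R}$ and $g'\colon\mathcal P'\to\widetilde{\mathcal P}_{0,R}$ be isogenies of the same height $m$. Then the following are equivalent: 1. there is a morphism of displays $f\colon\mathcal P\to\mathcal P'$ with $g'\circ f=g$; 2. there is a morphism of $n$-truncated displays $f_n\colon\mathcal P[n]\to\mathcal P'[n]$ with $g'[n]\circ f_n=g[n]$. If these conditions hold, then the morphism $f$ in (1) is unique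 and is an isomorphism. -/

import Mathlib

open scoped TensorProduct

universe u

noncomputable section

namespace ZinkDisplay

/-! ### Extension of scalars along a ring homomorphism -/

/-- The base change `B ⊗_{f, A} M` of an `A`-module `M` along a ring homomorphism `f : A → B`. -/
def ExtScalars {A B : Type*} [CommRing A] [CommRing B] (f : A →+* B)
    (M : Type*) [AddCommGroup M] [Module A M] : Type _ :=
  letI := f.toAlgebra
  B ⊗[A] M

namespace ExtScalars

variable {A B C : Type*} [CommRing A] [CommRing B] [CommRing C]
variable {M N : Type*} [AddCommGroup M] [Module A M] [AddCommGroup N] [Module A N]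

instance (f : A →+* B) : AddCommGroup (ExtScalars f M) :=
  letI := f.toAlgebra
  (TensorProduct.addCommGroup : AddCommGroup (B ⊗[A] M))

instance (f : A →+* B) : Module B (ExtScalars f M) :=
  letI := f.toAlgebra
  (TensorProduct.leftModule : Module B (B ⊗[A] M))

instance (f : A →+* B) [Module.Finite A M] : Module.Finite B (ExtScalars f M) :=
  let _ := f.toAlgebra
  (inferInstance : Module.Finite B (B ⊗[A] M))

instance (f : A →+* B) [Module.Projective A M] : Module.Projective B (ExtScalars f M) :=
  let _ := f.toAlgebra
  (inferInstance : Module.Projective B (B ⊗[A] M))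

/-- The canonical `f`-linear map `M → B ⊗_{f, A} M`, `x ↦ 1 ⊗ x`. -/
def of (f : A →+* B) : M →ₛₗ[f] ExtScalars f M :=
  letI := f.toAlgebra
  { toFun := fun x => (1 : B) ⊗ₜ[A] x
    map_add' := fun x y => TensorProduct.tmul_add _ _ _
    map_smul' := fun a x => by
      change (1 : B) ⊗ₜ[A] (a • x) = f a • ((1 : B) ⊗ₜ[A] x)
      rw [← TensorProduct.smul_tmul, TensorProduct.smul_tmul']
      rfl }

theorem induction_on {f : A →+* B} {motive : ExtScalars f M → Prop} (z : ExtScalars f M)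
    (zero : motive 0) (smul_of : ∀ (b : B) (x : M), motive (b • of f x))
    (add : ∀ z w, motive z → motive w → motive (z + w)) : motive z := by
  let _ := f.toAlgebra
  refine TensorProduct.induction_on (motive := motive) z zero (fun b x => ?_) add
  have h : (b ⊗ₜ[A] x : B ⊗[A] M) = b • ((1 : B) ⊗ₜ[A] x) := by
    rw [TensorProduct.smul_tmul', smul_eq_mul, mul_one]
  rw [h]
  exact smul_of b x

/-- The linear map `B ⊗_{f, A} M → N` attached to an `f`-linear map `M → N`. -/
def lift {f : A →+* B} {N : Type*} [AddCommGroup N] [Module B N] (g : M →ₛₗ[f] N) :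
    ExtScalars f M →ₗ[B] N :=
  letI := f.toAlgebra
  letI := Module.compHom N f
  haveI : IsScalarTower A B N := IsScalarTower.of_algebraMap_smul fun _ _ => rfl
  LinearMap.liftBaseChange B (M := M) (N := N)
    { toFun := g, map_add' := g.map_add, map_smul' := fun a x => g.map_smulₛₗ a x }

@[simp] theorem lift_of {f : A →+* B} {N : Type*} [AddCommGroup N] [Module B N]
    (g : M →ₛₗ[f] N) (x : M) : lift g (of f x) = g x := by
  let _ := f.toAlgebra
  let _ := Module.compHom N f
  have : IsScalarTower A B N := IsScalarTower.of_algebraMap_smul fun _ _ => rfl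
  exact (LinearMap.liftBaseChange_tmul (A := B) _ (1 : B) x).trans (one_smul _ _)

theorem hom_ext {f : A →+* B} {N : Type*} [AddCommGroup N] [Module B N]
    {g h : ExtScalars f M →ₗ[B] N} (H : ∀ x, g (of f x) = h (of f x)) : g = h := by
  ext z
  induction z using induction_on with
  | zero => simp
  | smul_of b x => simp [H]
  | add z w hz hw => simp [hz, hw]

theorem hom_ext₂ {f : A →+* B} {g : B →+* C} {N : Type*} [AddCommGroup N] [Module C N]
    {u v : ExtScalars g (ExtScalars f M) →ₗ[C] N} (H : ∀ x, u (of g (of f x)) = v (of g (of f x))) :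
    u = v := by
  refine hom_ext fun z => ?_
  induction z using induction_on with
  | zero => simp
  | smul_of b x => simp [H]
  | add z w hz hw => simp [hz, hw]

/-- Functoriality of extension of scalars: `f^σ` for a linear map `f`. -/
def map (f : A →+* B) (g : M →ₗ[A] N) : ExtScalars f M →ₗ[B] ExtScalars f N :=
  lift ((of f).comp g)

@[simp] theorem map_of (f : A →+* B) (g : M →ₗ[A] N) (x : M) :
    map f g (of f x) = of f (g x) := by simp [map]

theorem map_id (f : A →+* B) : map f (LinearMap.id : M →ₗ[A] M) = LinearMap.id :=
  hom_ext fun x => by simp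

theorem map_comp (f : A →+* B) {K : Type*} [AddCommGroup K] [Module A K] (h : N →ₗ[A] K)
    (g : M →ₗ[A] N) : map f (h.comp g) = (map f h).comp (map f g) :=
  hom_ext fun x => by simp

/-- Extension of scalars of a linear equivalence. -/
def congr (f : A →+* B) (e : M ≃ₗ[A] N) : ExtScalars f M ≃ₗ[B] ExtScalars f N :=
  LinearEquiv.ofLinearMap (map f e) (map f e.symm)
    (hom_ext fun x => by simp) (hom_ext fun x => by simp)

@[simp] theorem congr_of (f : A →+* B) (e : M ≃ₗ[A] N) (x : M) :
    congr f e (of f x) = of f (e x) := map_of f _ x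

@[simp] theorem congr_symm_of (f : A →+* B) (e : M ≃ₗ[A] N) (x : N) :
    (congr f e).symm (of f x) = of f (e.symm x) := map_of f _ x

/-- Transitivity: `C ⊗_{g, B} (B ⊗_{f, A} M) = C ⊗_{h, A} M` for `h = g ∘ f`. -/
def comp (f : A →+* B) (g : B →+* C) (h : A →+* C) (e : g.comp f = h)
    (M : Type*) [AddCommGroup M] [Module A M] : ExtScalars g (ExtScalars f M) ≃ₗ[C] ExtScalars h M :=
  letI := f.toAlgebra
  letI := g.toAlgebra
  letI := h.toAlgebra
  haveI : IsScalarTower A B C := IsScalarTower.of_algebraMap_eq' e.symm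
  TensorProduct.AlgebraTensorModule.cancelBaseChange A B C C M

@[simp] theorem comp_of_of (f : A →+* B) (g : B →+* C) (h : A →+* C) (e : g.comp f = h) (x : M) :
    comp f g h e M (of g (of f x)) = of h x := by
  let _ := f.toAlgebra
  let _ := g.toAlgebra
  let _ := h.toAlgebra
  have : IsScalarTower A B C := IsScalarTower.of_algebraMap_eq' e.symm
  change TensorProduct.AlgebraTensorModule.cancelBaseChange A B C C M
    ((1 : C) ⊗ₜ[B] ((1 : B) ⊗ₜ[A] x)) = (1 : C) ⊗ₜ[A] x
  rw [TensorProduct.AlgebraTensorModule.cancelBaseChange_tmul, one_smul]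

@[simp] theorem comp_symm_of (f : A →+* B) (g : B →+* C) (h : A →+* C) (e : g.comp f = h) (x : M) :
    (comp f g h e M).symm (of h x) = of g (of f x) := by
  rw [LinearEquiv.symm_apply_eq, comp_of_of]

/-- Extension of scalars along the identity. -/
def idEquiv (M : Type*) [AddCommGroup M] [Module A M] : ExtScalars (RingHom.id A) M ≃ₗ[A] M :=
  LinearEquiv.ofLinearMap (lift LinearMap.id) (of (RingHom.id A))
    (by ext x; simp) (hom_ext fun x => by simp)

/-- Extension of scalars commutes with direct sums. -/
def prod (f : A →+* B) (M N : Type*) [AddCommGroup M] [Module A M] [AddCommGroup N] [Module A N] :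
    ExtScalars f (M × N) ≃ₗ[B] ExtScalars f M × ExtScalars f N :=
  LinearEquiv.ofLinearMap
    ((map f (LinearMap.fst A M N)).prod (map f (LinearMap.snd A M N)))
    (LinearMap.coprod (map f (LinearMap.inl A M N)) (map f (LinearMap.inr A M N)))
    (by
      refine LinearMap.prod_ext (hom_ext fun x => ?_) (hom_ext fun x => ?_) <;> simp)
    (hom_ext fun x => by simp [← map_add])

@[simp] theorem prod_of (f : A →+* B) (x : M × N) :
    prod f M N (of f x) = (of f x.1, of f x.2) := by simp [prod]

@[simp] theorem prod_symm_of (f : A →+* B) (x : M) (y : N) :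
    (prod f M N).symm (of f x, of f y) = of f (x, y) := by
  rw [LinearEquiv.symm_apply_eq, prod_of]

end ExtScalars

/-! ### Frames and windows -/

/-- A frame `(𝒮, I, S, σ, σᵈⁱᵛ)`: a ring `𝒮`, an `𝒮`-module `I` with a linear map `ι : I → 𝒮`, a
quotient `π : 𝒮 → S`, a ring homomorphism `σ : 𝒮 → S` and a `σ`-linear map `σᵈⁱᵛ : I → S` with
`p · σᵈⁱᵛ(x) = σ(ι x)`. (That `ι` has image in the Jacobson radical, as it does for the Witt frames
of `p`-nilpotent rings, plays no role in the definition of windows and is not recorded.) -/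
structure Frame (p : ℕ) where
  /-- the ring `𝒮` -/
  carrier : Type u
  /-- the quotient `S` of `𝒮` -/
  quot : Type u
  /-- the `𝒮`-module `I` -/
  fil : Type u
  [commRingCarrier : CommRing carrier]
  [commRingQuot : CommRing quot]
  [addCommGroupFil : AddCommGroup fil]
  [moduleFil : Module carrier fil]
  /-- the map `I → 𝒮` -/
  ι : fil →ₗ[carrier] carrier
  /-- the projection `𝒮 → S` -/
  π : carrier →+* quot
  π_surjective : Function.Surjective π
  /-- the Frobenius `𝒮 → S` -/
  σ : carrier →+* quot
  /-- the divided Frobenius `I → S` -/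
  σdiv : fil →ₛₗ[σ] quot
  p_mul_σdiv : ∀ x, (p : quot) * σdiv x = σ (ι x)

attribute [instance] Frame.commRingCarrier Frame.commRingQuot Frame.addCommGroupFil Frame.moduleFil

variable {p : ℕ}

namespace Frame

/-- The map `I ⊗ M → M`, `i ⊗ x ↦ ι(i) x`. -/
def act (F : Frame.{u} p) (M : Type*) [AddCommGroup M] [Module F.carrier M] :
    F.fil ⊗[F.carrier] M →ₗ[F.carrier] M :=
  TensorProduct.lift ((LinearMap.lsmul F.carrier M).comp F.ι)

@[simp] theorem act_tmul (F : Frame.{u} p) {M : Type*} [AddCommGroup M] [Module F.carrier M]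
    (i : F.fil) (x : M) : F.act M (i ⊗ₜ x) = F.ι i • x := rfl

/-- The `σ`-linear map `I ⊗ M → M^σ`, `i ⊗ x ↦ σᵈⁱᵛ(i) ⊗ x`. -/
def divAct (F : Frame.{u} p) (M : Type*) [AddCommGroup M] [Module F.carrier M] :
    F.fil ⊗[F.carrier] M →ₛₗ[F.σ] ExtScalars F.σ M :=
  TensorProduct.lift (LinearMap.mk₂'ₛₗ F.σ F.σ (fun i x => F.σdiv i • ExtScalars.of F.σ x)
    (fun i j x => by simp [add_smul]) (fun c i x => by simp [mul_smul])
    (fun i x y => by simp) (fun c i x => by simp [smul_smul, mul_comm]))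

@[simp] theorem divAct_tmul (F : Frame.{u} p) {M : Type*} [AddCommGroup M] [Module F.carrier M]
    (i : F.fil) (x : M) : F.divAct M (i ⊗ₜ x) = F.σdiv i • ExtScalars.of F.σ x := rfl

/-- Morphisms of frames. -/
structure Hom (F G : Frame.{u} p) where
  /-- the map `𝒮 → 𝒮'` -/
  ring : F.carrier →+* G.carrier
  /-- the map `S → S'` -/
  quot : F.quot →+* G.quot
  /-- the map `I → I'` -/
  fil : F.fil →ₛₗ[ring] G.fil
  ι_fil : ∀ x, G.ι (fil x) = ring (F.ι x)
  π_ring : G.π.comp ring = quot.comp F.π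
  σ_ring : G.σ.comp ring = quot.comp F.σ
  σdiv_fil : ∀ x, G.σdiv (fil x) = quot (F.σdiv x)

end Frame

/-- A window over the frame `F`: a finite projective `(𝒮, I)`-module `(T, L)`, together with an
isomorphism `Ψ : T^σ ⊕ L^σ → S ⊗ (T ⊕ L)` of `S`-modules. -/
structure Window (F : Frame.{u} p) where
  /-- the finite projective `𝒮`-module `T` -/
  T : Type u
  /-- the finite projective `𝒮`-module `L` -/
  L : Type u
  [addCommGroupT : AddCommGroup T]
  [addCommGroupL : AddCommGroup L]
  [moduleT : Module F.carrier T]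
  [moduleL : Module F.carrier L]
  [finiteT : Module.Finite F.carrier T]
  [finiteL : Module.Finite F.carrier L]
  [projectiveT : Module.Projective F.carrier T]
  [projectiveL : Module.Projective F.carrier L]
  /-- the structure isomorphism -/
  Ψ : (ExtScalars F.σ T × ExtScalars F.σ L) ≃ₗ[F.quot] ExtScalars F.π (T × L)

namespace Window

attribute [instance] addCommGroupT addCommGroupL moduleT moduleL finiteT finiteL
  projectiveT projectiveL

variable {F G : Frame.{u} p}

/-- Matrices `[a b; c d]` with `a : T → T'`, `b : L → I ⊗ T'`, `c : T → L'`, `d : L → L'`, i.e.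
morphisms of the finite projective `(𝒮, I)`-modules that underlie two windows. -/
@[ext] structure PreHom (P Q : Window F) where
  /-- the entry `T → T'` -/
  a : P.T →ₗ[F.carrier] Q.T
  /-- the entry `L → I ⊗ T'` -/
  b : P.L →ₗ[F.carrier] F.fil ⊗[F.carrier] Q.T
  /-- the entry `T → L'` -/
  c : P.T →ₗ[F.carrier] Q.L
  /-- the entry `L → L'` -/
  d : P.L →ₗ[F.carrier] Q.L

namespace PreHom

variable {P Q R : Window F}

/-- The underlying homomorphism `T ⊕ L → T' ⊕ L'` of `𝒮`-modules. -/
def toLin (f : PreHom P Q) : P.T × P.L →ₗ[F.carrier] Q.T × Q.L :=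
  (f.a.coprod ((F.act Q.T).comp f.b)).prod (f.c.coprod f.d)

/-- The homomorphism `f^σ = [a^σ b^{σ,div}; p c^σ d^σ]` from `T^σ ⊕ L^σ` to `T'^σ ⊕ L'^σ`. -/
def sigma (f : PreHom P Q) :
    ExtScalars F.σ P.T × ExtScalars F.σ P.L →ₗ[F.quot] ExtScalars F.σ Q.T × ExtScalars F.σ Q.L :=
  ((ExtScalars.map F.σ f.a).coprod (ExtScalars.lift ((F.divAct Q.T).comp f.b))).prod
    (((p : F.quot) • ExtScalars.map F.σ f.c).coprod (ExtScalars.map F.σ f.d))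

/-- The identity matrix. -/
def id (P : Window F) : PreHom P P := ⟨LinearMap.id, 0, 0, LinearMap.id⟩

/-- The matrix product. -/
def comp (g : PreHom Q R) (f : PreHom P Q) : PreHom P R where
  a := g.a.comp f.a + (F.act R.T).comp (g.b.comp f.c)
  b := (LinearMap.lTensor F.fil g.a).comp f.b + g.b.comp f.d
  c := g.c.comp f.a + g.d.comp f.c
  d := g.c.comp ((F.act Q.T).comp f.b) + g.d.comp f.d

@[simp] theorem toLin_apply (f : PreHom P Q) (x : P.T × P.L) :
    f.toLin x = (f.a x.1 + F.act Q.T (f.b x.2), f.c x.1 + f.d x.2) := rfl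

theorem toLin_id (P : Window F) : (id P).toLin = LinearMap.id := by
  ext x <;> simp [id]

theorem act_lTensor {M N : Type u} [AddCommGroup M] [Module F.carrier M] [AddCommGroup N]
    [Module F.carrier N] (g : M →ₗ[F.carrier] N) (z : F.fil ⊗[F.carrier] M) :
    F.act N (LinearMap.lTensor F.fil g z) = g (F.act M z) := by
  induction z using TensorProduct.induction_on with
  | zero => simp
  | tmul i x => simp
  | add z w hz hw => simp [hz, hw]

theorem divAct_lTensor {M N : Type u} [AddCommGroup M] [Module F.carrier M] [AddCommGroup N]
    [Module F.carrier N] (g : M →ₗ[F.carrier] N) (z : F.fil ⊗[F.carrier] M) :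
    F.divAct N (LinearMap.lTensor F.fil g z) = ExtScalars.map F.σ g (F.divAct M z) := by
  induction z using TensorProduct.induction_on with
  | zero => simp
  | tmul i x => simp
  | add z w hz hw => simp [hz, hw]

theorem p_smul_divAct {M : Type u} [AddCommGroup M] [Module F.carrier M]
    (z : F.fil ⊗[F.carrier] M) :
    (p : F.quot) • F.divAct M z = ExtScalars.of F.σ (F.act M z) := by
  induction z using TensorProduct.induction_on with
  | zero => simp
  | tmul i x => simp [smul_smul, F.p_mul_σdiv]
  | add z w hz hw => simp [hz, hw]

theorem toLin_comp (g : PreHom Q R) (f : PreHom P Q) :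
    (g.comp f).toLin = g.toLin.comp f.toLin := by
  ext x <;> simp [comp, act_lTensor]

theorem sigma_left (f : PreHom P Q) (x : P.T) :
    f.sigma (ExtScalars.of F.σ x, 0) =
      (ExtScalars.of F.σ (f.a x), (p : F.quot) • ExtScalars.of F.σ (f.c x)) := by
  simp [sigma]

theorem sigma_right (f : PreHom P Q) (x : P.L) :
    f.sigma (0, ExtScalars.of F.σ x) =
      (F.divAct Q.T (f.b x), ExtScalars.of F.σ (f.d x)) := by
  simp [sigma]

theorem sigma_apply (f : PreHom P Q) (z : ExtScalars F.σ P.T × ExtScalars F.σ P.L) :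
    f.sigma z = (ExtScalars.map F.σ f.a z.1 + ExtScalars.lift ((F.divAct Q.T).comp f.b) z.2,
      (p : F.quot) • ExtScalars.map F.σ f.c z.1 + ExtScalars.map F.σ f.d z.2) := rfl

theorem sigma_id (P : Window F) : (id P).sigma = LinearMap.id := by
  refine LinearMap.prod_ext (ExtScalars.hom_ext fun x => ?_) (ExtScalars.hom_ext fun x => ?_) <;>
    simp [id, sigma]

theorem sigma_comp (g : PreHom Q R) (f : PreHom P Q) :
    (g.comp f).sigma = g.sigma.comp f.sigma := by
  refine LinearMap.prod_ext (ExtScalars.hom_ext fun x => ?_) (ExtScalars.hom_ext fun x => ?_)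
  · rw [LinearMap.comp_apply, LinearMap.comp_apply, LinearMap.comp_apply, LinearMap.inl_apply,
      sigma_left, sigma_left, sigma_apply, map_smul, map_smul, ExtScalars.map_of,
      ExtScalars.map_of, ExtScalars.map_of, ExtScalars.lift_of, LinearMap.comp_apply,
      p_smul_divAct, ← smul_add, ← map_add, ← map_add]
    rfl
  · rw [LinearMap.comp_apply, LinearMap.comp_apply, LinearMap.comp_apply, LinearMap.inr_apply,
      sigma_right, sigma_right, sigma_apply, ← map_smul, p_smul_divAct, ExtScalars.map_of,
      ExtScalars.map_of, ExtScalars.lift_of, LinearMap.comp_apply, ← divAct_lTensor, ← map_add,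
      ← map_add]
    rfl

end PreHom

/-- Morphisms of windows: morphisms `f` of finite projective `(𝒮, I)`-modules such that
`(S ⊗ f) ∘ Ψ = Ψ' ∘ f^σ`. -/
@[ext] structure Hom (P Q : Window F) extends PreHom P Q where
  comm : (ExtScalars.map F.π toPreHom.toLin).comp P.Ψ.toLinearMap =
    Q.Ψ.toLinearMap.comp toPreHom.sigma

namespace Hom

variable {P Q R : Window F}

theorem comm_apply (f : Hom P Q) (z : ExtScalars F.σ P.T × ExtScalars F.σ P.L) :
    ExtScalars.map F.π f.toLin (P.Ψ z) = Q.Ψ (f.sigma z) :=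
  LinearMap.congr_fun f.comm z

/-- The identity morphism. -/
def id (P : Window F) : Hom P P where
  toPreHom := PreHom.id P
  comm := by
    rw [PreHom.toLin_id, PreHom.sigma_id, ExtScalars.map_id, LinearMap.id_comp, LinearMap.comp_id]

/-- Composition of morphisms. -/
def comp (g : Hom Q R) (f : Hom P Q) : Hom P R where
  toPreHom := g.toPreHom.comp f.toPreHom
  comm := by
    rw [PreHom.toLin_comp, PreHom.sigma_comp, ExtScalars.map_comp, LinearMap.comp_assoc, f.comm,
      ← LinearMap.comp_assoc, g.comm, LinearMap.comp_assoc]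

/-- A morphism of windows is an isomorphism if it has a two-sided inverse. -/
def IsIso (f : Hom P Q) : Prop := ∃ g : Hom Q P, g.comp f = id P ∧ f.comp g = id Q

end Hom
end Window

/-! ### Base change of windows along morphisms of frames -/

namespace Window

variable {F G : Frame.{u} p}

section

variable (α : Frame.Hom F G)

/-- The identification `(𝒮' ⊗ M)^σ' = S' ⊗ M^σ`. -/
def twistEquiv (M : Type u) [AddCommGroup M] [Module F.carrier M] :
    ExtScalars G.σ (ExtScalars α.ring M) ≃ₗ[G.quot] ExtScalars α.quot (ExtScalars F.σ M) :=
  (ExtScalars.comp α.ring G.σ (α.quot.comp F.σ) α.σ_ring M).trans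
    (ExtScalars.comp F.σ α.quot (α.quot.comp F.σ) rfl M).symm

@[simp] theorem twistEquiv_of {M : Type u} [AddCommGroup M] [Module F.carrier M] (x : M) :
    twistEquiv α M (ExtScalars.of _ (ExtScalars.of _ x)) =
      ExtScalars.of _ (ExtScalars.of _ x) := by
  simp [twistEquiv]

/-- The identification `S' ⊗ (S ⊗ M) = S' ⊗ (𝒮' ⊗ M)`. -/
def quotEquiv (M : Type u) [AddCommGroup M] [Module F.carrier M] :
    ExtScalars α.quot (ExtScalars F.π M) ≃ₗ[G.quot] ExtScalars G.π (ExtScalars α.ring M) :=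
  (ExtScalars.comp F.π α.quot (α.quot.comp F.π) rfl M).trans
    (ExtScalars.comp α.ring G.π (α.quot.comp F.π) α.π_ring M).symm

@[simp] theorem quotEquiv_of {M : Type u} [AddCommGroup M] [Module F.carrier M] (x : M) :
    quotEquiv α M (ExtScalars.of _ (ExtScalars.of _ x)) =
      ExtScalars.of _ (ExtScalars.of _ x) := by
  simp [quotEquiv]

/-- The identification of `(T')^σ' ⊕ (L')^σ'` with `S' ⊗ (T^σ ⊕ L^σ)`,
where `T' = 𝒮' ⊗ T` and `L' = 𝒮' ⊗ L`. -/
def sourceEquiv (P : Window F) :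
    (ExtScalars G.σ (ExtScalars α.ring P.T) × ExtScalars G.σ (ExtScalars α.ring P.L)) ≃ₗ[G.quot]
      ExtScalars α.quot (ExtScalars F.σ P.T × ExtScalars F.σ P.L) :=
  ((twistEquiv α P.T).prodCongr (twistEquiv α P.L)).trans (ExtScalars.prod α.quot _ _).symm

/-- The identification of `S' ⊗ (S ⊗ (T ⊕ L))` with `S' ⊗ (T' ⊕ L')`,
where `T' = 𝒮' ⊗ T` and `L' = 𝒮' ⊗ L`. -/
def targetEquiv (P : Window F) :
    ExtScalars α.quot (ExtScalars F.π (P.T × P.L)) ≃ₗ[G.quot]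
      ExtScalars G.π (ExtScalars α.ring P.T × ExtScalars α.ring P.L) :=
  (quotEquiv α (P.T × P.L)).trans (ExtScalars.congr G.π (ExtScalars.prod α.ring P.T P.L))

/-- The base change of a window along a morphism of frames. -/
abbrev baseChange (P : Window F) : Window G where
  T := ExtScalars α.ring P.T
  L := ExtScalars α.ring P.L
  Ψ := (sourceEquiv α P).trans ((ExtScalars.congr α.quot P.Ψ).trans (targetEquiv α P))

/-- The base change of a matrix `[a b; c d]`. -/
abbrev PreHom.baseChange {P Q : Window F} (f : PreHom P Q) :
    PreHom (P.baseChange α) (Q.baseChange α) where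
  a := ExtScalars.map α.ring f.a
  b := ExtScalars.lift ((TensorProduct.map α.fil (ExtScalars.of α.ring)).comp f.b)
  c := ExtScalars.map α.ring f.c
  d := ExtScalars.map α.ring f.d

theorem act_map {M : Type u} [AddCommGroup M] [Module F.carrier M] (z : F.fil ⊗[F.carrier] M) :
    G.act (ExtScalars α.ring M) (TensorProduct.map α.fil (ExtScalars.of α.ring) z) =
      ExtScalars.of α.ring (F.act M z) := by
  induction z using TensorProduct.induction_on with
  | zero => simp
  | tmul i x => simp [α.ι_fil]
  | add z w hz hw => simp [hz, hw]

theorem divAct_map {M : Type u} [AddCommGroup M] [Module F.carrier M]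
    (z : F.fil ⊗[F.carrier] M) :
    twistEquiv α M
        (G.divAct (ExtScalars α.ring M) (TensorProduct.map α.fil (ExtScalars.of α.ring) z)) =
      ExtScalars.of α.quot (F.divAct M z) := by
  induction z using TensorProduct.induction_on with
  | zero => simp
  | tmul i x => simp [α.σdiv_fil]
  | add z w hz hw => simp [hz, hw]

theorem targetEquiv_of (P : Window F) (z : P.T × P.L) :
    targetEquiv α P (ExtScalars.of _ (ExtScalars.of _ z)) =
      ExtScalars.of _ (ExtScalars.of _ z.1, ExtScalars.of _ z.2) := by
  simp [targetEquiv]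

theorem PreHom.toLin_baseChange_of {P Q : Window F} (f : PreHom P Q) (x : P.T) (y : P.L) :
    (f.baseChange α).toLin (ExtScalars.of α.ring x, ExtScalars.of α.ring y) =
      (ExtScalars.of α.ring (f.toLin (x, y)).1, ExtScalars.of α.ring (f.toLin (x, y)).2) := by
  refine Prod.ext ?_ ?_
  · change ExtScalars.map α.ring f.a (ExtScalars.of α.ring x) + G.act (ExtScalars α.ring Q.T)
      (ExtScalars.lift _ (ExtScalars.of α.ring y)) = _
    simp [act_map]
  · change ExtScalars.map α.ring f.c (ExtScalars.of α.ring x) +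
      ExtScalars.map α.ring f.d (ExtScalars.of α.ring y) = _
    simp

theorem PreHom.target_comm {P Q : Window F} (f : PreHom P Q)
    (z : ExtScalars α.quot (ExtScalars F.π (P.T × P.L))) :
    ExtScalars.map G.π (f.baseChange α).toLin (targetEquiv α P z) =
      targetEquiv α Q (ExtScalars.map α.quot (ExtScalars.map F.π f.toLin) z) := by
  induction z using ExtScalars.induction_on with
  | zero => simp
  | add z w hz hw => simp only [map_add, hz, hw]
  | smul_of b w =>
    simp only [map_smul]
    congr 1
    obtain ⟨w, rfl⟩ : ∃ v, ExtScalars.of F.π v = w := by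
      induction w using ExtScalars.induction_on with
      | zero => exact ⟨0, map_zero _⟩
      | add z w hz hw =>
        obtain ⟨z, rfl⟩ := hz
        obtain ⟨w, rfl⟩ := hw
        exact ⟨z + w, map_add _ _ _⟩
      | smul_of s v =>
        obtain ⟨s, rfl⟩ := F.π_surjective s
        exact ⟨s • v, LinearMap.map_smulₛₗ _ _ _⟩
    rw [targetEquiv_of, ExtScalars.map_of, ExtScalars.map_of, ExtScalars.map_of, targetEquiv_of,
      PreHom.toLin_baseChange_of]

theorem sourceEquiv_of_left (P : Window F) (x : P.T) :
    sourceEquiv α P (ExtScalars.of _ (ExtScalars.of _ x), 0) =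
      ExtScalars.of _ (ExtScalars.of _ x, 0) := by
  rw [sourceEquiv, LinearEquiv.trans_apply, LinearEquiv.symm_apply_eq]
  simp

theorem sourceEquiv_of_right (P : Window F) (x : P.L) :
    sourceEquiv α P (0, ExtScalars.of _ (ExtScalars.of _ x)) =
      ExtScalars.of _ (0, ExtScalars.of _ x) := by
  rw [sourceEquiv, LinearEquiv.trans_apply, LinearEquiv.symm_apply_eq]
  simp

theorem PreHom.source_comm {P Q : Window F} (f : PreHom P Q) :
    (sourceEquiv α Q).toLinearMap.comp (f.baseChange α).sigma =
      (ExtScalars.map α.quot f.sigma).comp (sourceEquiv α P).toLinearMap := by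
  refine LinearMap.prod_ext (ExtScalars.hom_ext₂ fun x => ?_) (ExtScalars.hom_ext₂ fun x => ?_)
  · simp only [LinearMap.comp_apply, LinearMap.inl_apply, LinearEquiv.coe_coe, sourceEquiv_of_left]
    simp [sigma, sourceEquiv, LinearEquiv.symm_apply_eq]
  · simp only [LinearMap.comp_apply, LinearMap.inr_apply, LinearEquiv.coe_coe, sourceEquiv_of_right]
    simp [sigma, sourceEquiv, divAct_map]

/-- The base change of a morphism of windows along a morphism of frames. -/
def Hom.baseChange {P Q : Window F} (f : Hom P Q) : Hom (P.baseChange α) (Q.baseChange α) where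
  toPreHom := f.toPreHom.baseChange α
  comm := by
    refine LinearMap.ext fun z => ?_
    change ExtScalars.map G.π (f.toPreHom.baseChange α).toLin (targetEquiv α P
        (ExtScalars.map α.quot P.Ψ.toLinearMap (sourceEquiv α P z))) =
      targetEquiv α Q (ExtScalars.map α.quot Q.Ψ.toLinearMap
        (sourceEquiv α Q ((f.toPreHom.baseChange α).sigma z)))
    have h := LinearMap.congr_fun (PreHom.source_comm α f.toPreHom) z
    simp only [LinearMap.comp_apply, LinearEquiv.coe_coe] at h
    rw [PreHom.target_comm, h, ← LinearMap.comp_apply, ← LinearMap.comp_apply,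
      ← ExtScalars.map_comp, ← ExtScalars.map_comp, f.comm]

end

end Window

/-! ### The Witt frames -/

section Witt

open WittVector

variable (p) [hp : Fact p.Prime] (R : Type u) [CommRing R]

/-- The augmentation ideal `I_R = ker(W(R) → R)`. -/
def augIdeal : Ideal (WittVector p R) := RingHom.ker (constantCoeff : WittVector p R →+* R)

variable {p R}

theorem mem_augIdeal {x : WittVector p R} : x ∈ augIdeal p R ↔ x.coeff 0 = 0 := Iff.rfl

theorem verschiebung_mem_augIdeal (x : WittVector p R) : verschiebung x ∈ augIdeal p R :=
  verschiebung_coeff_zero x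

theorem verschiebung_shift_one {x : WittVector p R} (hx : x ∈ augIdeal p R) :
    verschiebung (x.shift 1) = x := by
  ext i
  cases i with
  | zero => rw [verschiebung_coeff_zero]; exact (mem_augIdeal.1 hx).symm
  | succ i => rw [verschiebung_coeff_succ, shift_coeff, add_comm]

theorem shift_one_verschiebung (x : WittVector p R) : (verschiebung x).shift 1 = x := by
  ext i
  rw [shift_coeff, add_comm, verschiebung_coeff_succ]

variable (p R)

/-- The divided Frobenius `I_R → W(R)`, the inverse of the Verschiebung. -/
def frobDiv : augIdeal p R →ₛₗ[(frobenius : WittVector p R →+* WittVector p R)]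
    WittVector p R where
  toFun x := (x : WittVector p R).shift 1
  map_add' x y := verschiebung_injective _ _ (by
    rw [map_add, verschiebung_shift_one x.2, verschiebung_shift_one y.2,
      verschiebung_shift_one (x + y).2, Submodule.coe_add])
  map_smul' a x := verschiebung_injective _ _ (by
    rw [verschiebung_shift_one (a • x).2, smul_eq_mul, mul_comm, verschiebung_mul_frobenius,
      verschiebung_shift_one x.2, mul_comm, Submodule.coe_smul, smul_eq_mul])

/-- The Witt frame `(W(R), I_R, W(R), F, V⁻¹)`. -/
abbrev wittFrame : Frame.{u} p where
  carrier := WittVector p R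
  quot := WittVector p R
  fil := augIdeal p R
  ι := (augIdeal p R).subtype
  π := RingHom.id _
  π_surjective := Function.surjective_id
  σ := frobenius
  σdiv := frobDiv p R
  p_mul_σdiv x := by
    change (p : WittVector p R) * (x : WittVector p R).shift 1 = frobenius (x : WittVector p R)
    conv_rhs => rw [← verschiebung_shift_one x.2, frobenius_verschiebung, mul_comm]

variable {R}

/-- The morphism of Witt frames induced by a ring homomorphism. -/
def wittFrameMap {R' : Type u} [CommRing R'] (φ : R →+* R') :
    Frame.Hom (wittFrame p R) (wittFrame p R') where
  ring := WittVector.map φ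
  quot := WittVector.map φ
  fil :=
    { toFun := fun x => ⟨WittVector.map φ x, by
        rw [mem_augIdeal, map_coeff, mem_augIdeal.1 x.2, map_zero]⟩
      map_add' := fun x y => Subtype.ext (map_add _ _ _)
      map_smul' := fun a x => Subtype.ext (map_mul _ _ _) }
  ι_fil _ := rfl
  π_ring := rfl
  σ_ring := by
    refine RingHom.ext fun x => ?_
    exact ((frobenius_isPoly p).map φ x).symm
  σdiv_fil x := by
    ext i
    change (WittVector.shift (WittVector.map φ (x : WittVector p R)) 1).coeff i =
      (WittVector.map φ (WittVector.shift (x : WittVector p R) 1)).coeff i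
    rw [shift_coeff, map_coeff, map_coeff, shift_coeff]

variable (R)

variable {p R}

theorem coeff_add_of_low {n : ℕ} {x y : WittVector p R} (hx : ∀ i < n, x.coeff i = 0)
    (hy : ∀ i < n, y.coeff i = 0) :
    (∀ i < n, (x + y).coeff i = 0) ∧ (x + y).coeff n = x.coeff n + y.coeff n := by
  have h : x + y = verschiebung^[n] (x.shift n + y.shift n) := by
    rw [iterate_map_add, ← eq_iterate_verschiebung hx, ← eq_iterate_verschiebung hy]
  refine ⟨fun i hi => by rw [h, iterate_verschiebung_coeff_eq_zero _ hi], ?_⟩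
  have h' := iterate_verschiebung_coeff (x.shift n + y.shift n) n 0
  rw [zero_add] at h'
  rw [h, h']
  have h₀ := map_add (constantCoeff : WittVector p R →+* R) (x.shift n) (y.shift n)
  exact h₀

theorem coeff_mul_of_low {n : ℕ} (a : WittVector p R) {x : WittVector p R}
    (hx : ∀ i < n, x.coeff i = 0) :
    (∀ i < n, (a * x).coeff i = 0) ∧
      (a * x).coeff n = x.coeff n * (frobenius^[n] a).coeff 0 := by
  have h : a * x = verschiebung^[n] (x.shift n * frobenius^[n] a) := by
    rw [mul_comm, ← iterate_verschiebung_mul_left, ← eq_iterate_verschiebung hx]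
  refine ⟨fun i hi => by rw [h, iterate_verschiebung_coeff_eq_zero _ hi], ?_⟩
  have h' := iterate_verschiebung_coeff (x.shift n * frobenius^[n] a) n 0
  rw [zero_add] at h'
  rw [h, h']
  have h₀ := map_mul (constantCoeff : WittVector p R →+* R) (x.shift n) (frobenius^[n] a)
  exact h₀

theorem coeff_zero_iterate_frobenius_verschiebung (n : ℕ) (z : WittVector p R) :
    ∃ c, (frobenius^[n] (verschiebung z)).coeff 0 = (p : R) * c := by
  cases n with
  | zero => exact ⟨0, by simp⟩
  | succ n =>
    refine ⟨(frobenius^[n] z).coeff 0, ?_⟩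
    rw [Function.iterate_succ_apply, frobenius_verschiebung, mul_comm, iterate_map_mul,
      Function.iterate_fixed (map_natCast (WittVector.frobenius : WittVector p R →+* WittVector p R) p)]
    have h := map_mul (constantCoeff : WittVector p R →+* R) (p : WittVector p R)
      (frobenius^[n] z)
    rw [map_natCast] at h
    exact h

theorem frobenius_coeff_of_low {n : ℕ} {x : WittVector p R} (hx : ∀ i < n, x.coeff i = 0)
    (hp : (p : R) * x.coeff n = 0) : ∀ i < n, (frobenius x).coeff i = 0 := by
  cases n with
  | zero => intro i hi; exact absurd hi (Nat.not_lt_zero i)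
  | succ n =>
    have h : frobenius x = (p : WittVector p R) * x.shift 1 := by
      rw [mul_comm, ← frobenius_verschiebung, verschiebung_shift_one]
      exact hx 0 (Nat.succ_pos n)
    have hs : ∀ i < n, (x.shift 1).coeff i = 0 := fun i hi => by
      rw [shift_coeff]; exact hx _ (by omega)
    obtain ⟨h₁, h₂⟩ := coeff_mul_of_low (p : WittVector p R) hs
    intro i hi
    rw [h]
    rcases Nat.lt_succ_iff_lt_or_eq.1 hi with hi | rfl
    · exact h₁ i hi
    · rw [h₂, Function.iterate_fixed (map_natCast (WittVector.frobenius : WittVector p R →+* WittVector p R) p), shift_coeff, add_comm 1 i, mul_comm]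
      have h₀ := map_natCast (constantCoeff : WittVector p R →+* R) p
      change (p : WittVector p R).coeff 0 = p at h₀
      rw [h₀, hp]

variable (p R)

/-- The augmentation ideal `I_{n+1,R} = ker(W_{n+1}(R) → R)`. -/
def truncAugIdeal (n : ℕ) : Ideal (TruncatedWittVector p (n + 1) R) where
  carrier := {x | TruncatedWittVector.coeff 0 x = 0}
  zero_mem' := TruncatedWittVector.coeff_zero _ _ _ 0
  add_mem' := by
    intro x y hx hy
    obtain ⟨x, rfl⟩ := WittVector.truncate_surjective p (n + 1) R x
    obtain ⟨y, rfl⟩ := WittVector.truncate_surjective p (n + 1) R y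
    simp only [Set.mem_ofPred_eq, WittVector.coeff_truncate, ← map_add, Fin.val_zero] at *
    exact (augIdeal p R).add_mem hx hy
  smul_mem' := by
    intro a x hx
    obtain ⟨x, rfl⟩ := WittVector.truncate_surjective p (n + 1) R x
    obtain ⟨a, rfl⟩ := WittVector.truncate_surjective p (n + 1) R a
    simp only [Set.mem_ofPred_eq, WittVector.coeff_truncate, smul_eq_mul, ← map_mul,
      Fin.val_zero] at *
    exact (augIdeal p R).mul_mem_left a hx

/-- The ideal `(0, …, 0, R[p])` of `W_{n+1}(R)`. -/
def lastTorsion (n : ℕ) : Ideal (TruncatedWittVector p (n + 1) R) where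
  carrier := {x | (∀ i : Fin (n + 1), (i : ℕ) < n → TruncatedWittVector.coeff i x = 0) ∧
    (p : R) * TruncatedWittVector.coeff (Fin.last n) x = 0}
  zero_mem' := ⟨fun i _ => TruncatedWittVector.coeff_zero _ _ _ i, by
    rw [TruncatedWittVector.coeff_zero, mul_zero]⟩
  add_mem' := by
    intro x y hx hy
    obtain ⟨x, rfl⟩ := WittVector.truncate_surjective p (n + 1) R x
    obtain ⟨y, rfl⟩ := WittVector.truncate_surjective p (n + 1) R y
    simp only [Set.mem_ofPred_eq, WittVector.coeff_truncate, ← map_add, Fin.val_last] at *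
    obtain ⟨h₁, h₂⟩ := coeff_add_of_low (n := n) (fun i hi => hx.1 ⟨i, by omega⟩ hi)
      (fun i hi => hy.1 ⟨i, by omega⟩ hi)
    exact ⟨fun i hi => h₁ i hi, by rw [h₂, mul_add, hx.2, hy.2, add_zero]⟩
  smul_mem' := by
    intro a x hx
    obtain ⟨x, rfl⟩ := WittVector.truncate_surjective p (n + 1) R x
    obtain ⟨a, rfl⟩ := WittVector.truncate_surjective p (n + 1) R a
    simp only [Set.mem_ofPred_eq, WittVector.coeff_truncate, smul_eq_mul, ← map_mul,
      Fin.val_last] at *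
    obtain ⟨h₁, h₂⟩ := coeff_mul_of_low (n := n) a (fun i hi => hx.1 ⟨i, by omega⟩ hi)
    exact ⟨fun i hi => h₁ i hi, by rw [h₂, ← mul_assoc, hx.2, zero_mul]⟩

variable {p R}

theorem exists_of_mem_truncAugIdeal {n : ℕ} {x : TruncatedWittVector p (n + 1) R}
    (hx : x ∈ truncAugIdeal p R n) : ∃ z : WittVector p R,
      x = WittVector.truncate (n + 1) (verschiebung z) := by
  obtain ⟨x, rfl⟩ := WittVector.truncate_surjective p (n + 1) R x
  refine ⟨x.shift 1, ?_⟩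
  rw [verschiebung_shift_one]
  change TruncatedWittVector.coeff 0 (WittVector.truncate (n + 1) x) = 0 at hx
  rwa [WittVector.coeff_truncate] at hx

theorem truncate_mem_truncAugIdeal (n : ℕ) {x : WittVector p R} (hx : x ∈ augIdeal p R) :
    WittVector.truncate (n + 1) x ∈ truncAugIdeal p R n := by
  change TruncatedWittVector.coeff 0 (WittVector.truncate (n + 1) x) = 0
  rw [WittVector.coeff_truncate]
  exact hx

theorem exists_of_mem_lastTorsion {n : ℕ} {x : TruncatedWittVector p (n + 1) R}
    (hx : x ∈ lastTorsion p R n) : ∃ z : WittVector p R, x = WittVector.truncate (n + 1) z ∧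
      (∀ i < n, z.coeff i = 0) ∧ (p : R) * z.coeff n = 0 := by
  obtain ⟨x, rfl⟩ := WittVector.truncate_surjective p (n + 1) R x
  refine ⟨x, rfl, fun i hi => ?_, ?_⟩
  · rw [← hx.1 ⟨i, by omega⟩ hi, WittVector.coeff_truncate]
  · rw [← hx.2, WittVector.coeff_truncate, Fin.val_last]

theorem truncate_eq_zero_iff {n : ℕ} {x : WittVector p R} :
    WittVector.truncate n x = 0 ↔ ∀ i < n, x.coeff i = 0 := by
  rw [← RingHom.mem_ker, WittVector.mem_ker_truncate]

variable (p R)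

/-- The Frobenius `W_{n+1}(R) → W_n(R)`. -/
def truncFrob (n : ℕ) : TruncatedWittVector p (n + 1) R →+* TruncatedWittVector p n R :=
  RingHom.liftOfRightInverse (WittVector.truncate (n + 1)) TruncatedWittVector.out
    TruncatedWittVector.truncateFun_out
    ⟨(WittVector.truncate n).comp frobenius, fun x hx => by
      rw [RingHom.mem_ker, truncate_eq_zero_iff] at hx
      rw [RingHom.mem_ker, RingHom.comp_apply, truncate_eq_zero_iff]
      exact frobenius_coeff_of_low (fun i hi => hx i (by omega)) (by rw [hx n (by omega), mul_zero])⟩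

variable {p R}

theorem truncFrob_truncate (n : ℕ) (x : WittVector p R) :
    truncFrob p R n (WittVector.truncate (n + 1) x) = WittVector.truncate n (frobenius x) :=
  RingHom.liftOfRightInverse_comp_apply _ _ _ _ x

variable (p R)

/-- The ring `𝒲_n(R) = W_{n+1}(R) / (0, …, 0, R[p])`. -/
abbrev TruncWitt (n : ℕ) : Type u := TruncatedWittVector p (n + 1) R ⧸ lastTorsion p R n

variable {p R}

theorem isTorsionBySet_truncAugIdeal (n : ℕ) :
    Module.IsTorsionBySet (TruncatedWittVector p (n + 1) R) (truncAugIdeal p R n)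
      (lastTorsion p R n) := by
  rintro ⟨x, hx⟩ ⟨a, ha⟩
  obtain ⟨x, rfl⟩ := exists_of_mem_truncAugIdeal hx
  obtain ⟨a, rfl, ha₁, ha₂⟩ := exists_of_mem_lastTorsion ha
  refine Subtype.ext ?_
  change WittVector.truncate (n + 1) a * WittVector.truncate (n + 1) (verschiebung x) = 0
  rw [← map_mul, mul_comm, truncate_eq_zero_iff]
  obtain ⟨h₁, h₂⟩ := coeff_mul_of_low (verschiebung x) ha₁
  intro i hi
  rcases Nat.lt_succ_iff_lt_or_eq.1 hi with hi | rfl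
  · exact h₁ i hi
  · obtain ⟨c, hc⟩ := coeff_zero_iterate_frobenius_verschiebung i x
    rw [h₂, hc, ← mul_assoc, mul_comm _ (p : R), ha₂, zero_mul]

/-- The `A / J`-module structure on an `A`-module that is killed by `J`. -/
@[reducible] def quotModule {A M : Type*} [CommRing A] [AddCommGroup M] [Module A M] (J : Ideal A)
    (h : Module.IsTorsionBySet A M J) : Module (A ⧸ J) M := h.module

/-- The `W_{n+1}(R)`-module structure of `I_{n+1,R}` factors through `𝒲_n(R)`. -/
instance (n : ℕ) : Module (TruncWitt p R n) (truncAugIdeal p R n) :=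
  quotModule (lastTorsion p R n) (isTorsionBySet_truncAugIdeal n)

variable (p R)

/-- The Frobenius `𝒲_n(R) → W_n(R)`. -/
def truncWittFrob (n : ℕ) : TruncWitt p R n →+* TruncatedWittVector p n R :=
  Ideal.Quotient.lift (lastTorsion p R n) (truncFrob p R n) fun a ha => by
    obtain ⟨a, rfl, ha₁, ha₂⟩ := exists_of_mem_lastTorsion ha
    rw [truncFrob_truncate, truncate_eq_zero_iff]
    exact frobenius_coeff_of_low ha₁ ha₂

/-- The projection `𝒲_n(R) → W_n(R)`. -/
def truncWittProj (n : ℕ) : TruncWitt p R n →+* TruncatedWittVector p n R :=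
  Ideal.Quotient.lift (lastTorsion p R n) (TruncatedWittVector.truncate n.le_succ) fun a ha => by
    obtain ⟨a, rfl, ha₁, ha₂⟩ := exists_of_mem_lastTorsion ha
    rw [TruncatedWittVector.truncate_wittVector_truncate, truncate_eq_zero_iff]
    exact ha₁

/-- The divided Frobenius `I_{n+1,R} → W_n(R)`, the inverse of the Verschiebung: it maps
`(0, x_0, …, x_{n-1})` to `(x_0, …, x_{n-1})`. -/
def truncFrobDivFun (n : ℕ) (x : truncAugIdeal p R n) : TruncatedWittVector p n R :=
  TruncatedWittVector.mk p fun i => TruncatedWittVector.coeff i.succ (x : TruncatedWittVector p (n + 1) R)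

variable {p R}

theorem truncFrobDivFun_eq {n : ℕ} {x : truncAugIdeal p R n} {z : WittVector p R}
    (h : (x : TruncatedWittVector p (n + 1) R) = WittVector.truncate (n + 1) (verschiebung z)) :
    truncFrobDivFun p R n x = WittVector.truncate n z := by
  ext i
  rw [truncFrobDivFun, TruncatedWittVector.coeff_mk, h, WittVector.coeff_truncate,
    WittVector.coeff_truncate, Fin.val_succ, verschiebung_coeff_succ]

variable (p R)

/-- The divided Frobenius `I_{n+1,R} → W_n(R)` as a Frobenius-linear map. -/
def truncFrobDiv (n : ℕ) :
    truncAugIdeal p R n →ₛₗ[truncWittFrob p R n] TruncatedWittVector p n R where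
  toFun := truncFrobDivFun p R n
  map_add' x y := by
    obtain ⟨a, ha⟩ := exists_of_mem_truncAugIdeal x.2
    obtain ⟨b, hb⟩ := exists_of_mem_truncAugIdeal y.2
    rw [truncFrobDivFun_eq ha, truncFrobDivFun_eq hb, ← map_add]
    exact truncFrobDivFun_eq (by rw [Submodule.coe_add, ha, hb, ← map_add, ← map_add])
  map_smul' c x := by
    obtain ⟨a, ha⟩ := exists_of_mem_truncAugIdeal x.2
    obtain ⟨c, rfl⟩ := Ideal.Quotient.mk_surjective c
    obtain ⟨c, rfl⟩ := WittVector.truncate_surjective p (n + 1) R c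
    have h : truncWittFrob p R n (Ideal.Quotient.mk _ (WittVector.truncate (n + 1) c)) =
        WittVector.truncate n (frobenius c) := truncFrob_truncate n c
    rw [truncFrobDivFun_eq ha, h, smul_eq_mul, ← map_mul]
    refine truncFrobDivFun_eq ?_
    change WittVector.truncate (n + 1) c * (x : TruncatedWittVector p (n + 1) R) = _
    rw [ha, ← map_mul, mul_comm (frobenius c), verschiebung_mul_frobenius, mul_comm c]

/-- The `n`-truncated Witt frame `(𝒲_n(R), I_{n+1,R}, W_n(R), F, V⁻¹)`. -/
abbrev truncWittFrame (n : ℕ) : Frame.{u} p where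
  carrier := TruncWitt p R n
  quot := TruncatedWittVector p n R
  fil := truncAugIdeal p R n
  ι :=
    { toFun := fun x => Ideal.Quotient.mk _ (x : TruncatedWittVector p (n + 1) R)
      map_add' := fun x y => by rw [Submodule.coe_add, map_add]
      map_smul' := fun c x => by
        obtain ⟨c, rfl⟩ := Ideal.Quotient.mk_surjective c
        exact map_mul (Ideal.Quotient.mk (lastTorsion p R n)) c
          (x : TruncatedWittVector p (n + 1) R) }
  π := truncWittProj p R n
  π_surjective := Ideal.Quotient.lift_surjective_of_surjective _ _
    (TruncatedWittVector.truncate_surjective n.le_succ)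
  σ := truncWittFrob p R n
  σdiv := truncFrobDiv p R n
  p_mul_σdiv x := by
    obtain ⟨a, ha⟩ := exists_of_mem_truncAugIdeal x.2
    change (p : TruncatedWittVector p n R) * truncFrobDivFun p R n x =
      truncFrob p R n (x : TruncatedWittVector p (n + 1) R)
    rw [truncFrobDivFun_eq ha, ha, truncFrob_truncate, frobenius_verschiebung, map_mul,
      map_natCast, mul_comm]

/-- The truncation morphism from the Witt frame to the `n`-truncated Witt frame. -/
def truncFrameMap (n : ℕ) : Frame.Hom (wittFrame p R) (truncWittFrame p R n) where
  ring := (Ideal.Quotient.mk (lastTorsion p R n)).comp (WittVector.truncate (n + 1))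
  quot := WittVector.truncate n
  fil :=
    { toFun := fun x => ⟨WittVector.truncate (n + 1) (x : WittVector p R),
        truncate_mem_truncAugIdeal n x.2⟩
      map_add' := fun x y => Subtype.ext (map_add _ _ _)
      map_smul' := fun a x => Subtype.ext (map_mul _ _ _) }
  ι_fil _ := rfl
  π_ring := RingHom.ext fun x => TruncatedWittVector.truncate_wittVector_truncate n.le_succ x
  σ_ring := RingHom.ext fun x => truncFrob_truncate n x
  σdiv_fil x := by
    have h : WittVector.truncate (n + 1) (x : WittVector p R) =
        WittVector.truncate (n + 1) (verschiebung ((x : WittVector p R).shift 1)) := by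
      rw [verschiebung_shift_one x.2]
    exact truncFrobDivFun_eq (x := ⟨_, truncate_mem_truncAugIdeal n x.2⟩) h

end Witt

/-! ### Displays and truncated displays -/

section Display

open WittVector

variable (p) [hp : Fact p.Prime]

/-- A (not necessarily nilpotent) display over `R`: a window over the Witt frame of `R`. -/
abbrev Display (R : Type u) [CommRing R] := Window (wittFrame p R)

/-- An `n`-truncated display over `R`: a window over the `n`-truncated Witt frame of `R`. -/
abbrev TruncDisplay (n : ℕ) (R : Type u) [CommRing R] := Window (truncWittFrame p R n)

variable {p} {R : Type u} [CommRing R]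

namespace Display

instance (P : Display p R) : Module (WittVector p R) P.T := P.moduleT
instance (P : Display p R) : Module (WittVector p R) P.L := P.moduleL
instance (P : Display p R) : Module.Finite (WittVector p R) P.T := P.finiteT
instance (P : Display p R) : Module.Finite (WittVector p R) P.L := P.finiteL
instance (P : Display p R) : Module.Projective (WittVector p R) P.T := P.projectiveT
instance (P : Display p R) : Module.Projective (WittVector p R) P.L := P.projectiveL

/-- The base change `P_{R'}` of a display along a ring homomorphism `R → R'`. -/
abbrev baseChange {R' : Type u} [CommRing R'] (φ : R →+* R') (P : Display p R) : Display p R' :=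
  Window.baseChange (wittFrameMap p φ) P

/-- The `n`-truncation `P[n]` of a display. -/
abbrev truncate (n : ℕ) (P : Display p R) : TruncDisplay p n R :=
  Window.baseChange (truncFrameMap p R n) P

/-- The `n`-truncation `f[n]` of a morphism of displays. -/
abbrev Hom.truncate (n : ℕ) {P Q : Display p R} (f : Window.Hom P Q) :
    Window.Hom (truncate n P) (truncate n Q) :=
  Window.Hom.baseChange (truncFrameMap p R n) f

/-! #### Nilpotence -/

/-- The entry `z̆ : L → L^F` of `Ψ⁻¹ = [w̆ x̆; y̆ z̆] : T ⊕ L → T^F ⊕ L^F`. -/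
def zBreve (P : Display p R) :
    P.L →ₗ[WittVector p R] ExtScalars (frobenius : WittVector p R →+* WittVector p R) P.L :=
  (LinearMap.snd (WittVector p R)
      (ExtScalars (frobenius : WittVector p R →+* WittVector p R) P.T)
      (ExtScalars (frobenius : WittVector p R →+* WittVector p R) P.L)).comp
    (P.Ψ.symm.toLinearMap.comp ((ExtScalars.idEquiv (P.T × P.L)).symm.toLinearMap.comp
      (LinearMap.inr (WittVector p R) P.T P.L)))

variable (p R) in
/-- The `e`-fold Frobenius `F^e` of `W(R)`. -/
def frobIter : ℕ → (WittVector p R →+* WittVector p R)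
  | 0 => RingHom.id _
  | e + 1 => (frobIter e).comp frobenius

/-- The composition `(F^{e-1})^* z̆ ∘ ⋯ ∘ F^* z̆ ∘ z̆ : L → L^{F^e}`. -/
def zBreveIter (P : Display p R) :
    (e : ℕ) → P.L →ₗ[WittVector p R] ExtScalars (frobIter p R e) P.L
  | 0 => (ExtScalars.idEquiv P.L).symm.toLinearMap
  | e + 1 => (ExtScalars.comp frobenius (frobIter p R e) (frobIter p R (e + 1)) rfl
      P.L).toLinearMap.comp ((ExtScalars.map (frobIter p R e) P.zBreve).comp (P.zBreveIter e))

variable (p R) in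
/-- The projection `W(R) → R/pR`. -/
def residueMap : WittVector p R →+* R ⧸ Ideal.span {(p : R)} :=
  (Ideal.Quotient.mk _).comp constantCoeff

/-- `P` is nilpotent of nilpotence order at most `e`: the composition
`z̆^(p^{e-1}) ∘ ⋯ ∘ z̆ : R/pR ⊗ L → (R/pR ⊗ L)^(p^e)` vanishes. Here `(R/pR ⊗ L)^(p^e)` is
`R/pR ⊗ L^{F^e}`, because the Witt vector Frobenius lifts the `p`-th power map of `R/pR`. -/
def NilpotentOfOrderLE (P : Display p R) (e : ℕ) : Prop :=
  ExtScalars.map (residueMap p R) (P.zBreveIter e) = 0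

/-! #### Isogenies -/

/-- `P` has constant dimension `d` and constant codimension `c`. -/
def HasDimCodim (P : Display p R) (d c : ℕ) : Prop :=
  (∀ q, Module.rankAtStalk (R := WittVector p R) P.T q = d) ∧
    (∀ q, Module.rankAtStalk (R := WittVector p R) P.L q = c)

/-- The geometric point of `Spec R` over a point `x`, with values in an algebraic closure of the
residue field at `x`. -/
def geomPoint (x : PrimeSpectrum R) : R →+* AlgebraicClosure x.asIdeal.ResidueField :=
  algebraMap R (AlgebraicClosure x.asIdeal.ResidueField)

/-- The determinant `⋀^h f` of a morphism of displays of height `h`, at the geometric point `x`. -/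
def detAt {P Q : Display p R} (f : Window.Hom P Q) (h : ℕ) (x : PrimeSpectrum R) :
    (⋀[WittVector p (AlgebraicClosure x.asIdeal.ResidueField)]^h
        (ExtScalars (WittVector.map (p := p) (geomPoint x)) (P.T × P.L))) →ₗ[
      WittVector p (AlgebraicClosure x.asIdeal.ResidueField)]
    (⋀[WittVector p (AlgebraicClosure x.asIdeal.ResidueField)]^h
        (ExtScalars (WittVector.map (p := p) (geomPoint x)) (Q.T × Q.L))) :=
  exteriorPower.map h (ExtScalars.map (WittVector.map (p := p) (geomPoint x)) f.toLin)

/-- The `p`-adic valuation `ν_p(det f)(x) ∈ ℕ ∪ {∞}` of the determinant of a morphism of displays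
of height `h` at a point `x` of `Spec R`. With `k` the algebraic closure of the residue field, the
stalks of the `ℤ_p`-local systems of `det P` and `det Q` at `x` are `ℤ_p`-lattices of rank one that
generate the `W(k)`-modules `det P_k` and `det Q_k`, so the valuation can be read off over
`W(k)`. -/
def detVal {P Q : Display p R} (f : Window.Hom P Q) (h : ℕ) (x : PrimeSpectrum R) : ℕ∞ :=
  ⨆ (j : ℕ) (_ : ∃ ψ, detAt f h x =
    (p : WittVector p (AlgebraicClosure x.asIdeal.ResidueField)) ^ j • ψ), (j : ℕ∞)

/-- `f` is an isogeny: source and target have the same constant height and dimension, and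
`ν_p(det f)` is finite everywhere. -/
def IsIsogeny {P Q : Display p R} (f : Window.Hom P Q) : Prop :=
  ∃ d c : ℕ, P.HasDimCodim d c ∧ Q.HasDimCodim d c ∧ ∀ x, detVal f (d + c) x < ⊤

/-- `f` is an isogeny of height `m`: source and target have the same constant height and dimension,
and `ν_p(det f)` is constant with value `m`. -/
def IsIsogenyOfHeight {P Q : Display p R} (f : Window.Hom P Q) (m : ℕ) : Prop :=
  ∃ d c : ℕ, P.HasDimCodim d c ∧ Q.HasDimCodim d c ∧ ∀ x, detVal f (d + c) x = m

theorem IsIsogenyOfHeight.isIsogeny {P Q : Display p R} {f : Window.Hom P Q} {m : ℕ}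
    (hf : IsIsogenyOfHeight f m) : IsIsogeny f := by
  obtain ⟨d, c, hP, hQ, h⟩ := hf
  exact ⟨d, c, hP, hQ, fun x => by rw [h x]; exact ENat.natCast_lt_top m⟩

end Display

/-- The structure map `W(F) → R` of a `W(F)/p^a`-algebra `R`. -/
def structureMap (p : ℕ) [Fact p.Prime] (a : ℕ) (F R : Type u) [CommRing F] [CommRing R]
    [Algebra (WittVector p F ⧸ Ideal.span {(p : WittVector p F) ^ a}) R] : WittVector p F →+* R :=
  (algebraMap (WittVector p F ⧸ Ideal.span {(p : WittVector p F) ^ a}) R).comp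
    (Ideal.Quotient.mk _)

end Display

end ZinkDisplay

end

open scoped TensorProduct

noncomputable section

/-! Realise `T` and `L` as direct summands of finite free modules. A homomorphism with upper right
entry in `I_R` becomes a matrix `u` over `W(R)`, and it is a morphism of displays exactly when it is
a fixed point of `Φ(u) = Ψ' u^σ Ψ⁻¹` (`comm_iff_Φ`). The theorem is then about fixed points of one
semilinear operator.

Contraction. On `V W(R)` the Frobenius equals `p V⁻¹`. So on matrices with entries there, `u^σ`
gains a factor `p` in every block except the upper right one, where `V⁻¹` is applied and `Φ`
multiplies from the right by `z̆`. After `e` rounds the product `F^{e-1}(z̆) ⋯ z̆` has entries in `p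
W(R) + V W(R)`, and this supplies the missing `p`. Hence `Φ^{e+1}` maps entries in `V^{n+e+1} W(R)`
to entries in `p V^n W(R)`, and by the same computation it lowers `p`-power torsion by one step
(`phi_iterate_gain`).

Rigidity. A morphism killed by a power of `p` is zero (`eq_zero_of_phi_fixed`). One reduces to `p u
= 0`, where all Witt coefficients of `u` are nilpotent. Let `𝔞` be generated by the first `e + 1`
coefficients of the entries. Modulo `𝔞²` these coefficients lie in an ideal of square zero, on which
the shift is still as good as `V⁻¹`, so the contraction argument shows that `u` vanishes modulo
`𝔞²`. Thus `𝔞 = 𝔞²`, and Nakayama gives `𝔞 = 0`.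

Quasi-inverse. An isogeny `u` of height `m` has a morphism `G` backwards with `G u = p^M` and `u G =
p^M`, where `M` depends only on `a`, `m`, `c`. From `u = Ψ' u^σ Ψ⁻¹` and `u^σ diag(1, p) = diag(1,
p) F(u)` it follows that the `(d+c)`-minors of `u`, multiplied by `p^c`, form a vector `X` with `X =
U F(X)`. Height `m` at every point means that the minors have nilpotent coefficients below `m` and
that the `m`-th coefficients generate the unit ideal. Over `R/p` this forces `p^{m+c}` into the
ideal of `X`, so over `R` the ideal of minors contains `p^{a(m+c)}`. Adjugates then provide `G`,
after further powers of `p` that repair the filtration and the compatibility with `Φ`.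

Lifting (`exists_isHom_mul_eq`). The truncated morphism lifts to a matrix `u` with `u ≡ Φ(u)` and
`g' u ≡ g` modulo `V^n`. Contraction shows that `p^M u` differs from the true morphism `G g` by `p^M
s` with `s` deep in the `V`-filtration, so `f₁ = u - s` satisfies `p^M f₁ = G g`. The defect `f₁ -
Φ(f₁)` is killed by `p^M` and deep, hence killed by an iterate of `Φ`, and a finite geometric series
removes it. The resulting morphism `f` satisfies `p^M (g' f - g) = 0`, so `g' f = g` by rigidity.
Uniqueness is rigidity combined with `G`. Finally `f` is invertible because equal heights leave
valuation zero for `det f`. -/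

namespace ZinkDisplay

/-! ### Witt vectors: the shift, square-zero coefficients, units and `p`-torsion. -/

section WittLemmas

open WittVector

variable {p : ℕ} [hp : Fact p.Prime] {R S : Type*} [CommRing R] [CommRing S]

/-- The shift `(x₀, x₁, …) ↦ (x₁, x₂, …)`, which on `I_R` is the inverse of the Verschiebung. -/
def vinv (x : WittVector p R) : WittVector p R := x.shift 1

@[simp] theorem vinv_coeff (x : WittVector p R) (i : ℕ) : (vinv x).coeff i = x.coeff (i + 1) := by
  rw [vinv, shift_coeff, add_comm]

@[simp] theorem vinv_verschiebung (x : WittVector p R) : vinv (verschiebung x) = x := by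
  ext i; simp

theorem verschiebung_vinv {x : WittVector p R} (hx : x.coeff 0 = 0) :
    verschiebung (vinv x) = x := by
  ext i
  cases i with
  | zero => rw [verschiebung_coeff_zero, hx]
  | succ i => simp

/-- The two summands have disjoint supports, so their sum is formed coefficient by coefficient. -/
theorem teichmuller_add_verschiebung_vinv (x : WittVector p R) :
    teichmuller p (x.coeff 0) + verschiebung (vinv x) = x := by
  ext i
  rw [coeff_add_of_disjoint]
  · cases i with
    | zero => simp
    | succ i => simp [teichmuller_coeff_pos]
  · rintro (_ | n)
    · right; simp
    · left; simp [teichmuller_coeff_pos]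

/-- The ideal of Witt vectors whose first `n` coefficients lie in `𝔞`. -/
def coeffIdeal (p : ℕ) [Fact p.Prime] (𝔞 : Ideal R) (n : ℕ) : Ideal (WittVector p R) :=
  RingHom.ker ((truncate n).comp (WittVector.map (p := p) (Ideal.Quotient.mk 𝔞)))

theorem mem_coeffIdeal {𝔞 : Ideal R} {n : ℕ} {x : WittVector p R} :
    x ∈ coeffIdeal p 𝔞 n ↔ ∀ i < n, x.coeff i ∈ 𝔞 := by
  rw [coeffIdeal, RingHom.mem_ker, RingHom.comp_apply, truncate_eq_zero_iff]
  simp [Ideal.Quotient.eq_zero_iff_mem]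

/-- The ideal `V^n W(R)`. -/
abbrev vIdeal (p : ℕ) [Fact p.Prime] (R : Type*) [CommRing R] (n : ℕ) : Ideal (WittVector p R) :=
  coeffIdeal p ⊥ n

theorem mem_vIdeal {n : ℕ} {x : WittVector p R} : x ∈ vIdeal p R n ↔ ∀ i < n, x.coeff i = 0 := by
  simp [mem_coeffIdeal]

theorem mem_vIdeal_one {x : WittVector p R} : x ∈ vIdeal p R 1 ↔ x.coeff 0 = 0 := by
  rw [mem_vIdeal]
  exact ⟨fun h => h 0 one_pos, fun h i hi => by rwa [Nat.lt_one_iff.1 hi]⟩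

theorem coeffIdeal_antitone (𝔞 : Ideal R) {m n : ℕ} (h : m ≤ n) :
    coeffIdeal p 𝔞 n ≤ coeffIdeal p 𝔞 m := fun x hx =>
  mem_coeffIdeal.2 fun i hi => mem_coeffIdeal.1 hx i (by omega)

theorem vinv_mem_coeffIdeal {𝔞 : Ideal R} {n : ℕ} {x : WittVector p R}
    (hx : x ∈ coeffIdeal p 𝔞 (n + 1)) : vinv x ∈ coeffIdeal p 𝔞 n :=
  mem_coeffIdeal.2 fun i hi => by
    rw [vinv_coeff]; exact mem_coeffIdeal.1 hx _ (by omega)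

theorem verschiebung_mem_vIdeal {n : ℕ} {x : WittVector p R} (hx : x ∈ vIdeal p R n) :
    verschiebung x ∈ vIdeal p R (n + 1) :=
  mem_vIdeal.2 fun i hi => by
    cases i with
    | zero => simp
    | succ i => rw [verschiebung_coeff_succ]; exact mem_vIdeal.1 hx i (by omega)

theorem frobenius_eq_p_mul_vinv {x : WittVector p R} (hx : x.coeff 0 = 0) :
    frobenius x = p * vinv x := by
  conv_lhs => rw [← verschiebung_vinv hx, frobenius_verschiebung, mul_comm]

theorem mul_verschiebung (x y : WittVector p R) :
    x * verschiebung y = verschiebung (frobenius x * y) := by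
  rw [mul_comm x, ← verschiebung_mul_frobenius, mul_comm]

theorem vinv_mul {x : WittVector p R} (hx : x.coeff 0 = 0) (y : WittVector p R) :
    vinv (x * y) = vinv x * frobenius y := by
  conv_lhs => rw [← verschiebung_vinv hx, ← verschiebung_mul_frobenius, vinv_verschiebung]

theorem vinv_add {x y : WittVector p R} (hx : x.coeff 0 = 0) (hy : y.coeff 0 = 0) :
    vinv (x + y) = vinv x + vinv y := by
  conv_lhs => rw [← verschiebung_vinv hx, ← verschiebung_vinv hy, ← map_add, vinv_verschiebung]

theorem coeff_zero_add (x y : WittVector p R) : (x + y).coeff 0 = x.coeff 0 + y.coeff 0 :=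
  map_add (constantCoeff : WittVector p R →+* R) x y

theorem coeff_zero_mul (x y : WittVector p R) : (x * y).coeff 0 = x.coeff 0 * y.coeff 0 :=
  map_mul (constantCoeff : WittVector p R →+* R) x y

theorem coeff_zero_sub (x y : WittVector p R) : (x - y).coeff 0 = x.coeff 0 - y.coeff 0 :=
  map_sub (constantCoeff : WittVector p R →+* R) x y

theorem coeff_zero_natCast (k : ℕ) : (k : WittVector p R).coeff 0 = k :=
  map_natCast (constantCoeff : WittVector p R →+* R) k

theorem coeff_zero_pow (x : WittVector p R) (k : ℕ) : (x ^ k).coeff 0 = x.coeff 0 ^ k :=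
  map_pow (constantCoeff : WittVector p R →+* R) x k

@[simp] theorem vinv_zero : vinv (0 : WittVector p R) = 0 := by ext i; simp

/-- The homomorphism from the dual numbers `ℤ ⊕ ℤ²` given by two elements of a ring whose
pairwise products vanish. -/
def dualNumberLift {x y : R} (hx : x * x = 0) (hxy : x * y = 0) (hy : y * y = 0) :
    TrivSqZeroExt ℤ (ℤ × ℤ) →ₐ[ℤ] R :=
  TrivSqZeroExt.lift (Algebra.ofId ℤ R)
    ((LinearMap.toSpanSingleton ℤ R x).coprod (LinearMap.toSpanSingleton ℤ R y))
    (fun v w => by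
      simp only [LinearMap.coprod_apply, LinearMap.toSpanSingleton_apply, zsmul_eq_mul]
      linear_combination (v.1 * w.1 : R) * hx + (v.1 * w.2 + v.2 * w.1 : R) * hxy +
        (v.2 * w.2 : R) * hy)
    (fun r v => by rw [LinearMap.map_smul, zsmul_eq_mul]; simp)
    (fun r v => by rw [op_smul_eq_smul, LinearMap.map_smul, zsmul_eq_mul, mul_comm]; simp)

theorem dualNumberLift_inr {x y : R} (hx : x * x = 0) (hxy : x * y = 0) (hy : y * y = 0)
    (v : ℤ × ℤ) : dualNumberLift hx hxy hy (TrivSqZeroExt.inr v) = v.1 • x + v.2 • y := by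
  simp [dualNumberLift]

/-- The ghost map is bijective once `p` is invertible, and it is compatible with `W(φ)`. -/
theorem ghostMap_injective_of_injective (φ : R →+* S) (hφ : Function.Injective φ)
    [Invertible (p : S)] :
    Function.Injective (ghostMap : WittVector p R → ℕ → R) := by
  intro x y h
  apply WittVector.map_injective φ hφ
  apply (ghostMap.bijective_of_invertible p S).injective
  funext n
  have hn : ∀ z : WittVector p R, ghostMap (WittVector.map φ z) n = φ (ghostMap z n) := by
    intro z
    rw [ghostMap_apply, ghostMap_apply, ghostComponent_apply, ghostComponent_apply,
      MvPolynomial.aeval_def, MvPolynomial.aeval_def, ← MvPolynomial.coe_eval₂Hom,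
          ← MvPolynomial.coe_eval₂Hom,
      ← RingHom.comp_apply, MvPolynomial.comp_eval₂Hom]
    congr 1
    apply MvPolynomial.ringHom_ext
    · intro r; simp
    · intro i; simp [map_coeff]
  rw [hn, hn, h]

/-- `ℤ ⊕ ℤ²` is the universal case for two elements whose products vanish. It embeds into its
rational analogue, so identities over it can be tested on ghost components. -/
theorem ghostMap_injective_dualNumber : Function.Injective
    (ghostMap : WittVector p (TrivSqZeroExt ℤ (ℤ × ℤ)) → ℕ → TrivSqZeroExt ℤ (ℤ × ℤ)) := by
  have hT := fun a b : ℚ × ℚ => TrivSqZeroExt.inr_mul_inr ℚ a b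
  let φ : TrivSqZeroExt ℤ (ℤ × ℤ) →+* TrivSqZeroExt ℚ (ℚ × ℚ) :=
    (dualNumberLift (hT (1, 0) (1, 0)) (hT (1, 0) (0, 1)) (hT (0, 1) (0, 1))).toRingHom
  have hφ : ∀ t, φ t = TrivSqZeroExt.inl (t.fst : ℚ) +
      TrivSqZeroExt.inr ((t.snd.1 : ℚ), (t.snd.2 : ℚ)) := by
    intro t
    conv_lhs => rw [← TrivSqZeroExt.inl_fst_add_inr_snd_eq t]
    rw [map_add]
    congr 1
    · change dualNumberLift _ _ _ (TrivSqZeroExt.inl t.fst) = _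
      simp [dualNumberLift]
    · refine (dualNumberLift_inr _ _ _ t.snd).trans ?_
      ext <;> simp
  have hinj : Function.Injective φ := by
    intro s t h
    rw [hφ, hφ] at h
    have h₁ := congrArg TrivSqZeroExt.fst h
    have h₂ := congrArg TrivSqZeroExt.snd h
    simp only [TrivSqZeroExt.fst_add, TrivSqZeroExt.fst_inl, TrivSqZeroExt.fst_inr, add_zero,
      TrivSqZeroExt.snd_add, TrivSqZeroExt.snd_inl, TrivSqZeroExt.snd_inr, zero_add,
      Prod.mk.injEq, Int.cast_inj] at h₁ h₂
    exact TrivSqZeroExt.ext h₁ (Prod.ext h₂.1 h₂.2)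
  have : Invertible ((p : ℕ) : TrivSqZeroExt ℚ (ℚ × ℚ)) :=
    letI : Invertible (p : ℚ) := invertibleOfNonzero (Nat.cast_ne_zero.2 hp.out.ne_zero)
    (Invertible.map (algebraMap ℚ (TrivSqZeroExt ℚ (ℚ × ℚ))) (p : ℚ)).copy _ (by simp)
  exact ghostMap_injective_of_injective φ hinj

theorem inr_pow_p_pow (u : ℤ × ℤ) (n : ℕ) :
    (TrivSqZeroExt.inr u : TrivSqZeroExt ℤ (ℤ × ℤ)) ^ (p ^ (n + 1)) = 0 :=
  pow_eq_zero_of_le (Nat.one_lt_pow (by omega) hp.out.one_lt : 2 ≤ p ^ (n + 1))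
    (by rw [pow_two, TrivSqZeroExt.inr_mul_inr])

/-- In the universal case the ghost components of `[v]` are `v, v^p, v^{p²}, …`, and all but the
zeroth vanish, so they are additive in `v`. -/
theorem teichmuller_add_of_sq_zero {x y : R} (hx : x * x = 0) (hxy : x * y = 0) (hy : y * y = 0) :
    teichmuller p (x + y) = teichmuller p x + teichmuller p y := by
  have key : ∀ v w : ℤ × ℤ, teichmuller p (TrivSqZeroExt.inr (v + w) : TrivSqZeroExt ℤ (ℤ × ℤ)) =
      teichmuller p (TrivSqZeroExt.inr v) + teichmuller p (TrivSqZeroExt.inr w) := by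
    intro v w
    apply ghostMap_injective_dualNumber
    funext n
    rw [map_add, Pi.add_apply]
    simp only [ghostMap_apply, ghostComponent_teichmuller]
    cases n with
    | zero => simp
    | succ n => simp only [inr_pow_p_pow, add_zero]
  have h := congrArg (WittVector.map (dualNumberLift hx hxy hy).toRingHom) (key (1, 0) (0, 1))
  simp only [map_add, map_teichmuller] at h
  simpa [dualNumberLift_inr, -TrivSqZeroExt.inr_add] using h

theorem map_frobenius (φ : R →+* S) (x : WittVector p R) :
    WittVector.map φ (frobenius x) = frobenius (WittVector.map φ x) := by
  ext n
  rw [map_coeff, coeff_frobenius, coeff_frobenius, MvPolynomial.aeval_def, MvPolynomial.aeval_def,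
    ← MvPolynomial.coe_eval₂Hom, ← MvPolynomial.coe_eval₂Hom, ← RingHom.comp_apply,
    MvPolynomial.comp_eval₂Hom]
  congr 1
  apply MvPolynomial.ringHom_ext
  · intro r; simp
  · intro i; simp [map_coeff]

/-- Frobenius drops the zeroth ghost component of `[x]`, which is the only nonzero one in the
universal case. This makes `F = p · vinv` hold beyond `V W(R)`. -/
theorem frobenius_teichmuller_of_sq_zero {x : R} (hx : x * x = 0) :
    frobenius (teichmuller p x) = 0 := by
  have key : frobenius (teichmuller p (TrivSqZeroExt.inr (1, 0) : TrivSqZeroExt ℤ (ℤ × ℤ))) =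
      0 := by
    apply ghostMap_injective_dualNumber
    funext n
    rw [ghostMap_apply, ghostComponent_frobenius, ghostComponent_teichmuller, inr_pow_p_pow,
      map_zero, Pi.zero_apply]
  have h := congrArg (WittVector.map (dualNumberLift hx hx hx).toRingHom) key
  rw [map_frobenius, map_teichmuller, map_zero] at h
  simpa [dualNumberLift_inr] using h

theorem map_vinv (φ : R →+* S) (x : WittVector p R) :
    WittVector.map φ (vinv x) = vinv (WittVector.map φ x) := by
  ext i; simp [map_coeff]

/-! ### The shift on Witt vectors with leading coefficient in a square-zero ideal. -/

section SqZero

variable {𝔞 : Ideal R}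

/-- In `x = [x₀] + V(vinv x)` the Teichmüller part is additive on `𝔞`, so subtracting it leaves an
additive remainder. -/
theorem vinv_add_of_mem (h𝔞 : ∀ x ∈ 𝔞, ∀ y ∈ 𝔞, x * y = 0)
    {x y : WittVector p R} (hx : x.coeff 0 ∈ 𝔞) (hy : y.coeff 0 ∈ 𝔞) :
    vinv (x + y) = vinv x + vinv y := by
  apply verschiebung_injective p R
  have h := teichmuller_add_verschiebung_vinv (x + y)
  rw [coeff_zero_add, teichmuller_add_of_sq_zero (h𝔞 _ hx _ hx) (h𝔞 _ hx _ hy) (h𝔞 _ hy _ hy)] at h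
  have h₁ := teichmuller_add_verschiebung_vinv x
  have h₂ := teichmuller_add_verschiebung_vinv y
  rw [map_add]
  linear_combination h - h₁ - h₂

theorem frobenius_eq_p_mul_vinv_of_mem (h𝔞 : ∀ x ∈ 𝔞, ∀ y ∈ 𝔞, x * y = 0)
    {x : WittVector p R} (hx : x.coeff 0 ∈ 𝔞) :
    frobenius x = p * vinv x := by
  conv_lhs => rw [← teichmuller_add_verschiebung_vinv x, map_add,
    frobenius_teichmuller_of_sq_zero (h𝔞 _ hx _ hx), frobenius_verschiebung, zero_add, mul_comm]

theorem vinv_mul_of_mem (h𝔞 : ∀ x ∈ 𝔞, ∀ y ∈ 𝔞, x * y = 0)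
    {x : WittVector p R} (hx : x.coeff 0 ∈ 𝔞) (y : WittVector p R) :
    vinv (x * y) = vinv x * frobenius y := by
  apply verschiebung_injective p R
  have h := teichmuller_add_verschiebung_vinv (x * y)
  rw [verschiebung_mul_frobenius]
  rw [coeff_zero_mul, map_mul] at h
  have h₁ := teichmuller_add_verschiebung_vinv x
  have h₂ := teichmuller_add_verschiebung_vinv y
  have h₃ : teichmuller p (x.coeff 0) * verschiebung (vinv y) = 0 := by
    rw [mul_verschiebung, frobenius_teichmuller_of_sq_zero (h𝔞 _ hx _ hx), zero_mul, map_zero]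
  linear_combination h - y * h₁ - teichmuller p (x.coeff 0) * h₂ + h₃

end SqZero

/-- The kernel of `W(R) → W(R / 𝔞)`. -/
def wittIdeal (p : ℕ) [Fact p.Prime] (𝔞 : Ideal R) : Ideal (WittVector p R) :=
  RingHom.ker (WittVector.map (p := p) (Ideal.Quotient.mk 𝔞))

theorem mem_wittIdeal {𝔞 : Ideal R} {x : WittVector p R} :
    x ∈ wittIdeal p 𝔞 ↔ ∀ i, x.coeff i ∈ 𝔞 := by
  rw [wittIdeal, RingHom.mem_ker, WittVector.map_eq_zero_iff]
  simp [Ideal.Quotient.eq_zero_iff_mem]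

/-- Splitting off Teichmüller parts gives `x y = [x₀ y₀] + V(F[x₀] · vinv y) + V(F y · vinv x)`. The
first term is zero and the others are `V` of products of the same kind, so by induction the product
lies in every `V^n W(R)`. -/
theorem mul_eq_zero_of_coeff_mul {𝔞 𝔟 : Ideal R} (h : ∀ x ∈ 𝔞, ∀ y ∈ 𝔟, x * y = 0)
    {x y : WittVector p R} (hx : x ∈ wittIdeal p 𝔞) (hy : y ∈ wittIdeal p 𝔟) : x * y = 0 := by
  have key : ∀ n, ∀ x ∈ wittIdeal p 𝔞, ∀ y ∈ wittIdeal p 𝔟, x * y ∈ vIdeal p R n := by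
    intro n
    induction n with
    | zero => exact fun x _ y _ => mem_vIdeal.2 fun i hi => absurd hi (Nat.not_lt_zero i)
    | succ n ih =>
      intro x hx y hy
      have hx' : vinv x ∈ wittIdeal p 𝔞 := mem_wittIdeal.2 fun i => by
        rw [vinv_coeff]; exact mem_wittIdeal.1 hx _
      have hy' : vinv y ∈ wittIdeal p 𝔟 := mem_wittIdeal.2 fun i => by
        rw [vinv_coeff]; exact mem_wittIdeal.1 hy _
      have hfrob : ∀ {𝔠 : Ideal R} {z : WittVector p R}, z ∈ wittIdeal p 𝔠 →
          frobenius z ∈ wittIdeal p 𝔠 := fun {𝔠 z} hz => by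
        rw [wittIdeal, RingHom.mem_ker, map_frobenius, (RingHom.mem_ker).1 hz, map_zero]
      have hteich : ∀ {𝔠 : Ideal R} {z : WittVector p R}, z ∈ wittIdeal p 𝔠 →
          teichmuller p (z.coeff 0) ∈ wittIdeal p 𝔠 := fun {𝔠 z} hz => mem_wittIdeal.2 fun i => by
        cases i with
        | zero => simpa using mem_wittIdeal.1 hz 0
        | succ i => rw [teichmuller_coeff_pos _ _ _ i.succ_pos]; exact zero_mem _
      have h₀ : teichmuller p (x.coeff 0) * teichmuller p (y.coeff 0) = 0 := by
        rw [← map_mul, h _ (mem_wittIdeal.1 hx 0) _ (mem_wittIdeal.1 hy 0), teichmuller_zero]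
      have h₁ := teichmuller_add_verschiebung_vinv x
      have h₂ := teichmuller_add_verschiebung_vinv y
      have e₁ := mul_verschiebung (teichmuller p (x.coeff 0)) (vinv y)
      have e₂ := mul_verschiebung y (vinv x)
      have : x * y = verschiebung (frobenius (teichmuller p (x.coeff 0)) * vinv y) +
          verschiebung (frobenius y * vinv x) := by
        linear_combination h₀ + e₁ + e₂ - y * h₁ - teichmuller p (x.coeff 0) * h₂
      rw [this]
      refine add_mem (verschiebung_mem_vIdeal (ih _ (hfrob (hteich hx)) _ hy'))
        (verschiebung_mem_vIdeal ?_)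
      rw [mul_comm]
      exact ih _ hx' _ (hfrob hy)
  ext i
  rw [zero_coeff]
  exact mem_vIdeal.1 (key (i + 1) x hx y hy) i i.lt_succ_self

theorem mul_mem_wittIdeal {𝔞 𝔟 : Ideal R} {x y : WittVector p R} (hx : x ∈ wittIdeal p 𝔞)
    (hy : y ∈ wittIdeal p 𝔟) : x * y ∈ wittIdeal p (𝔞 * 𝔟) := by
  rw [wittIdeal, RingHom.mem_ker, map_mul]
  refine mul_eq_zero_of_coeff_mul (𝔞 := 𝔞.map (Ideal.Quotient.mk (𝔞 * 𝔟)))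
    (𝔟 := 𝔟.map (Ideal.Quotient.mk (𝔞 * 𝔟))) (fun x hx y hy => ?_)
    (mem_wittIdeal.2 fun i => ?_) (mem_wittIdeal.2 fun i => ?_)
  · obtain ⟨x, hx', rfl⟩ := (Ideal.mem_map_iff_of_surjective _ Ideal.Quotient.mk_surjective).1 hx
    obtain ⟨y, hy', rfl⟩ := (Ideal.mem_map_iff_of_surjective _ Ideal.Quotient.mk_surjective).1 hy
    rw [← map_mul, Ideal.Quotient.eq_zero_iff_mem]
    exact Ideal.mul_mem_mul hx' hy'
  · rw [map_coeff]; exact Ideal.mem_map_of_mem _ (mem_wittIdeal.1 hx i)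
  · rw [map_coeff]; exact Ideal.mem_map_of_mem _ (mem_wittIdeal.1 hy i)

theorem pow_eq_zero_of_mem_wittIdeal {𝔞 : Ideal R} {a : ℕ} (h : 𝔞 ^ a = ⊥)
    {x : WittVector p R} (hx : x ∈ wittIdeal p 𝔞) : x ^ a = 0 := by
  have key : ∀ k, x ^ k ∈ wittIdeal p (𝔞 ^ k) := by
    intro k
    induction k with
    | zero => rw [pow_zero, pow_zero, mem_wittIdeal]; simp
    | succ k ih => rw [pow_succ, pow_succ]; exact mul_mem_wittIdeal ih hx
  have := key a
  rw [h, mem_wittIdeal] at this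
  ext i
  rw [zero_coeff]
  exact this i

theorem isUnit_of_charP [CharP R p] {x : WittVector p R} (hx : IsUnit (x.coeff 0)) :
    IsUnit x := by
  obtain ⟨u, hu⟩ := hx
  exact (mkUnit (hu.symm : x.coeff 0 = u)).isUnit

theorem charP_quotient {a : ℕ} (ha : (p : R) ^ a = 0) [Nontrivial R] :
    CharP (R ⧸ Ideal.span {(p : R)}) p := by
  have : Nontrivial (R ⧸ Ideal.span {(p : R)}) := by
    rw [Ideal.Quotient.nontrivial_iff, Ne, Ideal.span_singleton_eq_top]
    intro h
    exact (h.pow a).ne_zero ha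
  refine (CharP.charP_iff_prime_eq_zero hp.out).2 ?_
  rw [← map_natCast (Ideal.Quotient.mk (Ideal.span {(p : R)})), Ideal.Quotient.eq_zero_iff_mem]
  exact Ideal.mem_span_singleton_self _

/-- Over `R/p`, of characteristic `p`, this is known. A lift `y` of the inverse satisfies `x y - 1 ∈
W(pR)`, whose elements are nilpotent because `(pR)^a = 0`. -/
theorem isUnit_of_coeff_zero {a : ℕ} (ha : (p : R) ^ a = 0) {x : WittVector p R}
    (hx : IsUnit (x.coeff 0)) : IsUnit x := by
  cases subsingleton_or_nontrivial R with
  | inl h =>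
    have : Subsingleton (WittVector p R) := ⟨fun x y => WittVector.ext fun i => Subsingleton.elim _
        _⟩
    exact isUnit_of_subsingleton x
  | inr h =>
    have := charP_quotient (p := p) ha
    have hu : IsUnit (WittVector.map (Ideal.Quotient.mk (Ideal.span {(p : R)})) x) :=
      isUnit_of_charP (by rw [map_coeff]; exact hx.map _)
    obtain ⟨y', hy⟩ := hu.exists_right_inv
    obtain ⟨y, rfl⟩ := WittVector.map_surjective _ (Ideal.Quotient.mk_surjective) y'
    have hn : x * y - 1 ∈ wittIdeal p (Ideal.span {(p : R)}) := by
      rw [wittIdeal, RingHom.mem_ker, map_sub, map_mul, hy, map_one, sub_self]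
    have hnil : IsNilpotent (x * y - 1) := ⟨a, pow_eq_zero_of_mem_wittIdeal (by
      rw [Ideal.span_singleton_pow, ha, Ideal.span_singleton_eq_bot]) hn⟩
    have := hnil.isUnit_one_add
    rw [add_sub_cancel] at this
    exact isUnit_of_mul_isUnit_left this

/-- Modulo a prime `𝔭` the ring is a domain of characteristic `p`, where multiplication by `p` sends
the coefficient `x_i` to `x_i^p` in degree `i + 1`. So every `x_i` lies in every prime. -/
theorem isNilpotent_coeff_of_p_mul_eq_zero {a : ℕ} (ha : (p : R) ^ a = 0) {x : WittVector p R}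
    (hx : (p : WittVector p R) * x = 0) (i : ℕ) : IsNilpotent (x.coeff i) := by
  rw [← mem_nilradical, nilradical_eq_sInf, Ideal.mem_sInf]
  intro 𝔭 h𝔭
  have h𝔭 : 𝔭.IsPrime := h𝔭
  have hp𝔭 : (p : R ⧸ 𝔭) = 0 := by
    rw [← map_natCast (Ideal.Quotient.mk 𝔭), Ideal.Quotient.eq_zero_iff_mem]
    exact h𝔭.mem_of_pow_mem a (by rw [ha]; exact zero_mem _)
  have := (CharP.charP_iff_prime_eq_zero (R := R ⧸ 𝔭) hp.out).2 hp𝔭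
  have h := congrArg (fun z => (WittVector.map (Ideal.Quotient.mk 𝔭) z).coeff (i + 1)) hx
  simp only [map_mul, map_natCast, map_zero, zero_coeff] at h
  rw [mul_comm, mul_charP_coeff_succ] at h
  rw [← Ideal.Quotient.eq_zero_iff_mem, ← map_coeff]
  exact pow_eq_zero_iff hp.out.ne_zero |>.1 h

end WittLemmas

/-! ### The operator `u ↦ Ψ' u^σ Ψ⁻¹` on matrices: contraction and rigidity. -/

section MatrixSigma

open WittVector Matrix

variable {p : ℕ} [hp : Fact p.Prime] {R S : Type*} [CommRing R] [CommRing S]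

theorem verschiebung_natCast_mul (k : ℕ) (x : WittVector p R) :
    verschiebung ((k : WittVector p R) * x) = (k : WittVector p R) * verschiebung x := by
  rw [← nsmul_eq_mul, map_nsmul, nsmul_eq_mul]

/-- All entries of a matrix lie in an ideal. -/
def EntriesIn {A m n : Type*} [CommRing A] (N : Ideal A) (u : Matrix m n A) : Prop :=
  ∀ i j, u i j ∈ N

namespace EntriesIn

variable {A m n k : Type*} [CommRing A] {N N' : Ideal A} {u v : Matrix m n A}

theorem mono (h : N ≤ N') (hu : EntriesIn N u) : EntriesIn N' u := fun i j => h (hu i j)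

theorem zero : EntriesIn N (0 : Matrix m n A) := fun _ _ => zero_mem _

theorem add (hu : EntriesIn N u) (hv : EntriesIn N v) : EntriesIn N (u + v) :=
  fun i j => add_mem (hu i j) (hv i j)

theorem sub (hu : EntriesIn N u) (hv : EntriesIn N v) : EntriesIn N (u - v) :=
  fun i j => sub_mem (hu i j) (hv i j)

theorem smul (a : A) (hu : EntriesIn N u) : EntriesIn N (a • u) :=
  fun i j => N.mul_mem_left a (hu i j)

theorem sum {ι : Type*} {s : Finset ι} {f : ι → Matrix m n A} (h : ∀ i ∈ s, EntriesIn N (f i)) :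
    EntriesIn N (∑ i ∈ s, f i) := fun i j => by
  rw [Matrix.sum_apply]; exact sum_mem fun x hx => h x hx i j

theorem mul_left [Fintype m] (w : Matrix k m A) (hu : EntriesIn N u) : EntriesIn N (w * u) :=
  fun i j => by
    rw [Matrix.mul_apply]; exact sum_mem fun x _ => N.mul_mem_left _ (hu x j)

theorem mul_right [Fintype n] (hu : EntriesIn N u) (w : Matrix n k A) : EntriesIn N (u * w) :=
  fun i j => by
    rw [Matrix.mul_apply]; exact sum_mem fun x _ => N.mul_mem_right _ (hu i x)

end EntriesIn

/-- On the ideal `N`, the shift behaves like the inverse of the Verschiebung. -/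
structure VinvLinear (N : Ideal (WittVector p R)) : Prop where
  add : ∀ x ∈ N, ∀ y ∈ N, vinv (x + y) = vinv x + vinv y
  mul : ∀ x ∈ N, ∀ y, vinv (x * y) = vinv x * frobenius y
  frob : ∀ x ∈ N, frobenius x = p * vinv x

theorem vinvLinear_vIdeal : VinvLinear (vIdeal p R 1) where
  add _ hx _ hy := vinv_add (mem_vIdeal_one.1 hx) (mem_vIdeal_one.1 hy)
  mul _ hx y := vinv_mul (mem_vIdeal_one.1 hx) y
  frob _ hx := frobenius_eq_p_mul_vinv (mem_vIdeal_one.1 hx)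

theorem vinvLinear_coeffIdeal {𝔞 : Ideal R} (h𝔞 : ∀ x ∈ 𝔞, ∀ y ∈ 𝔞, x * y = 0) :
    VinvLinear (coeffIdeal p 𝔞 1) where
  add _ hx _ hy := vinv_add_of_mem h𝔞 (mem_coeffIdeal.1 hx 0 one_pos)
    (mem_coeffIdeal.1 hy 0 one_pos)
  mul _ hx y := vinv_mul_of_mem h𝔞 (mem_coeffIdeal.1 hx 0 one_pos) y
  frob _ hx := frobenius_eq_p_mul_vinv_of_mem h𝔞 (mem_coeffIdeal.1 hx 0 one_pos)

namespace VinvLinear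

variable {N : Ideal (WittVector p R)} (hN : VinvLinear N)

theorem sum (hN : VinvLinear N) {ι : Type*} (s : Finset ι) (f : ι → WittVector p R)
    (h : ∀ i ∈ s, f i ∈ N) : vinv (∑ i ∈ s, f i) = ∑ i ∈ s, vinv (f i) := by
  classical
  induction s using Finset.induction_on with
  | empty => simp
  | insert a s ha ih =>
    rw [Finset.sum_insert ha, Finset.sum_insert ha, hN.add _ (h a (by simp)) _
      (sum_mem fun i hi => h i (Finset.mem_insert_of_mem hi)),
      ih fun i hi => h i (Finset.mem_insert_of_mem hi)]

variable {m n k : Type*}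

theorem map_add (hN : VinvLinear N) {u v : Matrix m n (WittVector p R)} (hu : EntriesIn N u)
    (hv : EntriesIn N v) : (u + v).map vinv = u.map vinv + v.map vinv := by
  ext1 i j; exact hN.add _ (hu i j) _ (hv i j)

theorem map_mul [Fintype n] (hN : VinvLinear N) {u : Matrix m n (WittVector p R)}
    (hu : EntriesIn N u) (v : Matrix n k (WittVector p R)) :
    (u * v).map vinv = u.map vinv * v.map frobenius := by
  ext1 i j
  simp only [map_apply, mul_apply]
  rw [hN.sum _ _ fun x _ => N.mul_mem_right _ (hu i x)]
  exact Finset.sum_congr rfl fun x _ => hN.mul _ (hu i x) _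

theorem map_mul_left [Fintype m] (hN : VinvLinear N) (v : Matrix k m (WittVector p R))
    {u : Matrix m n (WittVector p R)} (hu : EntriesIn N u) :
    (v * u).map vinv = v.map frobenius * u.map vinv := by
  ext1 i j
  simp only [map_apply, mul_apply]
  rw [hN.sum _ _ fun x _ => N.mul_mem_left _ (hu x j)]
  refine Finset.sum_congr rfl fun x _ => ?_
  rw [mul_comm, hN.mul _ (hu x j), mul_comm]

theorem map_frob (hN : VinvLinear N) {u : Matrix m n (WittVector p R)} (hu : EntriesIn N u) :
    u.map frobenius = (p : WittVector p R) • u.map vinv := by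
  ext1 i j; exact hN.frob _ (hu i j)

end VinvLinear

variable {t l t' l' t'' l'' : Type*}

/-- The matrix of `f^σ` attached to the matrix of `f`. -/
def sig (u : Matrix (t' ⊕ l') (t ⊕ l) (WittVector p R)) :
    Matrix (t' ⊕ l') (t ⊕ l) (WittVector p R) :=
  fromBlocks (u.toBlocks₁₁.map frobenius) (u.toBlocks₁₂.map vinv)
    ((p : WittVector p R) • u.toBlocks₂₁.map frobenius) (u.toBlocks₂₂.map frobenius)

/-- The upper right block has entries in `I_R`. -/
def IsFil (u : Matrix (t' ⊕ l') (t ⊕ l) (WittVector p R)) : Prop :=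
  EntriesIn (vIdeal p R 1) u.toBlocks₁₂

section

variable {u v : Matrix (t' ⊕ l') (t ⊕ l) (WittVector p R)}

theorem IsFil.of_entriesIn {n : ℕ} (hn : 1 ≤ n) (h : EntriesIn (vIdeal p R n) u) : IsFil u :=
  fun _ _ => coeffIdeal_antitone _ hn (h _ _)

theorem IsFil.add (hu : IsFil u) (hv : IsFil v) : IsFil (u + v) := EntriesIn.add hu hv
theorem IsFil.sub (hu : IsFil u) (hv : IsFil v) : IsFil (u - v) := EntriesIn.sub hu hv
theorem IsFil.smul (a : WittVector p R) (hu : IsFil u) : IsFil (a • u) := EntriesIn.smul a hu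

theorem fromBlocks_congr {A : Type*} {a a' : Matrix t' t A} {b b' : Matrix t' l A}
    {c c' : Matrix l' t A} {d d' : Matrix l' l A} (ha : a = a') (hb : b = b') (hc : c = c')
    (hd : d = d') : fromBlocks a b c d = fromBlocks a' b' c' d' := by
  rw [ha, hb, hc, hd]

theorem toBlocks_add {A : Type*} [Add A] (u v : Matrix (t' ⊕ l') (t ⊕ l) A) :
    (u + v).toBlocks₁₁ = u.toBlocks₁₁ + v.toBlocks₁₁ ∧
    (u + v).toBlocks₁₂ = u.toBlocks₁₂ + v.toBlocks₁₂ ∧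
    (u + v).toBlocks₂₁ = u.toBlocks₂₁ + v.toBlocks₂₁ ∧
    (u + v).toBlocks₂₂ = u.toBlocks₂₂ + v.toBlocks₂₂ := ⟨rfl, rfl, rfl, rfl⟩

theorem toBlocks_smul {A : Type*} [Mul A] (k : A) (u : Matrix (t' ⊕ l') (t ⊕ l) A) :
    (k • u).toBlocks₁₁ = k • u.toBlocks₁₁ ∧ (k • u).toBlocks₁₂ = k • u.toBlocks₁₂ ∧
    (k • u).toBlocks₂₁ = k • u.toBlocks₂₁ ∧ (k • u).toBlocks₂₂ = k • u.toBlocks₂₂ :=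
  ⟨rfl, rfl, rfl, rfl⟩

theorem map_frobenius_add {m n : Type*} (u v : Matrix m n (WittVector p R)) :
    (u + v).map frobenius = u.map frobenius + v.map frobenius :=
  Matrix.map_add _ (_root_.map_add _) u v

theorem map_frobenius_natCast_smul {m n : Type*} (k : ℕ) (w : Matrix m n (WittVector p R)) :
    ((k : WittVector p R) • w).map frobenius = (k : WittVector p R) • w.map frobenius := by
  ext1 i j
  simp

theorem sig_add (hu : IsFil u) (hv : IsFil v) : sig (u + v) = sig u + sig v := by
  obtain ⟨h₁, h₂, h₃, h₄⟩ := toBlocks_add u v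
  rw [sig, sig, sig, fromBlocks_add, h₁, h₂, h₃, h₄]
  refine fromBlocks_congr (map_frobenius_add _ _) (vinvLinear_vIdeal.map_add hu hv) ?_
    (map_frobenius_add _ _)
  rw [map_frobenius_add, smul_add]

@[simp] theorem sig_zero : sig (0 : Matrix (t' ⊕ l') (t ⊕ l) (WittVector p R)) = 0 := by
  rw [sig, ← fromBlocks_zero]
  congr 1 <;> ext1 <;> simp [toBlocks₁₁, toBlocks₁₂, toBlocks₂₁, toBlocks₂₂]

theorem sig_natCast_smul (k : ℕ) (hu : IsFil u) :
    sig ((k : WittVector p R) • u) = (k : WittVector p R) • sig u := by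
  obtain ⟨h₁, h₂, h₃, h₄⟩ := toBlocks_smul (k : WittVector p R) u
  rw [sig, sig, fromBlocks_smul, h₁, h₂, h₃, h₄]
  refine fromBlocks_congr (map_frobenius_natCast_smul k _) ?_ ?_
    (map_frobenius_natCast_smul k _)
  swap; · rw [map_frobenius_natCast_smul, smul_comm]
  ext1 i j
  have h := vinvLinear_vIdeal.mul _ (hu i j) (k : WittVector p R)
  rw [map_natCast, mul_comm, mul_comm (vinv _)] at h
  exact h

theorem sig_sub (hu : IsFil u) (hv : IsFil v) : sig (u - v) = sig u - sig v := by
  rw [eq_sub_iff_add_eq, ← sig_add (hu.sub hv) hv, sub_add_cancel]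

end

theorem toBlocks_mul {A : Type*} [NonUnitalNonAssocSemiring A] [Fintype t'] [Fintype l']
    (u : Matrix (t'' ⊕ l'') (t' ⊕ l') A) (v : Matrix (t' ⊕ l') (t ⊕ l) A) :
    (u * v).toBlocks₁₁ = u.toBlocks₁₁ * v.toBlocks₁₁ + u.toBlocks₁₂ * v.toBlocks₂₁ ∧
    (u * v).toBlocks₁₂ = u.toBlocks₁₁ * v.toBlocks₁₂ + u.toBlocks₁₂ * v.toBlocks₂₂ ∧
    (u * v).toBlocks₂₁ = u.toBlocks₂₁ * v.toBlocks₁₁ + u.toBlocks₂₂ * v.toBlocks₂₁ ∧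
    (u * v).toBlocks₂₂ = u.toBlocks₂₁ * v.toBlocks₁₂ + u.toBlocks₂₂ * v.toBlocks₂₂ := by
  refine ⟨?_, ?_, ?_, ?_⟩ <;> ext1 i j <;>
    simp [toBlocks₁₁, toBlocks₁₂, toBlocks₂₁, toBlocks₂₂, mul_apply, Fintype.sum_sum_type]

theorem IsFil.mul [Fintype t'] [Fintype l']
    {u : Matrix (t'' ⊕ l'') (t' ⊕ l') (WittVector p R)} (hu : IsFil u)
    {v : Matrix (t' ⊕ l') (t ⊕ l) (WittVector p R)} (hv : IsFil v) : IsFil (u * v) := by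
  rw [IsFil, (toBlocks_mul u v).2.1]
  exact (EntriesIn.mul_left _ hv).add (EntriesIn.mul_right hu _)

/-- The factor `p` in the lower left block matches `F(b) = p · vinv b` for the upper right block, so
the cross terms agree. -/
theorem sig_mul [Fintype t'] [Fintype l']
    {u : Matrix (t'' ⊕ l'') (t' ⊕ l') (WittVector p R)} (hu : IsFil u)
    {v : Matrix (t' ⊕ l') (t ⊕ l) (WittVector p R)} (hv : IsFil v) :
    sig (u * v) = sig u * sig v := by
  obtain ⟨h₁, h₂, h₃, h₄⟩ := toBlocks_mul u v
  rw [sig, h₁, h₂, h₃, h₄, sig, sig, fromBlocks_multiply,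
    vinvLinear_vIdeal.map_add (EntriesIn.mul_left _ hv) (EntriesIn.mul_right hu _),
    vinvLinear_vIdeal.map_mul_left _ hv, vinvLinear_vIdeal.map_mul hu]
  simp only [map_frobenius_add, Matrix.map_mul, vinvLinear_vIdeal.map_frob hu,
    vinvLinear_vIdeal.map_frob hv]
  refine fromBlocks_congr ?_ rfl ?_ ?_
  · rw [Matrix.mul_smul, Matrix.smul_mul]
  · rw [smul_add, Matrix.mul_smul, Matrix.smul_mul]
  · rw [Matrix.mul_smul, Matrix.smul_mul]

theorem map_sig (φ : R →+* S) (u : Matrix (t' ⊕ l') (t ⊕ l) (WittVector p R)) :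
    (sig u).map (WittVector.map φ) = sig (u.map (WittVector.map φ)) := by
  ext1 (i | i) (j | j) <;>
    simp [sig, toBlocks₁₁, toBlocks₁₂, toBlocks₂₁, toBlocks₂₂, map_frobenius, map_vinv]

variable [Fintype t] [Fintype l] [Fintype t'] [Fintype l']

/-- The operator `u ↦ Ψ' u^σ Ψ⁻¹`. -/
def phi (Ψ' : Matrix (t' ⊕ l') (t' ⊕ l') (WittVector p R))
    (Ψi : Matrix (t ⊕ l) (t ⊕ l) (WittVector p R))
    (u : Matrix (t' ⊕ l') (t ⊕ l) (WittVector p R)) :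
    Matrix (t' ⊕ l') (t ⊕ l) (WittVector p R) :=
  Ψ' * sig u * Ψi

/-- `x` lies in the kernel of `W(R) → R / p R`. -/
def IsResidual (x : WittVector p R) : Prop :=
  ∃ a b : WittVector p R, x = (p : WittVector p R) * a + verschiebung b

/-- The iterated matrices `F^{k-1}(z) ⋯ F(z) z`, starting from an idempotent matrix. -/
def zeta (eL z : Matrix l l (WittVector p R)) : ℕ → Matrix l l (WittVector p R)
  | 0 => eL
  | k + 1 => (zeta eL z k).map frobenius * z

variable {Ψ' : Matrix (t' ⊕ l') (t' ⊕ l') (WittVector p R)}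
  {Ψi : Matrix (t ⊕ l) (t ⊕ l) (WittVector p R)}
  {u v : Matrix (t' ⊕ l') (t ⊕ l) (WittVector p R)}

theorem phi_add (hu : IsFil u) (hv : IsFil v) : phi Ψ' Ψi (u + v) = phi Ψ' Ψi u + phi Ψ' Ψi v := by
  rw [phi, sig_add hu hv, Matrix.mul_add, Matrix.add_mul]; rfl

theorem phi_sub (hu : IsFil u) (hv : IsFil v) : phi Ψ' Ψi (u - v) = phi Ψ' Ψi u - phi Ψ' Ψi v := by
  rw [phi, sig_sub hu hv, Matrix.mul_sub, Matrix.sub_mul]; rfl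

@[simp] theorem phi_zero : phi Ψ' Ψi 0 = 0 := by simp [phi]

theorem phi_natCast_smul (k : ℕ) (hu : IsFil u) :
    phi Ψ' Ψi ((k : WittVector p R) • u) = (k : WittVector p R) • phi Ψ' Ψi u := by
  rw [phi, sig_natCast_smul k hu, Matrix.mul_smul, Matrix.smul_mul]; rfl

theorem sig_entriesIn {X : ℕ → Ideal (WittVector p R)} (hX : ∀ n, X n ≤ vIdeal p R n)
    (hvX : ∀ n, ∀ x ∈ X (n + 1), vinv x ∈ X n) {n : ℕ} (hu : EntriesIn (X (n + 1)) u) :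
    EntriesIn (X n) (sig u) := by
  have h1 : ∀ i j, frobenius (u i j) = p * vinv (u i j) := fun i j =>
    vinvLinear_vIdeal.frob _ (coeffIdeal_antitone _ (by omega) (hX _ (hu i j)))
  have h2 : ∀ i j, vinv (u i j) ∈ X n := fun i j => hvX _ _ (hu i j)
  rintro (i | i) (j | j) <;>
    simp [sig, toBlocks₁₁, toBlocks₁₂, toBlocks₂₁, toBlocks₂₂, h1, h2, Ideal.mul_mem_left]

theorem phi_entriesIn {X : ℕ → Ideal (WittVector p R)} (hX : ∀ n, X n ≤ vIdeal p R n)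
    (hvX : ∀ n, ∀ x ∈ X (n + 1), vinv x ∈ X n) {n : ℕ} (hu : EntriesIn (X (n + 1)) u) :
    EntriesIn (X n) (phi Ψ' Ψi u) :=
  ((sig_entriesIn hX hvX hu).mul_left _).mul_right _

theorem phi_iterate_entriesIn {X : ℕ → Ideal (WittVector p R)} (hX : ∀ n, X n ≤ vIdeal p R n)
    (hvX : ∀ n, ∀ x ∈ X (n + 1), vinv x ∈ X n) (k : ℕ) :
    ∀ {n : ℕ} {u}, EntriesIn (X (n + k)) u → EntriesIn (X n) ((phi Ψ' Ψi)^[k] u) := by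
  induction k with
  | zero => exact fun hu => hu
  | succ k ih =>
    intro n u hu
    rw [Function.iterate_succ_apply']
    refine phi_entriesIn hX hvX (ih ?_)
    rwa [add_right_comm]

/-- All terms but the last involve `F` of an entry, hence gain a factor `p` on `V W(R)`. The last
one, `vinv` of the upper right block times `z̆`, is the only obstruction to contraction. -/
theorem toBlocks₁₂_phi (u : Matrix (t' ⊕ l') (t ⊕ l) (WittVector p R)) :
    (phi Ψ' Ψi u).toBlocks₁₂ =
      (Ψ'.toBlocks₁₁ * u.toBlocks₁₁.map frobenius +
        Ψ'.toBlocks₁₂ * ((p : WittVector p R) • u.toBlocks₂₁.map frobenius)) * Ψi.toBlocks₁₂ +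
      Ψ'.toBlocks₁₂ * u.toBlocks₂₂.map frobenius * Ψi.toBlocks₂₂ +
      Ψ'.toBlocks₁₁ * u.toBlocks₁₂.map vinv * Ψi.toBlocks₂₂ := by
  rw [phi, (toBlocks_mul _ _).2.1, (toBlocks_mul _ _).1, (toBlocks_mul _ _).2.1, sig,
    toBlocks_fromBlocks₁₁, toBlocks_fromBlocks₁₂, toBlocks_fromBlocks₂₁, toBlocks_fromBlocks₂₂,
    Matrix.add_mul (Ψ'.toBlocks₁₁ * u.toBlocks₁₂.map vinv)]
  abel

/-- If `z` is nilpotent, then `e + 1` iterations of `u ↦ Ψ' u^σ Ψ⁻¹` map matrices with entries in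
`X` to matrices with entries in `Y`, where `p X ⊆ Y`. -/
theorem phi_iterate_gain {X Y : ℕ → Ideal (WittVector p R)} (hX : ∀ n, X n ≤ vIdeal p R n)
    (hY : ∀ n, Y n ≤ vIdeal p R n) (hpX : ∀ n, ∀ x ∈ X n, (p : WittVector p R) * x ∈ Y n)
    (hvX : ∀ n, ∀ x ∈ X (n + 1), vinv x ∈ X n) (hvY : ∀ n, ∀ x ∈ Y (n + 1), vinv x ∈ Y n)
    (hVX : ∀ n, ∀ x ∈ X n, verschiebung x ∈ X (n + 1)) {eL : Matrix l l (WittVector p R)} {e : ℕ}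
    (hz : ∀ i j, IsResidual (zeta eL Ψi.toBlocks₂₂ e i j))
    (hu' : u.toBlocks₁₂ * eL = u.toBlocks₁₂) {n : ℕ} (hu : EntriesIn (X (n + (e + 1))) u) :
    EntriesIn (Y n) ((phi Ψ' Ψi)^[e + 1] u) := by
  have hF : ∀ {n} {x : WittVector p R}, x ∈ X (n + 1) → frobenius x ∈ Y n := fun {n x} hx => by
    rw [vinvLinear_vIdeal.frob _ (coeffIdeal_antitone _ (by omega) (hX _ hx))]
    exact hpX _ _ (hvX _ _ hx)
  -- Modulo `Y`, the upper right block of `Φ^k(u)` factors as `y · F^{k-1}(z̆) ⋯ z̆`. For `k = 0`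
  -- the product is `eL`, which is why `u` must be fixed by `eL` on the right.
  have step : ∀ k n, EntriesIn (X (n + k)) u → ∃ y : Matrix t' l (WittVector p R),
      EntriesIn (X n) y ∧
      EntriesIn (Y n) (((phi Ψ' Ψi)^[k] u).toBlocks₁₂ - y * zeta eL Ψi.toBlocks₂₂ k) := by
    intro k
    induction k with
    | zero =>
      intro n hu
      refine ⟨u.toBlocks₁₂, fun i j => hu _ _, ?_⟩
      rw [zeta, Function.iterate_zero, id, hu', sub_self]
      exact EntriesIn.zero
    | succ k ih =>
      intro n hu
      obtain ⟨y, hy, hr⟩ := ih (n + 1) (by rwa [add_right_comm])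
      have hU : EntriesIn (X (n + 1)) ((phi Ψ' Ψi)^[k] u) :=
        phi_iterate_entriesIn hX hvX k (by rwa [add_right_comm])
      rw [Function.iterate_succ_apply']
      set U := (phi Ψ' Ψi)^[k] u
      set ζ := zeta eL Ψi.toBlocks₂₂ k
      refine ⟨Ψ'.toBlocks₁₁ * y.map vinv,
        EntriesIn.mul_left _ fun i j => hvX _ _ (hy i j), ?_⟩
      have hy1 : EntriesIn (vIdeal p R 1) y := hy.mono ((hX _).trans (coeffIdeal_antitone _
          (by omega)))
      have hr1 := hr.mono ((hY _).trans (coeffIdeal_antitone _ (by omega : 1 ≤ n + 1)))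
      have hb : U.toBlocks₁₂.map vinv = y.map vinv * ζ.map frobenius +
          (U.toBlocks₁₂ - y * ζ).map vinv := by
        rw [← vinvLinear_vIdeal.map_mul hy1, ← vinvLinear_vIdeal.map_add (hy1.mul_right _) hr1,
          add_sub_cancel]
      have hsplit : Ψ'.toBlocks₁₁ * U.toBlocks₁₂.map vinv * Ψi.toBlocks₂₂ =
          Ψ'.toBlocks₁₁ * y.map vinv * (ζ.map frobenius * Ψi.toBlocks₂₂) +
          Ψ'.toBlocks₁₁ * (U.toBlocks₁₂ - y * ζ).map vinv * Ψi.toBlocks₂₂ := by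
        rw [hb, Matrix.mul_add, Matrix.add_mul]
        simp only [Matrix.mul_assoc]
      rw [toBlocks₁₂_phi, hsplit, zeta, add_left_comm, add_sub_cancel_left]
      refine (EntriesIn.add ?_ ?_).add ?_
      · refine EntriesIn.mul_right (EntriesIn.add (EntriesIn.mul_left _ ?_)
          (EntriesIn.mul_left _ (EntriesIn.smul _ ?_))) _ <;> exact fun i j => hF (hU _ _)
      · refine EntriesIn.mul_right (EntriesIn.mul_left _ ?_) _
        exact fun i j => hF (hU _ _)
      · refine EntriesIn.mul_right (EntriesIn.mul_left _ ?_) _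
        exact fun i j => hvY _ _ (hr i j)
  -- After `e` iterations only the upper right block is known to lie in `Y`. One more iteration
  -- brings in the other blocks through `F = p · vinv` and costs one level of the filtration.
  obtain ⟨y, hy, hr⟩ := step e (n + 1) (by rwa [add_assoc, add_comm 1])
  have hU : EntriesIn (X (n + 1)) ((phi Ψ' Ψi)^[e] u) :=
    phi_iterate_entriesIn hX hvX e (by rwa [add_assoc, add_comm 1])
  rw [Function.iterate_succ_apply']
  set U := (phi Ψ' Ψi)^[e] u
  have hb : EntriesIn (Y (n + 1)) U.toBlocks₁₂ := by
    rw [← sub_add_cancel U.toBlocks₁₂ (y * zeta eL Ψi.toBlocks₂₂ e)]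
    refine hr.add fun i j => ?_
    rw [mul_apply]
    refine sum_mem fun x _ => ?_
    obtain ⟨a, b, hab⟩ := hz x j
    have h1 := vinvLinear_vIdeal.frob _ (coeffIdeal_antitone _ (by omega) (hX _ (hy i x)))
    -- The part of `ζ_e` in `V W(R)` also contributes a factor `p`: `y V(b) = V(F(y) b)` and `F(y) =
    -- p · vinv y`.
    have h2 : y i x * verschiebung b = p * verschiebung (vinv (y i x) * b) := by
      rw [mul_verschiebung, h1, mul_assoc, verschiebung_natCast_mul]
    rw [hab, mul_add, h2, ← mul_assoc, mul_right_comm, mul_comm _ (p : WittVector p R)]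
    refine add_mem (hpX _ _ (Ideal.mul_mem_right _ _ (hy i x))) (hpX _ _ (hVX _ _ ?_))
    exact Ideal.mul_mem_right _ _ (hvX _ _ (hy i x))
  refine EntriesIn.mul_right (EntriesIn.mul_left _ ?_) _
  rintro (i | i) (j | j)
  · exact hF (hU _ _)
  · exact hvY _ _ (hb _ _)
  · exact Ideal.mul_mem_left _ _ (hF (hU _ _))
  · exact hF (hU _ _)

theorem phi_mul_blocks {e : Matrix (t ⊕ l) (t ⊕ l) (WittVector p R)} (h : Ψi * e = Ψi) (u) :
    phi Ψ' Ψi u * e = phi Ψ' Ψi u := by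
  rw [phi, Matrix.mul_assoc, h]

theorem vinv_natCast_mul (k : ℕ) {x : WittVector p R} (hx : x.coeff 0 = 0) :
    vinv ((k : WittVector p R) * x) = (k : WittVector p R) * vinv x := by
  rw [mul_comm, vinv_mul hx, map_natCast, mul_comm]

theorem coeff_zero_of_mem_vIdeal {n : ℕ} {x : WittVector p R} (hx : x ∈ vIdeal p R (n + 1)) :
    x.coeff 0 = 0 := mem_vIdeal.1 hx 0 n.succ_pos

theorem phi_iterate_toBlocks₁₂ {eL : Matrix l l (WittVector p R)}
    (hΨ : ∀ w : Matrix (t' ⊕ l') (t ⊕ l) (WittVector p R),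
      (phi Ψ' Ψi w).toBlocks₁₂ * eL = (phi Ψ' Ψi w).toBlocks₁₂)
    (hu' : u.toBlocks₁₂ * eL = u.toBlocks₁₂) (k : ℕ) :
    ((phi Ψ' Ψi)^[k] u).toBlocks₁₂ * eL = ((phi Ψ' Ψi)^[k] u).toBlocks₁₂ := by
  cases k with
  | zero => exact hu'
  | succ k => rw [Function.iterate_succ_apply', hΨ]

/-- Each block of `e + 1` iterations gains one factor `p`: the contraction is applied with `X_n =
p^k V^n W(R)` and `Y_n = p^{k+1} V^n W(R)`. -/
theorem phi_iterate_pow {eL : Matrix l l (WittVector p R)} {e : ℕ}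
    (hz : ∀ i j, IsResidual (zeta eL Ψi.toBlocks₂₂ e i j))
    (hΨ : ∀ w : Matrix (t' ⊕ l') (t ⊕ l) (WittVector p R),
      (phi Ψ' Ψi w).toBlocks₁₂ * eL = (phi Ψ' Ψi w).toBlocks₁₂)
    (hu' : u.toBlocks₁₂ * eL = u.toBlocks₁₂) (k : ℕ) :
    ∀ {n : ℕ}, EntriesIn (vIdeal p R (n + k * (e + 1))) u →
      EntriesIn (Ideal.span {(p : WittVector p R) ^ k} * vIdeal p R n)
        ((phi Ψ' Ψi)^[k * (e + 1)] u) := by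
  induction k with
  | zero => intro n hu; simpa using hu
  | succ k ih =>
    intro n hu
    rw [Nat.succ_mul, add_comm (k * (e + 1)), Function.iterate_add_apply]
    have hv : ∀ k n, ∀ x ∈ Ideal.span {(p : WittVector p R) ^ k} * vIdeal p R (n + 1),
        vinv x ∈ Ideal.span {(p : WittVector p R) ^ k} * vIdeal p R n := by
      intro k n x hx
      obtain ⟨y, hy, rfl⟩ := Ideal.mem_span_singleton_mul.1 hx
      rw [← Nat.cast_pow, vinv_natCast_mul _ (coeff_zero_of_mem_vIdeal hy), Nat.cast_pow]
      exact Ideal.mem_span_singleton_mul.2 ⟨_, vinv_mem_coeffIdeal hy, rfl⟩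
    refine phi_iterate_gain (X := fun n => Ideal.span {(p : WittVector p R) ^ k} * vIdeal p R n)
      (Y := fun n => Ideal.span {(p : WittVector p R) ^ (k + 1)} * vIdeal p R n)
      (fun n => Ideal.mul_le_right) (fun n => Ideal.mul_le_right) ?_ (hv k) (hv (k + 1)) ?_ hz
      (phi_iterate_toBlocks₁₂ hΨ hu' _) (ih ?_)
    · intro n x hx
      obtain ⟨y, hy, rfl⟩ := Ideal.mem_span_singleton_mul.1 hx
      exact Ideal.mem_span_singleton_mul.2 ⟨y, hy, by rw [pow_succ', mul_assoc]⟩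
    · intro n x hx
      obtain ⟨y, hy, rfl⟩ := Ideal.mem_span_singleton_mul.1 hx
      rw [← Nat.cast_pow, verschiebung_natCast_mul, Nat.cast_pow]
      exact Ideal.mem_span_singleton_mul.2 ⟨_, verschiebung_mem_vIdeal hy, rfl⟩
    · rwa [add_assoc, add_comm (e + 1), ← Nat.succ_mul]

/-- Dual to the gain of powers of `p`: here `X_n` and `Y_n` are the `p^{k+1}`-torsion and the
`p^k`-torsion in `V^n W(R)`, so each block of `e + 1` iterations lowers the torsion exponent by one.
-/
theorem phi_iterate_torsion {eL : Matrix l l (WittVector p R)} {e : ℕ}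
    (hz : ∀ i j, IsResidual (zeta eL Ψi.toBlocks₂₂ e i j))
    (hΨ : ∀ w : Matrix (t' ⊕ l') (t ⊕ l) (WittVector p R),
      (phi Ψ' Ψi w).toBlocks₁₂ * eL = (phi Ψ' Ψi w).toBlocks₁₂) (k : ℕ) :
    ∀ {u : Matrix (t' ⊕ l') (t ⊕ l) (WittVector p R)},
      u.toBlocks₁₂ * eL = u.toBlocks₁₂ → (∀ i j, (p : WittVector p R) ^ k * u i j = 0) →
      EntriesIn (vIdeal p R (k * (e + 1))) u → (phi Ψ' Ψi)^[k * (e + 1)] u = 0 := by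
  induction k with
  | zero =>
    intro u _ hu _
    ext1 i j
    simpa using hu i j
  | succ k ih =>
    intro u hu' hu hn
    have hv : ∀ k n, ∀ x ∈ vIdeal p R (n + 1) ⊓
        Submodule.torsionBy (WittVector p R) (WittVector p R) ((p : WittVector p R) ^ k),
        vinv x ∈ vIdeal p R n ⊓
          Submodule.torsionBy (WittVector p R) (WittVector p R) ((p : WittVector p R) ^ k) := by
      rintro k n x ⟨hx₁, hx₂⟩
      refine ⟨vinv_mem_coeffIdeal hx₁, ?_⟩
      rw [SetLike.mem_coe, Submodule.mem_torsionBy_iff, smul_eq_mul] at hx₂ ⊢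
      rw [← Nat.cast_pow, ← vinv_natCast_mul _ (coeff_zero_of_mem_vIdeal hx₁), Nat.cast_pow, hx₂,
        vinv_zero]
    have h : EntriesIn (vIdeal p R (k * (e + 1)) ⊓
        Submodule.torsionBy (WittVector p R) (WittVector p R) ((p : WittVector p R) ^ k))
        ((phi Ψ' Ψi)^[e + 1] u) := by
      refine phi_iterate_gain (X := fun n => vIdeal p R n ⊓
        Submodule.torsionBy (WittVector p R) (WittVector p R) ((p : WittVector p R) ^ (k + 1)))
        (Y := fun n => vIdeal p R n ⊓
        Submodule.torsionBy (WittVector p R) (WittVector p R) ((p : WittVector p R) ^ k))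
        (fun n => inf_le_left) (fun n => inf_le_left) ?_ (hv (k + 1)) (hv k) ?_ hz hu' ?_
      · rintro n x ⟨hx₁, hx₂⟩
        rw [SetLike.mem_coe, Submodule.mem_torsionBy_iff, smul_eq_mul] at hx₂
        refine ⟨Ideal.mul_mem_left _ _ hx₁, ?_⟩
        rw [SetLike.mem_coe, Submodule.mem_torsionBy_iff, smul_eq_mul, ← mul_assoc, ← pow_succ, hx₂]
      · rintro n x ⟨hx₁, hx₂⟩
        refine ⟨verschiebung_mem_vIdeal hx₁, ?_⟩
        rw [SetLike.mem_coe, Submodule.mem_torsionBy_iff, smul_eq_mul] at hx₂ ⊢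
        rw [← Nat.cast_pow, ← verschiebung_natCast_mul, Nat.cast_pow, hx₂, _root_.map_zero]
      · intro i j
        refine ⟨?_, by rw [SetLike.mem_coe, Submodule.mem_torsionBy_iff]; exact hu i j⟩
        have := hn i j
        rwa [Nat.succ_mul] at this
    rw [Nat.succ_mul, Function.iterate_add_apply]
    refine ih (phi_iterate_toBlocks₁₂ hΨ hu' _) (fun i j => ?_) fun i j => (h i j).1
    have := (h i j).2
    rwa [SetLike.mem_coe, Submodule.mem_torsionBy_iff] at this

/-- A fixed point of `u ↦ Ψ' u^σ Ψ⁻¹` that is killed by `p` vanishes if its leading coefficients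
lie in an ideal of square zero. -/
theorem eq_zero_of_phi_fixed_of_sq_zero {𝔞 : Ideal R} (h𝔞 : ∀ x ∈ 𝔞, ∀ y ∈ 𝔞, x * y = 0)
    {eL : Matrix l l (WittVector p R)} {e : ℕ}
    (hz : ∀ i j, IsResidual (zeta eL Ψi.toBlocks₂₂ e i j))
    (hu' : u.toBlocks₁₂ * eL = u.toBlocks₁₂) (hfix : phi Ψ' Ψi u = u)
    (hp : ∀ i j, (p : WittVector p R) * u i j = 0)
    (hu : EntriesIn (coeffIdeal p 𝔞 (e + 1)) u) : u = 0 := by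
  have hN := vinvLinear_coeffIdeal (p := p) h𝔞
  have hpv : ∀ x ∈ coeffIdeal p 𝔞 1, (p : WittVector p R) * x = 0 →
      (p : WittVector p R) * vinv x = 0 := fun x hx h => by
    have := hN.mul x hx (p : WittVector p R)
    rw [mul_comm, h, vinv_zero, map_natCast, mul_comm] at this
    exact this.symm
  have hF : ∀ i j, frobenius (u i j) = 0 := fun i j => by
    have h1 := coeffIdeal_antitone _ (by omega : 1 ≤ e + 1) (hu i j)
    rw [hN.frob _ h1, hpv _ h1 (hp i j)]
  -- Since `F(u) = p · vinv u = 0`, the obstructing term is all that remains, now as an exact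
  -- equation.
  have hb : u.toBlocks₁₂ = Ψ'.toBlocks₁₁ * u.toBlocks₁₂.map vinv * Ψi.toBlocks₂₂ := by
    have h11 : u.toBlocks₁₁.map frobenius = 0 := by ext1 i j; exact hF _ _
    have h21 : u.toBlocks₂₁.map frobenius = 0 := by ext1 i j; exact hF _ _
    have h22 : u.toBlocks₂₂.map frobenius = 0 := by ext1 i j; exact hF _ _
    conv_lhs => rw [← hfix, toBlocks₁₂_phi, h11, h21, h22]
    simp
  -- Iterating that equation uses up one controlled coefficient per step. Starting with `e + 1` of
  -- them leaves one after `e` steps, just enough to apply `F = p · vinv` to `y` once more.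
  have step : ∀ k ≤ e, ∃ y : Matrix t' l (WittVector p R),
      EntriesIn (coeffIdeal p 𝔞 (e + 1 - k)) y ∧ (∀ i j, (p : WittVector p R) * y i j = 0) ∧
      u.toBlocks₁₂ = y * zeta eL Ψi.toBlocks₂₂ k := by
    intro k
    induction k with
    | zero => exact fun _ => ⟨u.toBlocks₁₂, fun i j => hu _ _, fun i j => hp _ _, hu'.symm⟩
    | succ k ih =>
      intro hk
      obtain ⟨y, hy, hpy, h⟩ := ih (by omega)
      have hy1 : EntriesIn (coeffIdeal p 𝔞 1) y := hy.mono (coeffIdeal_antitone _ (by omega))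
      refine ⟨Ψ'.toBlocks₁₁ * y.map vinv, EntriesIn.mul_left _ fun i j =>
        vinv_mem_coeffIdeal ?_, fun i j => ?_, ?_⟩
      · rw [show e + 1 - (k + 1) + 1 = e + 1 - k by omega]; exact hy i j
      · rw [mul_apply, Finset.mul_sum]
        refine Finset.sum_eq_zero fun x _ => ?_
        rw [mul_left_comm, map_apply, hpv _ (hy1 _ _) (hpy _ _), mul_zero]
      · rw [zeta]
        conv_lhs => rw [hb, h, hN.map_mul hy1]
        simp only [Matrix.mul_assoc]
  obtain ⟨y, hy, hpy, h⟩ := step e le_rfl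
  have hb0 : u.toBlocks₁₂ = 0 := by
    rw [h]
    ext1 i j
    rw [mul_apply]
    refine Finset.sum_eq_zero fun x _ => ?_
    obtain ⟨a, b, hab⟩ := hz x j
    have h1 : y i x ∈ coeffIdeal p 𝔞 1 := by
      have := hy i x
      rwa [show e + 1 - e = 1 by omega] at this
    rw [hab, mul_add, mul_verschiebung, hN.frob _ h1, hpv _ h1 (hpy _ _), zero_mul,
      _root_.map_zero, mul_left_comm, ← mul_assoc, hpy, zero_mul, add_zero]
  have hsig : sig u = 0 := by
    rw [sig, ← fromBlocks_zero]
    refine fromBlocks_congr ?_ ?_ ?_ ?_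
    · ext1 i j; exact hF _ _
    · rw [hb0]; ext1 i j; exact vinv_zero
    · ext1 i j
      change (p : WittVector p R) * frobenius (u _ _) = 0
      rw [hF, mul_zero]
    · ext1 i j; exact hF _ _
  rw [← hfix, phi, hsig, Matrix.mul_zero, Matrix.zero_mul]

theorem IsResidual.map (φ : R →+* S) {x : WittVector p R} (hx : IsResidual x) :
    IsResidual (WittVector.map φ x) := by
  obtain ⟨a, b, rfl⟩ := hx
  exact ⟨WittVector.map φ a, WittVector.map φ b, by
    rw [_root_.map_add, _root_.map_mul, map_natCast, map_verschiebung]⟩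

theorem map_zeta (φ : R →+* S) (eL z : Matrix l l (WittVector p R)) (k : ℕ) :
    (zeta eL z k).map (WittVector.map φ) =
      zeta (eL.map (WittVector.map φ)) (z.map (WittVector.map φ)) k := by
  induction k with
  | zero => rfl
  | succ k ih =>
    rw [zeta, zeta, Matrix.map_mul, ← ih]
    congr 1
    ext1 i j
    simp [map_frobenius]

theorem map_phi (φ : R →+* S) (u : Matrix (t' ⊕ l') (t ⊕ l) (WittVector p R)) :
    (phi Ψ' Ψi u).map (WittVector.map φ) = phi (Ψ'.map (WittVector.map φ))
      (Ψi.map (WittVector.map φ)) (u.map (WittVector.map φ)) := by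
  rw [phi, phi, Matrix.map_mul, Matrix.map_mul, map_sig]

/-- The square-zero case is applied modulo `𝔞²`, where `𝔞` is generated by the finitely many
coefficients of index at most `e`. This gives `𝔞 = 𝔞²`, while `𝔞` consists of nilpotent elements, so
Nakayama applies. -/
theorem eq_zero_of_phi_fixed_of_p_mul {a : ℕ} (ha : (p : R) ^ a = 0)
    {eL : Matrix l l (WittVector p R)} {e : ℕ}
    (hz : ∀ i j, IsResidual (zeta eL Ψi.toBlocks₂₂ e i j))
    (hu' : u.toBlocks₁₂ * eL = u.toBlocks₁₂) (hfix : phi Ψ' Ψi u = u)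
    (hp : ∀ i j, (p : WittVector p R) * u i j = 0) : u = 0 := by
  set s : Set R := Set.range fun q : (t' ⊕ l') × (t ⊕ l) × Fin (e + 1) =>
    (u q.1 q.2.1).coeff q.2.2
  set 𝔞 : Ideal R := Ideal.span s
  have hfg : 𝔞.FG := Submodule.fg_span (Set.finite_range _)
  set φ := Ideal.Quotient.mk (𝔞 * 𝔞)
  have hzero : u.map (WittVector.map φ) = 0 := by
    refine eq_zero_of_phi_fixed_of_sq_zero (𝔞 := 𝔞.map φ) (Ψ' := Ψ'.map (WittVector.map φ))
      (Ψi := Ψi.map (WittVector.map φ)) (eL := eL.map (WittVector.map φ)) (e := e)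
      (fun x hx y hy => ?_) (fun i j => ?_) ?_ ?_ (fun i j => ?_) (fun i j => ?_)
    · obtain ⟨x, hx', rfl⟩ := (Ideal.mem_map_iff_of_surjective _ Ideal.Quotient.mk_surjective).1 hx
      obtain ⟨y, hy', rfl⟩ := (Ideal.mem_map_iff_of_surjective _ Ideal.Quotient.mk_surjective).1 hy
      rw [← _root_.map_mul, Ideal.Quotient.eq_zero_iff_mem]
      exact Ideal.mul_mem_mul hx' hy'
    · have h : (Ψi.map (WittVector.map φ)).toBlocks₂₂ = Ψi.toBlocks₂₂.map (WittVector.map φ) := rfl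
      rw [h, ← map_zeta]
      exact (hz i j).map φ
    · conv_rhs => rw [show (u.map (WittVector.map φ)).toBlocks₁₂ =
        u.toBlocks₁₂.map (WittVector.map φ) from rfl, ← hu', Matrix.map_mul]
      rfl
    · rw [← map_phi, hfix]
    · rw [map_apply, ← map_natCast (WittVector.map φ), ← _root_.map_mul, hp, _root_.map_zero]
    · rw [mem_coeffIdeal]
      intro k hk
      rw [map_apply, map_coeff]
      exact Ideal.mem_map_of_mem _ (Ideal.subset_span ⟨(i, j, ⟨k, hk⟩), rfl⟩)
  -- This holds for all coefficients, not only those that generate `𝔞`, so `𝔞 = 0` will finish the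
  -- proof.
  have hmem : ∀ i j k, (u i j).coeff k ∈ 𝔞 * 𝔞 := by
    intro i j k
    have := congrArg (fun x => WittVector.coeff x k) (congrFun (congrFun hzero i) j)
    change (WittVector.map φ (u i j)).coeff k = (0 : WittVector p (R ⧸ 𝔞 * 𝔞)).coeff k at this
    rw [map_coeff, zero_coeff] at this
    exact Ideal.Quotient.eq_zero_iff_mem.1 this
  have h𝔞 : 𝔞 = ⊥ := by
    refine Submodule.eq_bot_of_le_smul_of_le_jacobson_bot 𝔞 𝔞 hfg ?_ ?_
    · rw [Ideal.span_le]
      rintro _ ⟨q, rfl⟩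
      exact hmem _ _ _
    · rw [Ideal.span_le]
      rintro _ ⟨q, rfl⟩
      have hn := isNilpotent_coeff_of_p_mul_eq_zero ha (hp q.1 q.2.1) q.2.2
      have : nilradical R ≤ (⊥ : Ideal R).jacobson := by
        rw [nilradical, Ideal.zero_eq_bot]
        exact Ideal.radical_le_jacobson
      exact this hn
  ext i j k
  have := hmem i j k
  rw [h𝔞, Ideal.mul_bot, Ideal.mem_bot] at this
  rw [this]
  exact (zero_coeff p R k).symm

/-- A fixed point of `u ↦ Ψ' u^σ Ψ⁻¹` that is killed by a power of `p` vanishes. -/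
theorem eq_zero_of_phi_fixed {a : ℕ} (ha : (p : R) ^ a = 0) {eL : Matrix l l (WittVector p R)}
    {e : ℕ} (hz : ∀ i j, IsResidual (zeta eL Ψi.toBlocks₂₂ e i j))
    (hu' : u.toBlocks₁₂ * eL = u.toBlocks₁₂) (hfil : IsFil u) (hfix : phi Ψ' Ψi u = u) {k : ℕ}
    (hp : ∀ i j, (p : WittVector p R) ^ k * u i j = 0) : u = 0 := by
  induction k with
  | zero => ext1 i j; simpa using hp i j
  | succ k ih =>
    -- `p^k u` is again a fixed point and is killed by `p`, so the torsion exponent drops by one.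
    have h : (((p ^ k : ℕ) : WittVector p R) • u) = 0 := by
      refine eq_zero_of_phi_fixed_of_p_mul (Ψ' := Ψ') (Ψi := Ψi) ha hz ?_ ?_ fun i j => ?_
      · rw [(toBlocks_smul _ u).2.1, Matrix.smul_mul, hu']
      · rw [phi_natCast_smul _ hfil, hfix]
      · change (p : WittVector p R) * (((p ^ k : ℕ) : WittVector p R) * u i j) = 0
        rw [Nat.cast_pow, ← mul_assoc, ← pow_succ', hp]
    refine ih fun i j => ?_
    have := congrFun (congrFun h i) j
    rw [← Nat.cast_pow]
    exact this

end MatrixSigma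


/-! ### Displays in coordinates, and lifting of factorizations. -/

section WindowMatrices

open WittVector Matrix

variable {p : ℕ} [hp : Fact p.Prime] {R : Type*} [CommRing R]

/-- A display in coordinates: idempotent matrices `eT`, `eL` with images `T`, `L`, and the matrices
of `Ψ` and of its inverse. -/
structure WindowMatrix (p : ℕ) [Fact p.Prime] (R : Type*) [CommRing R] (t l : Type*)
    [Fintype t] [Fintype l] where
  /-- the projection onto `T` -/
  eT : Matrix t t (WittVector p R)
  /-- the projection onto `L` -/
  eL : Matrix l l (WittVector p R)
  /-- the matrix of `Ψ` -/
  Ψ : Matrix (t ⊕ l) (t ⊕ l) (WittVector p R)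
  /-- the matrix of `Ψ⁻¹` -/
  Ψi : Matrix (t ⊕ l) (t ⊕ l) (WittVector p R)
  eT_mul : eT * eT = eT
  eL_mul : eL * eL = eL
  e_mul_Ψ : fromBlocks eT 0 0 eL * Ψ = Ψ
  Ψ_mul_sig : Ψ * sig (fromBlocks eT 0 0 eL) = Ψ
  sig_mul_Ψi : sig (fromBlocks eT 0 0 eL) * Ψi = Ψi
  Ψi_mul_e : Ψi * fromBlocks eT 0 0 eL = Ψi
  Ψ_mul_Ψi : Ψ * Ψi = fromBlocks eT 0 0 eL
  Ψi_mul_Ψ : Ψi * Ψ = sig (fromBlocks eT 0 0 eL)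

namespace WindowMatrix

variable {t l t' l' t'' l'' : Type*} [Fintype t] [Fintype l] [Fintype t'] [Fintype l']
  [Fintype t''] [Fintype l'']

/-- The projection onto `T ⊕ L`. -/
def e (W : WindowMatrix p R t l) : Matrix (t ⊕ l) (t ⊕ l) (WittVector p R) :=
  fromBlocks W.eT 0 0 W.eL

theorem e_isFil (W : WindowMatrix p R t l) : IsFil W.e := fun _ _ => zero_mem _

theorem e_mul_e (W : WindowMatrix p R t l) : W.e * W.e = W.e := by
  simp [e, fromBlocks_multiply, W.eT_mul, W.eL_mul]

/-- The coordinate matrices of homomorphisms `T ⊕ L → T' ⊕ L'` with upper right entry in `I_R`. -/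
structure IsPre (W : WindowMatrix p R t l) (W' : WindowMatrix p R t' l')
    (u : Matrix (t' ⊕ l') (t ⊕ l) (WittVector p R)) : Prop where
  fil : IsFil u
  left : W'.e * u = u
  right : u * W.e = u

/-- The operator `u ↦ Ψ' u^σ Ψ⁻¹` on matrices of homomorphisms. -/
abbrev Φ (W : WindowMatrix p R t l) (W' : WindowMatrix p R t' l') :
    Matrix (t' ⊕ l') (t ⊕ l) (WittVector p R) → Matrix (t' ⊕ l') (t ⊕ l) (WittVector p R) :=
  phi W'.Ψ W.Ψi

variable {W : WindowMatrix p R t l} {W' : WindowMatrix p R t' l'} {W'' : WindowMatrix p R t'' l''}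
  {u v : Matrix (t' ⊕ l') (t ⊕ l) (WittVector p R)}
  {w : Matrix (t'' ⊕ l'') (t' ⊕ l') (WittVector p R)}

theorem IsPre.add (hu : IsPre W W' u) (hv : IsPre W W' v) : IsPre W W' (u + v) :=
  ⟨hu.fil.add hv.fil, by rw [Matrix.mul_add, hu.left, hv.left], by rw [Matrix.add_mul, hu.right,
      hv.right]⟩

theorem IsPre.sub (hu : IsPre W W' u) (hv : IsPre W W' v) : IsPre W W' (u - v) :=
  ⟨hu.fil.sub hv.fil, by rw [Matrix.mul_sub, hu.left, hv.left], by rw [Matrix.sub_mul, hu.right,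
      hv.right]⟩

theorem IsPre.zero : IsPre W W' 0 := ⟨fun _ _ => zero_mem _, Matrix.mul_zero _, Matrix.zero_mul _⟩

theorem IsPre.sum {ι : Type*} {s : Finset ι}
    {f : ι → Matrix (t' ⊕ l') (t ⊕ l) (WittVector p R)} (h : ∀ i ∈ s, IsPre W W' (f i)) :
    IsPre W W' (∑ i ∈ s, f i) :=
  Finset.sum_induction f (IsPre W W') (fun _ _ => IsPre.add) IsPre.zero h

theorem IsPre.smul (a : WittVector p R) (hu : IsPre W W' u) : IsPre W W' (a • u) :=
  ⟨hu.fil.smul a, by rw [Matrix.mul_smul, hu.left], by rw [Matrix.smul_mul, hu.right]⟩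

theorem IsPre.comp (hw : IsPre W' W'' w) (hu : IsPre W W' u) : IsPre W W'' (w * u) :=
  ⟨hw.fil.mul hu.fil, by rw [← Matrix.mul_assoc, hw.left], by rw [Matrix.mul_assoc, hu.right]⟩

theorem e_mul_Φ (W : WindowMatrix p R t l) (W' : WindowMatrix p R t' l') (u) :
    W'.e * Φ W W' u = Φ W W' u := by
  rw [Φ, phi, ← Matrix.mul_assoc, ← Matrix.mul_assoc, e, W'.e_mul_Ψ]

theorem Φ_mul_e (W : WindowMatrix p R t l) (W' : WindowMatrix p R t' l') (u) :
    Φ W W' u * W.e = Φ W W' u := phi_mul_blocks W.Ψi_mul_e u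

theorem toBlocks₁₂_mul_eL (h : u * W.e = u) : u.toBlocks₁₂ * W.eL = u.toBlocks₁₂ := by
  conv_rhs => rw [← h, (toBlocks_mul u W.e).2.1]
  simp [e]

theorem Φ_toBlocks₁₂ (W : WindowMatrix p R t l) (W' : WindowMatrix p R t' l') (u) :
    (Φ W W' u).toBlocks₁₂ * W.eL = (Φ W W' u).toBlocks₁₂ :=
  toBlocks₁₂_mul_eL (Φ_mul_e W W' u)

/-- Writing `w = w e'` inserts `sig e' = Ψ'⁻¹ Ψ'` between the two factors. -/
theorem Φ_comp (hw : IsPre W' W'' w) (hu : IsPre W W' u) :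
    Φ W W'' (w * u) = Φ W' W'' w * Φ W W' u := by
  change W''.Ψ * sig (w * u) * W.Ψi = W''.Ψ * sig w * W'.Ψi * (W'.Ψ * sig u * W.Ψi)
  rw [sig_mul hw.fil hu.fil]
  calc W''.Ψ * (sig w * sig u) * W.Ψi = W''.Ψ * (sig (w * W'.e) * sig u) * W.Ψi := by rw [hw.right]
    _ = W''.Ψ * sig w * (W'.Ψi * W'.Ψ) * (sig u * W.Ψi) := by
      rw [sig_mul hw.fil W'.e_isFil, W'.Ψi_mul_Ψ, e]; simp only [Matrix.mul_assoc]
    _ = _ := by simp only [Matrix.mul_assoc]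

theorem Φ_e (W : WindowMatrix p R t l) : Φ W W W.e = W.e := by
  rw [Φ, phi, e, W.Ψ_mul_sig, W.Ψ_mul_Ψi]

theorem Φ_add (hu : IsFil u) (hv : IsFil v) : Φ W W' (u + v) = Φ W W' u + Φ W W' v :=
  phi_add hu hv

theorem Φ_sub (hu : IsFil u) (hv : IsFil v) : Φ W W' (u - v) = Φ W W' u - Φ W W' v :=
  phi_sub hu hv

theorem Φ_natCast_smul (k : ℕ) (hu : IsFil u) :
    Φ W W' ((k : WittVector p R) • u) = (k : WittVector p R) • Φ W W' u :=
  phi_natCast_smul k hu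

theorem Φ_zero : Φ W W' 0 = 0 := by
  simp

/-- The coordinate matrices of morphisms of displays. -/
structure IsHom (W : WindowMatrix p R t l) (W' : WindowMatrix p R t' l')
    (u : Matrix (t' ⊕ l') (t ⊕ l) (WittVector p R)) : Prop extends IsPre W W' u where
  fixed : Φ W W' u = u

theorem IsHom.sub (hu : IsHom W W' u) (hv : IsHom W W' v) : IsHom W W' (u - v) :=
  ⟨hu.toIsPre.sub hv.toIsPre, by rw [Φ_sub hu.fil hv.fil, hu.fixed, hv.fixed]⟩

theorem IsHom.comp (hw : IsHom W' W'' w) (hu : IsHom W W' u) : IsHom W W'' (w * u) :=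
  ⟨hw.toIsPre.comp hu.toIsPre, by rw [Φ_comp hw.toIsPre hu.toIsPre, hw.fixed, hu.fixed]⟩

/-- The nilpotence condition of order at most `n`. -/
def IsNilpotentOfOrder (W : WindowMatrix p R t l) (n : ℕ) : Prop :=
  ∀ i j, IsResidual (zeta W.eL W.Ψi.toBlocks₂₂ n i j)

theorem IsHom.eq_zero {a : ℕ} (ha : (p : R) ^ a = 0) {n : ℕ} (hz : W.IsNilpotentOfOrder n)
    (hu : IsHom W W' u) {k : ℕ} (hk : (p : WittVector p R) ^ k • u = 0) : u = 0 :=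
  eq_zero_of_phi_fixed ha hz (toBlocks₁₂_mul_eL hu.right) hu.fil hu.fixed (k := k)
    fun i j => by simpa using congrFun₂ hk i j

theorem IsPre.Φ_of_entriesIn (hu : EntriesIn (vIdeal p R 2) u) : IsPre W W' (Φ W W' u) :=
  ⟨IsFil.of_entriesIn le_rfl (phi_entriesIn (X := vIdeal p R) (fun _ => le_rfl)
    (fun _ _ h => vinv_mem_coeffIdeal h) hu), e_mul_Φ _ _ _, Φ_mul_e _ _ _⟩

theorem iterate_Φ_entriesIn (k : ℕ) {n : ℕ} (hu : EntriesIn (vIdeal p R (n + k)) u) :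
    EntriesIn (vIdeal p R n) ((Φ W W')^[k] u) :=
  phi_iterate_entriesIn (X := vIdeal p R) (fun _ => le_rfl)
    (fun _ _ h => vinv_mem_coeffIdeal h) k hu

theorem IsPre.iterate_Φ (hu : IsPre W W' u) (k : ℕ) (h : EntriesIn (vIdeal p R (k + 1)) u) :
    IsPre W W' ((Φ W W')^[k] u) := by
  refine ⟨IsFil.of_entriesIn le_rfl (iterate_Φ_entriesIn k (by rwa [add_comm])), ?_, ?_⟩
  · cases k with
    | zero => exact hu.left
    | succ k => rw [Function.iterate_succ_apply']; exact e_mul_Φ _ _ _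
  · cases k with
    | zero => exact hu.right
    | succ k => rw [Function.iterate_succ_apply']; exact Φ_mul_e _ _ _

/-- The telescoping geometric series. The depth hypothesis keeps the upper right block of each
summand in `I_R`, where `Φ` is additive. -/
theorem sum_iterate_Φ (hu : IsPre W W' u) (k : ℕ) (h : EntriesIn (vIdeal p R (k + 1)) u) :
    Φ W W' (∑ i ∈ Finset.range k, (Φ W W')^[i] u) =
      ∑ i ∈ Finset.range k, (Φ W W')^[i] u - u + (Φ W W')^[k] u := by
  induction k with
  | zero =>
    simp
  | succ k ih =>
    have h' : EntriesIn (vIdeal p R (k + 1)) u := h.mono (coeffIdeal_antitone _ (by omega))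
    rw [Finset.sum_range_succ, Φ_add (IsPre.sum fun i hi => hu.iterate_Φ i (h.mono
      (coeffIdeal_antitone _ (by have := Finset.mem_range.1 hi; omega)))).fil
      (hu.iterate_Φ k h').fil]
    rw [ih h', Function.iterate_succ_apply']
    abel

theorem iterate_Φ_natCast_smul (hu : IsPre W W' u) (m k : ℕ)
    (h : EntriesIn (vIdeal p R (k + 1)) u) :
    (Φ W W')^[k] ((m : WittVector p R) • u) = (m : WittVector p R) • (Φ W W')^[k] u := by
  induction k with
  | zero => rfl
  | succ k ih =>
    have h' : EntriesIn (vIdeal p R (k + 1)) u := h.mono (coeffIdeal_antitone _ (by omega))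
    rw [Function.iterate_succ_apply', Function.iterate_succ_apply', ih h',
      Φ_natCast_smul m (hu.iterate_Φ k h').fil]

/-- Lifting of factorizations from truncations. -/
theorem exists_isHom_mul_eq {a : ℕ} (ha : (p : R) ^ a = 0) {e : ℕ} (hz : W.IsNilpotentOfOrder e)
    {g : Matrix (t'' ⊕ l'') (t ⊕ l) (WittVector p R)} (hg : IsHom W W'' g) (hw : IsHom W' W'' w)
    {G : Matrix (t' ⊕ l') (t'' ⊕ l'') (WittVector p R)} (hG : IsHom W'' W' G) {M : ℕ}
    (hGw : G * w = (p : WittVector p R) ^ M • W'.e) (hwG : w * G = (p : WittVector p R) ^ M • W''.e)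
    {n : ℕ} (hn : 2 * (M * (e + 1)) + 3 ≤ n) (hu : IsPre W W' u)
    (hu₁ : EntriesIn (vIdeal p R n) (u - Φ W W' u))
    (hu₂ : EntriesIn (vIdeal p R n) (w * u - g)) :
    ∃ f, IsHom W W' f ∧ w * f = g := by
  set K := M * (e + 1) with hK
  set q : WittVector p R := (p : WittVector p R) ^ M with hq
  have hqc : q = ((p ^ M : ℕ) : WittVector p R) := by rw [hq, Nat.cast_pow]
  have anti : ∀ {m₁ m₂ : ℕ} {x : Matrix (t' ⊕ l') (t ⊕ l) (WittVector p R)}, m₂ ≤ m₁ →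
      EntriesIn (vIdeal p R m₁) x → EntriesIn (vIdeal p R m₂) x :=
    fun h hx => hx.mono (coeffIdeal_antitone _ h)
  set δ := u - Φ W W' u with hδ
  have hΦu : IsPre W W' (Φ W W' u) := by
    refine ⟨?_, e_mul_Φ _ _ _, Φ_mul_e _ _ _⟩
    have := hu.fil.sub (IsFil.of_entriesIn (by omega) hu₁)
    rwa [hδ, sub_sub_cancel] at this
  have hδp : IsPre W W' δ := hu.sub hΦu
  -- `G g` is an honest morphism that would equal `p^M f`. The error `ε = G (w u - g)` is deep in
  -- the `V`-filtration.
  set ε := q • u - G * g with hε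
  have hεp : IsPre W W' ε := (hu.smul q).sub (hG.toIsPre.comp hg.toIsPre)
  have hεn : EntriesIn (vIdeal p R n) ε := by
    have : ε = G * (w * u - g) := by
      rw [hε, Matrix.mul_sub, ← Matrix.mul_assoc, hGw, Matrix.smul_mul, hu.left]
    rw [this]; exact hu₂.mul_left _
  have hΦε : Φ W W' ε = ε - q • δ := by
    rw [hε, Φ_sub (hu.smul q).fil (hG.comp hg).fil, (hG.comp hg).fixed, hqc,
      Φ_natCast_smul _ hu.fil, hδ, smul_sub]
    abel
  -- Unrolling `ε = Φ(ε) + p^M δ`. All terms of the sum are visibly divisible by `p^M`.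
  have hsum : ∀ k, k ≤ K + 1 → ε = (Φ W W')^[k] ε + q • ∑ i ∈ Finset.range k, (Φ W W')^[i] δ := by
    intro k
    induction k with
    | zero => intro _; simp
    | succ k ih =>
      intro hk
      have hqδ : IsPre W W' (q • δ) := hδp.smul q
      have h1 : (Φ W W')^[k + 1] ε = (Φ W W')^[k] ε - q • (Φ W W')^[k] δ := by
        rw [Function.iterate_succ_apply, hΦε, hqc, ← iterate_Φ_natCast_smul hδp _ k (anti
            (by omega) hu₁),
          ← hqc]
        have : ∀ j, j ≤ k → (Φ W W')^[j] (ε - q • δ) = (Φ W W')^[j] ε - (Φ W W')^[j] (q • δ) := by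
          intro j hj
          induction j with
          | zero => rfl
          | succ j ihj =>
            rw [Function.iterate_succ_apply', Function.iterate_succ_apply',
              Function.iterate_succ_apply', ihj (by omega),
              Φ_sub (hεp.iterate_Φ j (anti (by omega) hεn)).fil
              (hqδ.iterate_Φ j (anti (by omega) (hu₁.smul q))).fil]
        exact this k le_rfl
      rw [Finset.sum_range_succ, smul_add, h1]
      conv_lhs => rw [ih (by omega)]
      abel
  -- The remaining term is divisible by `p^M` by contraction, since `K = M (e + 1)`. This uses up
  -- `K` levels of the filtration.
  obtain ⟨v, hv, hv'⟩ : ∃ v, EntriesIn (vIdeal p R (n - K)) v ∧ (Φ W W')^[K] ε = q • v := by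
    have h1 := phi_iterate_pow (u := ε) (Ψ' := W'.Ψ) (n := n - K) hz (Φ_toBlocks₁₂ W W')
      (toBlocks₁₂_mul_eL hεp.right) M (by rw [Nat.sub_add_cancel (by omega)]; exact hεn)
    have h2 : ∀ i j, ∃ y ∈ vIdeal p R (n - K), q * y = (Φ W W')^[K] ε i j := fun i j =>
      Ideal.mem_span_singleton_mul.1 (h1 i j)
    choose v hv hv' using h2
    exact ⟨fun i j => v i j, hv, by ext1 i j; exact (hv' i j).symm⟩
  -- The quotient `v` was chosen entry by entry, so it is projected to a homomorphism of the
  -- summands. This does not change `p^M v`.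
  set s := W'.e * v * W.e + ∑ i ∈ Finset.range K, (Φ W W')^[i] δ with hs
  have hsn : EntriesIn (vIdeal p R (n - K)) s :=
    ((hv.mul_left _).mul_right _).add (EntriesIn.sum fun i hi => iterate_Φ_entriesIn i
      (anti (by have := Finset.mem_range.1 hi; omega) hu₁))
  have hsp : IsPre W W' s := by
    refine IsPre.add ⟨IsFil.of_entriesIn (n := n - K) (by omega) ((hv.mul_left _).mul_right _), ?_,
        ?_⟩
      (IsPre.sum fun i hi => hδp.iterate_Φ i
        (anti (by have := Finset.mem_range.1 hi; omega) hu₁))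
    · rw [← Matrix.mul_assoc, ← Matrix.mul_assoc, W'.e_mul_e]
    · rw [Matrix.mul_assoc, W.e_mul_e]
  have hqs : q • s = ε := by
    have h1 := hεp.iterate_Φ K (anti (by omega) hεn)
    rw [hs, smul_add, ← Matrix.smul_mul, ← Matrix.mul_smul, ← hv', h1.left, h1.right, ← hsum K
        (by omega)]
  set f₁ := u - s with hf₁
  have hf₁p : IsPre W W' f₁ := hu.sub hsp
  have hqf₁ : q • f₁ = G * g := by rw [hf₁, smul_sub, hqs, hε, sub_sub_cancel]
  have hΦs : IsPre W W' (Φ W W' s) := IsPre.Φ_of_entriesIn (anti (by omega) hsn)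
  -- The new defect is killed by `p^M`, because `p^M f₁ = G g` is fixed by `Φ`.
  set δ₁ := f₁ - Φ W W' f₁ with hδ₁
  have hδ₁' : δ₁ = δ - s + Φ W W' s := by
    rw [hδ₁, hf₁, Φ_sub hu.fil hsp.fil, hδ]; abel
  have hδ₁n : EntriesIn (vIdeal p R (n - K - 1)) δ₁ := by
    rw [hδ₁']
    refine (EntriesIn.sub (anti (by omega) hu₁) (anti (by omega) hsn)).add
      (iterate_Φ_entriesIn 1 (anti (by omega) hsn))
  have hδ₁p : IsPre W W' δ₁ := by rw [hδ₁']; exact (hδp.sub hsp).add hΦs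
  have hqδ₁ : q • δ₁ = 0 := by
    rw [hδ₁, smul_sub, hqf₁, hqc, ← Φ_natCast_smul _ hf₁p.fil, ← hqc, hqf₁,
      (hG.comp hg).fixed, sub_self]
  -- This is the second use of `K` levels. The bound `2 K + 3` also covers one extra application of
  -- `Φ` and membership in `I_R`.
  have hKδ₁ : (Φ W W')^[K] δ₁ = 0 := by
    refine phi_iterate_torsion (Ψ' := W'.Ψ) hz (Φ_toBlocks₁₂ W W') M
      (toBlocks₁₂_mul_eL hδ₁p.right) (fun i j => ?_) (anti (by omega) hδ₁n)
    simpa using congrFun₂ hqδ₁ i j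
  have hδ₁K : EntriesIn (vIdeal p R (K + 1)) δ₁ := anti (by omega) hδ₁n
  have hSp : IsPre W W' (∑ i ∈ Finset.range K, (Φ W W')^[i] δ₁) :=
    IsPre.sum fun i hi => hδ₁p.iterate_Φ i (anti (by have := Finset.mem_range.1 hi; omega) hδ₁K)
  -- The series inverts `1 - Φ` on `δ₁`, so subtracting it cancels the defect. All its terms are
  -- killed by `p^M`.
  set f := f₁ - ∑ i ∈ Finset.range K, (Φ W W')^[i] δ₁ with hf
  have hfH : IsHom W W' f := by
    refine ⟨hf₁p.sub hSp, ?_⟩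
    rw [hf, Φ_sub hf₁p.fil hSp.fil, sum_iterate_Φ hδ₁p K hδ₁K, hKδ₁, hδ₁]
    abel
  have hqf : q • f = G * g := by
    rw [hf, smul_sub, hqf₁, Finset.smul_sum, Finset.sum_eq_zero, sub_zero]
    intro i hi
    rw [hqc, ← iterate_Φ_natCast_smul hδ₁p _ i
      (anti (by have := Finset.mem_range.1 hi; omega) hδ₁K), ← hqc, hqδ₁]
    clear hi
    induction i with
    | zero => rfl
    | succ i ih =>
      rw [Function.iterate_succ_apply', ih, Φ_zero]
  refine ⟨f, hfH, sub_eq_zero.1 ?_⟩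
  -- `p^M (w f - g) = w G g - p^M g = 0`, and rigidity applies.
  refine IsHom.eq_zero ha hz ((hw.comp hfH).sub hg) (k := M) ?_
  rw [smul_sub, ← Matrix.mul_smul, hqf, ← Matrix.mul_assoc, hwG, Matrix.smul_mul, hg.left, sub_self]

end WindowMatrix

end WindowMatrices


/-! ### Ideals of minors and adjugates for maps between images of idempotent matrices. -/

section Minors

open Matrix

variable {A B : Type*} [CommRing A] [CommRing B] {m n m' n' H : Type*}

theorem mul_one_submatrix [Fintype n] [DecidableEq n] (X : Matrix m n A) (J : H → n) :
    X * (1 : Matrix n n A).submatrix id J = X.submatrix id J := by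
  ext i j; simp [Matrix.mul_apply, Matrix.one_apply]

theorem one_submatrix_mul [Fintype m] [DecidableEq m] (X : Matrix m n A) (I : H → m) :
    (1 : Matrix m m A).submatrix I id * X = X.submatrix I id := by
  ext i j; simp [Matrix.mul_apply, Matrix.one_apply]

theorem matrix_map_mul [Fintype n] (f : A →+* B) (u : Matrix m n A) (v : Matrix n n' A) :
    (u * v).map f = u.map f * v.map f := Matrix.map_mul

/-- Equality of matrices can be checked in the local rings. -/
theorem matrix_eq_of_localization {u v : Matrix m n A}
    (h : ∀ (q : Ideal A) [q.IsPrime], u.map (algebraMap A (Localization.AtPrime q)) =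
      v.map (algebraMap A (Localization.AtPrime q))) : u = v := by
  ext i j
  rw [← sub_eq_zero]
  refine eq_zero_of_localization _ fun q hq => ?_
  have := congrFun₂ (h q) i j
  rw [_root_.map_sub, sub_eq_zero]
  exact this

section Span

variable [Fintype H] [DecidableEq H]

/-- A weak form of Cauchy–Binet: the rows of `u v` are combinations of rows of `v`, and the
determinant is multilinear in them. -/
theorem det_mul_mem_span [Fintype m] (u : Matrix H m A) (v : Matrix m H A) (N : Ideal A)
    (h : ∀ I : H → m, (v.submatrix I id).det ∈ N) : (u * v).det ∈ N := by
  classical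
  have h1 : (u * v).det = ∑ r : H → m, (∏ a, u a (r a)) * (v.submatrix r id).det := by
    have h2 : u * v = fun a => ∑ i, u a i • v i := by
      ext a b; simp [Matrix.mul_apply, Finset.sum_apply]
    have h3 := (detRowAlternating (R := A) (n := H)).toMultilinearMap.map_sum
      (fun a i => u a i • v i)
    rw [h2]
    refine h3.trans (Finset.sum_congr rfl fun r _ => ?_)
    exact (detRowAlternating (R := A) (n := H)).toMultilinearMap.map_smul_univ
      (fun a => u a (r a)) fun a => v (r a)
  rw [h1]
  exact sum_mem fun r _ => N.mul_mem_left _ (h r)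

theorem mul_det_mem_span [Fintype n] (u : Matrix H n A) (v : Matrix n H A) (N : Ideal A)
    (h : ∀ J : H → n, (u.submatrix id J).det ∈ N) : (u * v).det ∈ N := by
  rw [← det_transpose, transpose_mul]
  refine det_mul_mem_span _ _ N fun J => ?_
  rw [← det_transpose, transpose_submatrix, transpose_transpose]
  exact h J

/-- The ideal generated by the minors of a matrix. -/
def minorIdeal (H : Type*) [Fintype H] [DecidableEq H] (u : Matrix m n A) : Ideal A :=
  Ideal.span (Set.range fun q : (H → m) × (H → n) => (u.submatrix q.1 q.2).det)

theorem minor_mem (u : Matrix m n A) (I : H → m) (J : H → n) :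
    (u.submatrix I J).det ∈ minorIdeal H u := Ideal.subset_span ⟨(I, J), rfl⟩

theorem minorIdeal_mul_le [Fintype m] [Fintype n] (u : Matrix m' m A) (v : Matrix m n A)
    (w : Matrix n n' A) : minorIdeal H (u * v * w) ≤ minorIdeal H v := by
  rw [minorIdeal, Ideal.span_le]
  rintro _ ⟨⟨I, J⟩, rfl⟩
  change ((u * v * w).submatrix I J).det ∈ minorIdeal H v
  rw [submatrix_mul _ _ I id J Function.bijective_id, submatrix_mul _ _ I id id
      Function.bijective_id]
  refine mul_det_mem_span _ _ _ fun J' => ?_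
  rw [submatrix_mul _ _ _ id _ Function.bijective_id]
  refine det_mul_mem_span _ _ _ fun I' => ?_
  exact minor_mem v I' J'

end Span

/-- The matrix `e` is a product `U V` with `V U = 1`, with inner dimension `d`. -/
def SplitRank [Fintype n] (e : Matrix n n A) (H : Type*) [Fintype H] [DecidableEq H] : Prop :=
  ∃ (U : Matrix n H A) (V : Matrix H n A), U * V = e ∧ V * U = 1

/-- An idempotent matrix whose image has constant rank `d`. -/
def LocRank [Fintype n] (e : Matrix n n A) (d : ℕ) : Prop :=
  ∀ (q : Ideal A) [q.IsPrime], SplitRank (e.map (algebraMap A (Localization.AtPrime q))) (Fin d)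

theorem SplitRank.map [Fintype n] [Fintype H] [DecidableEq H] {e : Matrix n n A}
    (h : SplitRank e H) (f : A →+* B) : SplitRank (e.map f) H := by
  obtain ⟨U, V, h₁, h₂⟩ := h
  refine ⟨U.map f, V.map f, by rw [← matrix_map_mul, h₁], ?_⟩
  rw [← matrix_map_mul, h₂, Matrix.map_one f (_root_.map_zero f) (_root_.map_one f)]

theorem SplitRank.mul_self [Fintype n] [Fintype H] [DecidableEq H] {e : Matrix n n A}
    (h : SplitRank e H) : e * e = e := by
  obtain ⟨U, V, rfl, h₂⟩ := h
  calc _ = U * (V * U) * V := by simp only [Matrix.mul_assoc]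
    _ = _ := by rw [h₂, Matrix.mul_one]

theorem LocRank.map [Fintype n] {e : Matrix n n A} {d : ℕ} (h : LocRank e d) (f : A →+* B) :
    LocRank (e.map f) d := by
  intro q hq
  have h1 := (h (q.comap f)).map (Localization.localRingHom (q.comap f) q f rfl)
  convert h1 using 1
  ext i j
  simp [Localization.localRingHom_to_map]

/-- The matrix `S_J adj(φ_{IJ}) T_I`. -/
def minorAdj [DecidableEq m] [DecidableEq n] [Fintype H] [DecidableEq H] (φ : Matrix m n A)
    (I : H → m) (J : H → n) : Matrix n m A :=
  (1 : Matrix n n A).submatrix id J * adjugate (φ.submatrix I J) *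
    (1 : Matrix m m A).submatrix I id

variable [DecidableEq m] [DecidableEq n] [Fintype H] [DecidableEq H] [Fintype m] [Fintype n]

theorem minorAdj_map (f : A →+* B) (φ : Matrix m n A) (I : H → m) (J : H → n) :
    (minorAdj φ I J).map f = minorAdj (φ.map f) I J := by
  rw [minorAdj, matrix_map_mul, matrix_map_mul, minorAdj]
  have h := f.map_adjugate (φ.submatrix I J)
  simp only [RingHom.mapMatrix_apply] at h
  rw [h]
  congr 1
  · congr 1
    rw [← submatrix_map, Matrix.map_one f (_root_.map_zero f) (_root_.map_one f)]
  · rw [← submatrix_map, Matrix.map_one f (_root_.map_zero f) (_root_.map_one f)]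

/-- With `e = U V` and `e' = U' V'` one has `φ = U' b V` for a square matrix `b`. Then `adj(φ_{IJ})
= adj(V_J) adj(b) adj(U'_I)`, and the outer adjugates collapse to scalars, leaving a multiple of `U
adj(b) V'`. -/
theorem minorAdj_factor {φ : Matrix m n A} {e : Matrix n n A} {e' : Matrix m m A}
    (hl : e' * φ = φ) (hr : φ * e = φ) (he : SplitRank e H) (he' : SplitRank e' H)
    (I : H → m) (J : H → n) :
    e * minorAdj φ I J * e' * φ = (φ.submatrix I J).det • e ∧
      φ * (e * minorAdj φ I J * e') = (φ.submatrix I J).det • e' := by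
  obtain ⟨U, V, rfl, hU⟩ := he
  obtain ⟨U', V', rfl, hU'⟩ := he'
  set b := V' * φ * U with hb
  have hφ : φ = U' * b * V := by
    conv_lhs => rw [← hl, ← hr]
    simp only [hb, Matrix.mul_assoc]
  have hminor : φ.submatrix I J = U'.submatrix I id * b * V.submatrix id J := by
    rw [hφ, submatrix_mul _ _ I id J Function.bijective_id,
      submatrix_mul _ _ I id id Function.bijective_id, submatrix_id_id]
  have hK : U * V * minorAdj φ I J * (U' * V') =
      ((V.submatrix id J).det * (U'.submatrix I id).det) • (U * adjugate b * V') := by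
    rw [minorAdj, hminor, adjugate_mul_distrib, adjugate_mul_distrib]
    calc _ = U * ((V * (1 : Matrix n n A).submatrix id J) * adjugate (V.submatrix id J)) *
          adjugate b * (adjugate (U'.submatrix I id) *
            ((1 : Matrix m m A).submatrix I id * U')) * V' := by simp only [Matrix.mul_assoc]
      _ = _ := by
        rw [mul_one_submatrix, one_submatrix_mul, mul_adjugate, adjugate_mul]
        simp only [Matrix.mul_smul, Matrix.smul_mul, Matrix.mul_one, smul_smul,
          Matrix.mul_assoc]
        rw [mul_comm (U'.submatrix I id).det]
  have hdet : (φ.submatrix I J).det =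
      (V.submatrix id J).det * (U'.submatrix I id).det * b.det := by
    rw [hminor, det_mul, det_mul]; ring
  rw [hK, hdet]
  constructor
  · rw [hφ, Matrix.smul_mul]
    have : U * adjugate b * V' * (U' * b * V) = b.det • (U * V) := by
      calc _ = U * (adjugate b * ((V' * U') * b)) * V := by simp only [Matrix.mul_assoc]
        _ = _ := by rw [hU', Matrix.one_mul, adjugate_mul]; simp
    rw [this, smul_smul]
  · rw [hφ, Matrix.mul_smul]
    have : U' * b * V * (U * adjugate b * V') = b.det • (U' * V') := by
      calc _ = U' * (b * ((V * U) * adjugate b)) * V' := by simp only [Matrix.mul_assoc]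
        _ = _ := by rw [hU, Matrix.one_mul, mul_adjugate]; simp
    rw [this, smul_smul]

end Minors

/-! ### Quasi-inverses from minors, and minors under conjugation by `diag(1, x)`. -/

section BlockMinors

open Matrix

variable {A B : Type*} [CommRing A] [CommRing B] {t l t' l' : Type*}
  [Fintype t] [Fintype l] [Fintype t'] [Fintype l']

theorem SplitRank.fromBlocks {H K : Type*} [Fintype H] [Fintype K] [DecidableEq H] [DecidableEq K]
    {eT : Matrix t t A} {eL : Matrix l l A} (hT : SplitRank eT H) (hL : SplitRank eL K) :
    SplitRank (fromBlocks eT 0 0 eL) (H ⊕ K) := by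
  obtain ⟨U, V, rfl, h⟩ := hT
  obtain ⟨U', V', rfl, h'⟩ := hL
  refine ⟨Matrix.fromBlocks U 0 0 U', Matrix.fromBlocks V 0 0 V', ?_, ?_⟩
  · simp [fromBlocks_multiply]
  · simp [fromBlocks_multiply, h, h']

theorem fromBlocks_map_diag (f : A →+* B) (eT : Matrix t t A) (eL : Matrix l l A) :
    (fromBlocks eT 0 0 eL).map f = fromBlocks (eT.map f) 0 0 (eL.map f) := by
  rw [fromBlocks_map, Matrix.map_zero f (_root_.map_zero f), Matrix.map_zero f (_root_.map_zero f)]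

variable [DecidableEq t] [DecidableEq l] [DecidableEq t'] [DecidableEq l']

/-- An element of the ideal of minors gives a quasi-inverse. -/
theorem exists_quasiInverse {d c : ℕ} {eT : Matrix t t A} {eL : Matrix l l A}
    {eT' : Matrix t' t' A} {eL' : Matrix l' l' A} (hT : LocRank eT d) (hL : LocRank eL c)
    (hT' : LocRank eT' d) (hL' : LocRank eL' c) {φ : Matrix (t' ⊕ l') (t ⊕ l) A}
    (hl : fromBlocks eT' 0 0 eL' * φ = φ) (hr : φ * fromBlocks eT 0 0 eL = φ)
    {x : A} (hx : x ∈ minorIdeal (Fin d ⊕ Fin c) φ) :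
    ∃ G : Matrix (t ⊕ l) (t' ⊕ l') A, fromBlocks eT 0 0 eL * G * fromBlocks eT' 0 0 eL' = G ∧
      G * φ = x • fromBlocks eT 0 0 eL ∧ φ * G = x • fromBlocks eT' 0 0 eL' := by
  set e := fromBlocks eT 0 0 eL with he
  set e' := fromBlocks eT' 0 0 eL' with he'
  have hloc : ∀ (q : Ideal A) [q.IsPrime], SplitRank (e.map (algebraMap A (Localization.AtPrime q)))
      (Fin d ⊕ Fin c) := fun q _ => by
    rw [he, fromBlocks_map_diag]; exact (hT q).fromBlocks (hL q)
  have hloc' : ∀ (q : Ideal A) [q.IsPrime],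
      SplitRank (e'.map (algebraMap A (Localization.AtPrime q))) (Fin d ⊕ Fin c) := fun q _ => by
    rw [he', fromBlocks_map_diag]; exact (hT' q).fromBlocks (hL' q)
  have hee : e * e = e := matrix_eq_of_localization fun q _ => by
    rw [matrix_map_mul, (hloc q).mul_self]
  have hee' : e' * e' = e' := matrix_eq_of_localization fun q _ => by
    rw [matrix_map_mul, (hloc' q).mul_self]
  rw [minorIdeal] at hx
  induction hx using Submodule.span_induction with
  | mem x hx =>
    obtain ⟨⟨I, J⟩, rfl⟩ := hx
    -- This candidate is defined globally. The identities are checked in the local rings, where both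
    -- idempotents split.
    refine ⟨e * minorAdj φ I J * e', ?_, ?_, ?_⟩
    · calc _ = (e * e) * minorAdj φ I J * (e' * e') := by simp only [Matrix.mul_assoc]
        _ = _ := by rw [hee, hee']
    all_goals
      refine matrix_eq_of_localization fun q _ => ?_
      have h1 := minorAdj_factor (φ := φ.map (algebraMap A (Localization.AtPrime q)))
        (by rw [← matrix_map_mul, hl]) (by rw [← matrix_map_mul, hr]) (hloc q) (hloc' q) I J
      have h2 : ∀ y : Matrix (t ⊕ l) (t ⊕ l) A, ((φ.submatrix I J).det • y).map
          (algebraMap A (Localization.AtPrime q)) = ((φ.map (algebraMap A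
          (Localization.AtPrime q))).submatrix I J).det • y.map (algebraMap A
          (Localization.AtPrime q)) := fun y => by
        ext i j
        rw [Matrix.map_apply, Matrix.smul_apply, Matrix.smul_apply, smul_eq_mul, _root_.map_mul,
          RingHom.map_det]
        rfl
      have h3 : ∀ y : Matrix (t' ⊕ l') (t' ⊕ l') A, ((φ.submatrix I J).det • y).map
          (algebraMap A (Localization.AtPrime q)) = ((φ.map (algebraMap A
          (Localization.AtPrime q))).submatrix I J).det • y.map (algebraMap A
          (Localization.AtPrime q)) := fun y => by
        ext i j
        rw [Matrix.map_apply, Matrix.smul_apply, Matrix.smul_apply, smul_eq_mul, _root_.map_mul,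
          RingHom.map_det]
        rfl
      simp only [h2, h3, matrix_map_mul, minorAdj_map]
      first | exact h1.1 | exact h1.2
  | zero => exact ⟨0, by simp, by simp, by simp⟩
  | add x y _ _ hx hy =>
    obtain ⟨G, h1, h2, h3⟩ := hx
    obtain ⟨G', h1', h2', h3'⟩ := hy
    exact ⟨G + G', by rw [Matrix.mul_add, Matrix.add_mul, h1, h1'],
      by rw [Matrix.add_mul, h2, h2', add_smul], by rw [Matrix.mul_add, h3, h3', add_smul]⟩
  | smul a x _ hx =>
    obtain ⟨G, h1, h2, h3⟩ := hx
    exact ⟨a • G, by rw [Matrix.mul_smul, Matrix.smul_mul, h1],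
      by rw [Matrix.smul_mul, h2, smul_smul, smul_eq_mul],
      by rw [Matrix.mul_smul, h3, smul_smul, smul_eq_mul]⟩

/-- The matrix `diag(1, x)`. -/
def diagBlocks (t l : Type*) [DecidableEq t] [DecidableEq l] (x : A) : Matrix (t ⊕ l) (t ⊕ l) A :=
  fromBlocks 1 0 0 (x • 1)

theorem diagBlocks_map (f : A →+* B) (x : A) :
    (diagBlocks t l x).map f = diagBlocks t l (f x) := by
  rw [diagBlocks, fromBlocks_map_diag, Matrix.map_one f (_root_.map_zero f) (_root_.map_one f),
    diagBlocks]
  congr 1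
  ext i j
  simp only [Matrix.map_apply, Matrix.smul_apply, smul_eq_mul, _root_.map_mul, Matrix.one_apply]
  split <;> simp

theorem det_diagBlocks (x : A) : (diagBlocks t l x).det = x ^ Fintype.card l := by
  rw [diagBlocks, det_fromBlocks_zero₂₁, det_one, one_mul, det_smul, det_one, mul_one]

theorem fromBlocks_mul_diagBlocks (U : Matrix t t' A) (W : Matrix l l' A) (x : A) :
    fromBlocks U 0 0 W * diagBlocks t' l' x = diagBlocks t l x * fromBlocks U 0 0 W := by
  simp [diagBlocks, fromBlocks_multiply]

/-- The comparison of minors of matrices that are conjugate by `diag(1, p)`. -/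
theorem minor_comparison {d c : ℕ} {eT : Matrix t t A} {eL : Matrix l l A}
    {eT' : Matrix t' t' A} {eL' : Matrix l' l' A} (hT : LocRank eT d) (hL : LocRank eL c)
    (hT' : LocRank eT' d) (hL' : LocRank eL' c) {φ ψ : Matrix (t' ⊕ l') (t ⊕ l) A}
    (hφl : fromBlocks eT' 0 0 eL' * φ = φ) (hφr : φ * fromBlocks eT 0 0 eL = φ)
    (hψl : fromBlocks eT' 0 0 eL' * ψ = ψ) (hψr : ψ * fromBlocks eT 0 0 eL = ψ) {x : A}
    (hD : φ * diagBlocks t l x = diagBlocks t' l' x * ψ)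
    (I : Fin d ⊕ Fin c → t' ⊕ l') (J : Fin d ⊕ Fin c → t ⊕ l) :
    x ^ c * (φ.submatrix I J).det = x ^ c * (ψ.submatrix I J).det := by
  rw [← sub_eq_zero]
  refine eq_zero_of_localization _ fun q _ => ?_
  have : q.IsPrime := Ideal.IsMaximal.isPrime ‹_›
  rw [_root_.map_sub, sub_eq_zero]
  simp only [_root_.map_mul, _root_.map_pow, RingHom.map_det]
  set f := algebraMap A (Localization.AtPrime q)
  obtain ⟨U, V, h1, h2⟩ := hT q
  obtain ⟨W, Z, h3, h4⟩ := hL q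
  obtain ⟨U', V', h1', h2'⟩ := hT' q
  obtain ⟨W', Z', h3', h4'⟩ := hL' q
  -- A minor is the determinant of the square matrix in local bases times factors that depend only
  -- on `I` and `J`. It remains to compare two square determinants.
  have key : ∀ {φ : Matrix (t' ⊕ l') (t ⊕ l) A}, fromBlocks eT' 0 0 eL' * φ = φ →
      φ * fromBlocks eT 0 0 eL = φ → f.mapMatrix (φ.submatrix I J) =
      (fromBlocks U' 0 0 W').submatrix I id *
        (fromBlocks V' 0 0 Z' * φ.map f * fromBlocks U 0 0 W) *
        (fromBlocks V 0 0 Z).submatrix id J := by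
    intro φ hl hr
    have h5 : φ.map f = fromBlocks U' 0 0 W' *
        (fromBlocks V' 0 0 Z' * φ.map f * fromBlocks U 0 0 W) * fromBlocks V 0 0 Z := by
      conv_lhs => rw [← hl, ← hr]
      rw [matrix_map_mul, matrix_map_mul, fromBlocks_map_diag, fromBlocks_map_diag, ← h1, ← h3,
        ← h1', ← h3']
      have e1 : fromBlocks (U * V) 0 0 (W * Z) = fromBlocks U 0 0 W * fromBlocks V 0 0 Z := by
        simp [fromBlocks_multiply]
      have e2 : fromBlocks (U' * V') 0 0 (W' * Z') =
          fromBlocks U' 0 0 W' * fromBlocks V' 0 0 Z' := by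
        simp [fromBlocks_multiply]
      rw [e1, e2]
      simp only [Matrix.mul_assoc]
    rw [RingHom.mapMatrix_apply, ← submatrix_map]
    conv_lhs => rw [h5]
    rw [submatrix_mul _ _ I id J Function.bijective_id,
      submatrix_mul _ _ I id id Function.bijective_id, submatrix_id_id]
  rw [key hφl hφr, key hψl hψr]
  simp only [det_mul]
  have hD' : φ.map f * diagBlocks t l (f x) = diagBlocks t' l' (f x) * ψ.map f := by
    have h6 := congrArg (fun u => u.map f) hD
    simpa only [matrix_map_mul, diagBlocks_map] using h6
  -- The local bases respect the block decomposition, so they commute with `diag(1, x)`. Taking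
  -- determinants then yields the factor `x^c`.
  have hb : (fromBlocks V' 0 0 Z' * φ.map f * fromBlocks U 0 0 W) *
      diagBlocks (Fin d) (Fin c) (f x) = diagBlocks (Fin d) (Fin c) (f x) *
      (fromBlocks V' 0 0 Z' * ψ.map f * fromBlocks U 0 0 W) := by
    rw [Matrix.mul_assoc _ (fromBlocks U 0 0 W), fromBlocks_mul_diagBlocks, ← Matrix.mul_assoc,
      Matrix.mul_assoc (fromBlocks V' 0 0 Z') (φ.map f), hD', ← Matrix.mul_assoc,
      fromBlocks_mul_diagBlocks]
    simp only [Matrix.mul_assoc]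
  have hb' := congrArg det hb
  rw [det_mul, det_mul _ (fromBlocks V' 0 0 Z' * ψ.map f * fromBlocks U 0 0 W),
    det_diagBlocks, Fintype.card_fin] at hb'
  linear_combination (det ((fromBlocks U' 0 0 W').submatrix I id) *
    det ((fromBlocks V 0 0 Z).submatrix id J)) * hb'

end BlockMinors


/-! ### Ideals spanned by vectors of Witt vectors with `X = U F(X)`. -/

section FrobeniusModules

open WittVector Matrix

variable {p : ℕ} [hp : Fact p.Prime] {R : Type*} [CommRing R]

theorem iterate_verschiebung_sum {ι : Type*} (s : Finset ι) (n : ℕ) (f : ι → WittVector p R) :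
    verschiebung^[n] (∑ i ∈ s, f i) = ∑ i ∈ s, verschiebung^[n] (f i) := by
  classical
  induction s using Finset.induction_on with
  | empty => exact iterate_map_zero _ n
  | insert a s ha ih => rw [Finset.sum_insert ha, Finset.sum_insert ha, iterate_map_add, ih]

theorem iterate_verschiebung_injective (n : ℕ) :
    Function.Injective (verschiebung^[n] : WittVector p R → WittVector p R) :=
  (verschiebung_injective p R).iterate n

variable (p R) in
/-- The iterated Frobenius. -/
abbrev frobPow (k : ℕ) : WittVector p R →+* WittVector p R :=
  (WittVector.frobenius : WittVector p R →+* WittVector p R) ^ k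

theorem frobPow_succ (k : ℕ) (x : WittVector p R) :
    frobPow p R (k + 1) x = frobPow p R k (WittVector.frobenius x) := by
  rw [frobPow, pow_succ]; rfl

theorem frobPow_succ' (k : ℕ) (x : WittVector p R) :
    frobPow p R (k + 1) x = WittVector.frobenius (frobPow p R k x) := by
  rw [frobPow, pow_succ']; rfl

/-- Iterates the relation `k` times. The map `τ` is the identity or a power of Frobenius; in the
second case the new coefficients stay in the image of `τ`. -/
theorem exists_mulVec_frobenius_pow {ι : Type*} [Fintype ι] [DecidableEq ι]
    {τ : WittVector p R →+* WittVector p R}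
    {X : ι → WittVector p R} {U : Matrix ι ι (WittVector p R)}
    (hτ : ∀ (k : ℕ) x, (frobPow p R k) (τ x) =
      τ ((frobPow p R k) x))
    (hX : ∀ i, X i = ∑ j, τ (U i j) * WittVector.frobenius (X j)) (k : ℕ) :
    ∃ W : Matrix ι ι (WittVector p R), ∀ i,
      X i = ∑ j, τ (W i j) * (frobPow p R k) (X j) := by
  induction k with
  | zero =>
    refine ⟨1, fun i => ?_⟩
    simp [Matrix.one_apply]
  | succ k ih =>
    obtain ⟨W, hW⟩ := ih
    refine ⟨W * U.map (frobPow p R k), fun i => ?_⟩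
    have h1 : ∀ j, (frobPow p R k) (X j) = ∑ l,
        τ ((frobPow p R k) (U j l)) *
          (frobPow p R (k + 1)) (X l) := fun j => by
      conv_lhs => rw [hX j, map_sum]
      refine Finset.sum_congr rfl fun l _ => ?_
      rw [map_mul, hτ, frobPow_succ]
    rw [hW i]
    simp_rw [h1, Matrix.mul_apply, map_sum, map_mul, Finset.mul_sum, Finset.sum_mul]
    rw [Finset.sum_comm]
    refine Finset.sum_congr rfl fun j _ => Finset.sum_congr rfl fun l _ => ?_
    rw [Matrix.map_apply, mul_assoc]

theorem exists_sum_eq_one {ι : Type*} [Fintype ι] {x : ι → R}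
    (h : Ideal.span (Set.range x) = ⊤) : ∃ r : ι → R, ∑ i, r i * x i = 1 := by
  have h1 : (1 : R) ∈ Ideal.span (Set.range x) := by rw [h]; trivial
  exact Ideal.mem_span_range_iff_exists_fun.1 h1

theorem span_pow_range_eq_top {ι : Type*} {x : ι → R} (h : Ideal.span (Set.range x) = ⊤) (n : ℕ) :
    Ideal.span (Set.range fun i => x i ^ n) = ⊤ := by
  have := Ideal.span_pow_eq_top _ h n
  rwa [← Set.range_comp] at this

theorem span_range_eq_top_of_pow {ι : Type*} {x y : ι → R} {n : ℕ} (hn : n ≠ 0)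
    (hxy : ∀ i, y i = x i ^ n)
    (h : Ideal.span (Set.range y) = ⊤) : Ideal.span (Set.range x) = ⊤ := by
  rw [← top_le_iff, ← h, Ideal.span_le]
  rintro _ ⟨i, rfl⟩
  rw [hxy]
  exact Ideal.pow_mem_of_mem _ (Ideal.subset_span (Set.mem_range_self i)) n (Nat.pos_of_ne_zero hn)

/-- Witt vectors whose zeroth coefficients generate the unit ideal generate the unit ideal if
Witt vectors with invertible zeroth coefficient are invertible. -/
theorem span_range_eq_top_of_coeff_zero {ι : Type*} [Fintype ι]
    (hu : ∀ x : WittVector p R, IsUnit (x.coeff 0) → IsUnit x) {v : ι → WittVector p R}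
    (h : Ideal.span (Set.range fun i => (v i).coeff 0) = ⊤) : Ideal.span (Set.range v) = ⊤ := by
  obtain ⟨r, hr⟩ := exists_sum_eq_one h
  have h1 : (∑ i, teichmuller p (r i) * v i).coeff 0 = 1 := by
    have : constantCoeff (∑ i, teichmuller p (r i) * v i) = 1 := by
      rw [map_sum, ← hr]
      refine Finset.sum_congr rfl fun i _ => ?_
      rw [map_mul]
      simp [constantCoeff_apply, teichmuller_coeff_zero]
    exact this
  refine Ideal.eq_top_of_isUnit_mem _ (x := ∑ i, teichmuller p (r i) * v i)
    (sum_mem fun i _ => Ideal.mul_mem_left _ _ (Ideal.subset_span ⟨i, rfl⟩))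
    (hu _ (by rw [h1]; exact isUnit_one))

/-- Frobenius-invariant ideals with nilpotent coefficients below `n` and unimodular `n`-th
coefficients contain `p ^ n`. -/
theorem p_pow_mem_span_of_frobenius [CharP R p] {ι : Type*} [Fintype ι]
    {X : ι → WittVector p R} {U : Matrix ι ι (WittVector p R)}
    (hX : ∀ i, X i = ∑ j, U i j * WittVector.frobenius (X j)) {n : ℕ}
    (h₁ : ∀ i, ∀ k < n, IsNilpotent ((X i).coeff k))
    (h₂ : Ideal.span (Set.range fun i => (X i).coeff n) = ⊤) :
    (p : WittVector p R) ^ n ∈ Ideal.span (Set.range X) := by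
  classical
  have hfc : ∀ (k : ℕ) (x : WittVector p R) (j : ℕ),
      ((frobPow p R k) x).coeff j = x.coeff j ^ p ^ k := by
    intro k
    induction k with
    | zero => intro x j; simp
    | succ k ih =>
      intro x j
      rw [frobPow_succ', coeff_frobenius_charP, ih, ← pow_mul,
        pow_succ]
  -- A power of Frobenius that kills all the finitely many nilpotent coefficients below `n`.
  -- Expressing `X` through `F^N(X)` then puts `X` in `V^n W(R)`.
  obtain ⟨N, hN⟩ : ∃ N : ℕ, ∀ i, ∀ k < n, (X i).coeff k ^ p ^ N = 0 := by
    have : ∀ q : ι × Fin n, ∃ N : ℕ, (X q.1).coeff q.2 ^ N = 0 := fun q => h₁ q.1 q.2 q.2.2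
    choose N hN using this
    refine ⟨∑ q, N q, fun i k hk => ?_⟩
    refine pow_eq_zero_of_le ?_ (hN (i, ⟨k, hk⟩))
    exact (Finset.single_le_sum (f := N) (fun _ _ => Nat.zero_le _) (Finset.mem_univ _)).trans
      (Nat.lt_pow_self hp.out.one_lt).le
  have hXV : ∀ i, X i ∈ vIdeal p R n := by
    obtain ⟨W, hW⟩ := exists_mulVec_frobenius_pow (τ := RingHom.id _) (fun _ _ => rfl) hX N
    intro i
    rw [hW i]
    refine sum_mem fun j _ => Ideal.mul_mem_left _ _ (mem_vIdeal.2 fun k hk => ?_)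
    rw [hfc, hN j k hk]
  set y : ι → WittVector p R := fun i => (X i).shift n with hy
  have hXy : ∀ i, X i = verschiebung^[n] (y i) := fun i =>
    eq_iterate_verschiebung fun k hk => mem_vIdeal.1 (hXV i) k hk
  -- Moving `V^n` across the relation twists `U` by `F^n`. After `n` iterations all of `y` is in the
  -- image of `F^n`, and `V^n F^n = p^n` makes `X` divisible by `p^n`.
  have hyU : ∀ i, y i = ∑ j,
      (frobPow p R n) (U i j) * WittVector.frobenius (y j) := by
    intro i
    apply iterate_verschiebung_injective n
    rw [← hXy, iterate_verschiebung_sum]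
    conv_lhs => rw [hX i]
    refine Finset.sum_congr rfl fun j _ => ?_
    rw [hXy j, ← (verschiebung_frobenius_comm.iterate_left n).eq, mul_comm,
      iterate_verschiebung_mul_left, mul_comm]
    simp only [RingHom.coe_pow]
  obtain ⟨W, hW⟩ := exists_mulVec_frobenius_pow (τ := frobPow p R n) (fun k x => by
    rw [← RingHom.comp_apply, ← RingHom.mul_def, ← pow_add, add_comm, pow_add]; rfl) hyU n
  set v : ι → WittVector p R := fun i => ∑ j, W i j * y j with hv
  have hyv : ∀ i, y i = (frobPow p R n) (v i) := fun i => by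
    conv_lhs => rw [hW i]
    simp only [hv, map_sum, map_mul]
  have hXv : ∀ i, X i = v i * p ^ n := fun i => by
    rw [hXy, hyv, RingHom.coe_pow, iterate_verschiebung_iterate_frobenius]
  -- The `n`-th coefficient of `p^n v` is the `p^n`-th power of the zeroth coefficient of `v`, so
  -- unimodularity passes to `v`.
  have hvtop : Ideal.span (Set.range v) = ⊤ := by
    refine span_range_eq_top_of_coeff_zero (fun x => isUnit_of_charP) ?_
    refine span_range_eq_top_of_pow (n := p ^ n) (pow_ne_zero _ hp.out.ne_zero) (fun i => ?_) h₂
    have := mul_pow_charP_coeff_succ (v i) (m := 0) (n := n)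
    rw [zero_add] at this
    change (X i).coeff n = _
    rw [hXv i, this]
  obtain ⟨r, hr⟩ := exists_sum_eq_one hvtop
  have : (p : WittVector p R) ^ n = ∑ i, r i * X i := by
    simp_rw [hXv, ← mul_assoc, ← Finset.sum_mul, hr, one_mul]
  rw [this]
  exact sum_mem fun i _ => Ideal.mul_mem_left _ _ (Ideal.subset_span ⟨i, rfl⟩)

/-- Over `R/p` the previous statement applies to `X = p^c x`, with `n` shifted to `n + c`. The error
in lifting back lies in `W(pR)`, whose `a`-th powers vanish, hence the exponent `a (n + c)`. -/
theorem p_pow_mem_span_of_frobenius' {a : ℕ} (ha : (p : R) ^ a = 0) {ι : Type*} [Fintype ι]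
    {x : ι → WittVector p R} {U : Matrix ι ι (WittVector p R)} {c : ℕ}
    (hX : ∀ i, (p : WittVector p R) ^ c * x i = ∑ j, U i j * (p ^ c * WittVector.frobenius (x j)))
        {n : ℕ}
    (h₁ : ∀ i, ∀ k < n, IsNilpotent ((x i).coeff k))
    (h₂ : Ideal.span (Set.range fun i => (x i).coeff n) = ⊤) :
    (p : WittVector p R) ^ (a * (n + c)) ∈ Ideal.span (Set.range x) := by
  cases subsingleton_or_nontrivial R with
  | inl h =>
    have : Subsingleton (WittVector p R) :=
      ⟨fun x y => WittVector.ext fun i => Subsingleton.elim _ _⟩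
    rw [Subsingleton.elim ((p : WittVector p R) ^ (a * (n + c))) 0]
    exact zero_mem _
  | inr h =>
    have := charP_quotient ha
    set π := Ideal.Quotient.mk (Ideal.span {(p : R)})
    set ρ := WittVector.map (p := p) π with hρ
    have h3 := p_pow_mem_span_of_frobenius (n := n + c) (X := fun i => ρ (x i) *
        (p : WittVector p _) ^ c)
      (U := U.map ρ) (fun i => by
        have := congrArg ρ (hX i)
        simp only [map_mul, map_sum, map_pow, map_natCast] at this ⊢
        rw [mul_comm, this]
        refine Finset.sum_congr rfl fun j _ => ?_
        rw [hρ, map_frobenius, Matrix.map_apply, mul_comm (WittVector.frobenius _)])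
      (fun i k hk => by
        by_cases hkc : k < c
        · rw [mul_pow_charP_coeff_zero _ hkc]; exact IsNilpotent.zero
        · obtain ⟨j, rfl⟩ := Nat.exists_eq_add_of_le' (not_lt.1 hkc)
          rw [mul_pow_charP_coeff_succ, hρ, map_coeff]
          exact ((h₁ i j (by omega)).map π).pow_of_pos (pow_ne_zero _ hp.out.ne_zero))
      (by
        have h4 := span_pow_range_eq_top (x := fun i => π ((x i).coeff n)) (by
          have h5 := congrArg (Ideal.map π) h₂
          rwa [Ideal.map_span, Ideal.map_top, ← Set.range_comp] at h5) (p ^ c)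
        refine Eq.trans ?_ h4
        congr 2
        ext i
        rw [mul_pow_charP_coeff_succ, hρ, map_coeff])
    obtain ⟨r, hr⟩ := Ideal.mem_span_range_iff_exists_fun.1 h3
    have hsurj : Function.Surjective ρ := map_surjective _ Ideal.Quotient.mk_surjective
    choose r' hr' using fun i => hsurj (r i)
    set s := ∑ i, r' i * (x i * (p : WittVector p R) ^ c) with hs
    have h6 : (p : WittVector p R) ^ (n + c) - s ∈ wittIdeal p (Ideal.span {(p : R)}) := by
      rw [wittIdeal, RingHom.mem_ker, _root_.map_sub, sub_eq_zero, hs, _root_.map_sum,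
        _root_.map_pow, map_natCast, ← hr]
      refine Finset.sum_congr rfl fun i _ => ?_
      rw [← hr' i, _root_.map_mul, _root_.map_mul, _root_.map_pow, map_natCast]
    have h7 : ((p : WittVector p R) ^ (n + c) - s) ^ a = 0 :=
      pow_eq_zero_of_mem_wittIdeal (by rw [Ideal.span_singleton_pow, ha]; simp) h6
    have hsm : s ∈ Ideal.span (Set.range x) := sum_mem fun i _ =>
      Ideal.mul_mem_left _ _ (Ideal.mul_mem_right _ _ (Ideal.subset_span ⟨i, rfl⟩))
    rw [← Ideal.Quotient.eq_zero_iff_mem] at hsm ⊢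
    have h8 := congrArg (Ideal.Quotient.mk (Ideal.span (Set.range x))) h7
    rw [_root_.map_pow, _root_.map_sub, hsm, sub_zero, _root_.map_zero, ← _root_.map_pow,
      ← pow_mul] at h8
    rwa [mul_comm a]

end FrobeniusModules

/-! ### Quasi-inverses and inverses of isogenies in coordinates. -/

section QuasiInverse

open WittVector Matrix

variable {p : ℕ} [hp : Fact p.Prime] {R : Type*} [CommRing R]
  {t l t' l' : Type*} [Fintype t] [Fintype l] [Fintype t'] [Fintype l']

namespace WindowMatrix

variable {W : WindowMatrix p R t l} {W' : WindowMatrix p R t' l'}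

/-- The dimension is `d` and the codimension is `c`. -/
structure HasRanks (W : WindowMatrix p R t l) (d c : ℕ) : Prop where
  rankT : LocRank W.eT d
  rankL : LocRank W.eL c

@[simp] theorem e_toBlocks₁₁ (W : WindowMatrix p R t l) : W.e.toBlocks₁₁ = W.eT := rfl
@[simp] theorem e_toBlocks₁₂ (W : WindowMatrix p R t l) : W.e.toBlocks₁₂ = 0 := rfl
@[simp] theorem e_toBlocks₂₁ (W : WindowMatrix p R t l) : W.e.toBlocks₂₁ = 0 := rfl
@[simp] theorem e_toBlocks₂₂ (W : WindowMatrix p R t l) : W.e.toBlocks₂₂ = W.eL := rfl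

theorem sig_e (W : WindowMatrix p R t l) : sig W.e = W.e.map WittVector.frobenius := by
  rw [e, fromBlocks_map_diag, sig]
  simp only [toBlocks_fromBlocks₁₁, toBlocks_fromBlocks₁₂, toBlocks_fromBlocks₂₁,
    toBlocks_fromBlocks₂₂]
  refine fromBlocks_congr rfl ?_ ?_ rfl
  · ext1 i j; exact vinv_zero
  · rw [Matrix.map_zero WittVector.frobenius (map_zero WittVector.frobenius), smul_zero]

variable [DecidableEq t] [DecidableEq l] [DecidableEq t'] [DecidableEq l']
variable {u : Matrix (t' ⊕ l') (t ⊕ l) (WittVector p R)}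

theorem sig_mul_diagBlocks (hu : IsFil u) : sig u * diagBlocks t l (p : WittVector p R) =
    diagBlocks t' l' (p : WittVector p R) * u.map WittVector.frobenius := by
  have h1 : u.map WittVector.frobenius = fromBlocks (u.toBlocks₁₁.map WittVector.frobenius)
      (u.toBlocks₁₂.map WittVector.frobenius)
      (u.toBlocks₂₁.map WittVector.frobenius) (u.toBlocks₂₂.map WittVector.frobenius) := by
    conv_lhs => rw [← fromBlocks_toBlocks u]
    rw [fromBlocks_map]
  rw [h1, vinvLinear_vIdeal.map_frob hu, sig, diagBlocks, diagBlocks]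
  simp [fromBlocks_multiply]

/-- The ideal of minors of the matrix of a morphism contains a power of `p`, if the minors have
nilpotent coefficients below `n` and unimodular `n`-th coefficients. -/
theorem IsHom.p_pow_mem_minorIdeal {a : ℕ} (ha : (p : R) ^ a = 0) {d c : ℕ} (hW : W.HasRanks d c)
    (hW' : W'.HasRanks d c) (hu : IsHom W W' u) {n : ℕ}
    (h₁ : ∀ (I : Fin d ⊕ Fin c → t' ⊕ l') (J : Fin d ⊕ Fin c → t ⊕ l), ∀ k < n,
      _root_.IsNilpotent ((u.submatrix I J).det.coeff k))
    (h₂ : Ideal.span (Set.range fun q : (Fin d ⊕ Fin c → t' ⊕ l') × (Fin d ⊕ Fin c → t ⊕ l) =>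
      (u.submatrix q.1 q.2).det.coeff n) = ⊤) :
    (p : WittVector p R) ^ (a * (n + c)) ∈ minorIdeal (Fin d ⊕ Fin c) u := by
  -- The minors of `u^σ` and of `F(u)` agree after multiplication by `p^c`, since the two matrices
  -- are related by `diag(1, p)`.
  have hcomp := minor_comparison (φ := sig u) (ψ := u.map WittVector.frobenius) (x :=
      (p : WittVector p R))
    (hW.rankT.map WittVector.frobenius) (hW.rankL.map WittVector.frobenius)
        (hW'.rankT.map WittVector.frobenius)
    (hW'.rankL.map WittVector.frobenius)
    (by rw [← fromBlocks_map_diag, ← e, ← sig_e, ← sig_mul W'.e_isFil hu.fil, hu.left])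
    (by rw [← fromBlocks_map_diag, ← e, ← sig_e, ← sig_mul hu.fil W.e_isFil, hu.right])
    (by rw [← fromBlocks_map_diag, ← e, ← matrix_map_mul, hu.left])
    (by rw [← fromBlocks_map_diag, ← e, ← matrix_map_mul, hu.right]) (sig_mul_diagBlocks hu.fil)
  -- From `u = Ψ' u^σ Ψ⁻¹`, the minors of `u` are combinations of those of `u^σ`.
  have hspan : ∀ q : (Fin d ⊕ Fin c → t' ⊕ l') × (Fin d ⊕ Fin c → t ⊕ l),
      ∃ r : (Fin d ⊕ Fin c → t' ⊕ l') × (Fin d ⊕ Fin c → t ⊕ l) → WittVector p R,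
      ∑ j, r j * ((sig u).submatrix j.1 j.2).det = (u.submatrix q.1 q.2).det := by
    intro q
    have h3 : (u.submatrix q.1 q.2).det ∈ minorIdeal (Fin d ⊕ Fin c) (sig u) := by
      have h4 := minor_mem u q.1 q.2
      have h5 : u = W'.Ψ * sig u * W.Ψi := hu.fixed.symm
      rw [h5] at h4
      have := minorIdeal_mul_le _ _ _ h4
      rwa [← h5] at this
    exact Ideal.mem_span_range_iff_exists_fun.1 h3
  choose r hr using hspan
  refine p_pow_mem_span_of_frobenius' ha (c := c) (U := r) (fun i => ?_) (fun q => h₁ q.1 q.2) h₂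
  rw [← hr i, Finset.mul_sum]
  refine Finset.sum_congr rfl fun j _ => ?_
  rw [mul_left_comm, hcomp j.1 j.2, RingHom.map_det]
  rfl

theorem exists_quasiInverse_of_mem {d c : ℕ} (hW : W.HasRanks d c) (hW' : W'.HasRanks d c)
    (hu : IsPre W W' u) {x : WittVector p R} (hx : x ∈ minorIdeal (Fin d ⊕ Fin c) u) :
    ∃ G : Matrix (t ⊕ l) (t' ⊕ l') (WittVector p R), W.e * G = G ∧ G * W'.e = G ∧
      G * u = x • W.e ∧ u * G = x • W'.e := by
  obtain ⟨G, h1, h2, h3⟩ := exists_quasiInverse hW.rankT hW.rankL hW'.rankT hW'.rankL hu.left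
    hu.right hx
  change W.e * G * W'.e = G at h1
  refine ⟨G, ?_, ?_, h2, h3⟩
  · rw [← h1, ← Matrix.mul_assoc, ← Matrix.mul_assoc, W.e_mul_e]
  · rw [← h1, Matrix.mul_assoc, W'.e_mul_e]

/-- A quasi-inverse commutes with the operators `Φ` up to torsion. -/
theorem pow_smul_Φ_quasiInverse (hu : IsHom W W' u) {G : Matrix (t ⊕ l) (t' ⊕ l') (WittVector p R)}
    (hG : IsPre W' W G) {k : ℕ} (h₁ : G * u = (p : WittVector p R) ^ k • W.e)
    (h₂ : u * G = (p : WittVector p R) ^ k • W'.e) :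
    (p : WittVector p R) ^ k • Φ W' W G = (p : WittVector p R) ^ k • G := by
  -- `u Φ(G) = Φ(u G) = Φ(p^k e') = p^k e'`. Multiplying by `G` from the left turns `u` into `p^k`.
  have h3 : u * Φ W' W G = u * G := by
    have h4 := Φ_comp hu.toIsPre hG
    rw [hu.fixed, h₂, ← Nat.cast_pow, Φ_natCast_smul _ W'.e_isFil, Φ_e, Nat.cast_pow, ← h₂] at h4
    exact h4.symm
  have h5 := congrArg (fun v => G * v) h3
  simp only [← Matrix.mul_assoc, h₁, Matrix.smul_mul, hG.left, e_mul_Φ] at h5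
  exact h5

/-- The quasi-inverse of an isogeny. -/
theorem IsHom.exists_quasiInverse {a : ℕ} (ha : (p : R) ^ a = 0) {d c : ℕ} (hW : W.HasRanks d c)
    (hW' : W'.HasRanks d c) (hu : IsHom W W' u) {n : ℕ}
    (hn : (p : WittVector p R) ^ n ∈ minorIdeal (Fin d ⊕ Fin c) u) :
    ∃ G, IsHom W' W G ∧ G * u = (p : WittVector p R) ^ (2 * (n + a)) • W.e ∧
      u * G = (p : WittVector p R) ^ (2 * (n + a)) • W'.e := by
  obtain ⟨G, h1, h2, h3, h4⟩ := exists_quasiInverse_of_mem hW hW' hu.toIsPre hn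
  -- `p^a` vanishes in `R`, so multiplying by it moves the upper right block of `G` into `I_R`.
  have hpa : (p : WittVector p R) ^ a ∈ vIdeal p R 1 := by
    rw [mem_vIdeal_one, coeff_zero_pow, coeff_zero_natCast, ha]
  set G₁ := (p : WittVector p R) ^ a • G with hG₁
  have hG₁p : IsPre W' W G₁ := ⟨fun i j => Ideal.mul_mem_right _ _ hpa,
    by rw [hG₁, Matrix.mul_smul, h1], by rw [hG₁, Matrix.smul_mul, h2]⟩
  have h5 : G₁ * u = (p : WittVector p R) ^ (n + a) • W.e := by
    rw [hG₁, Matrix.smul_mul, h3, smul_smul, ← pow_add, add_comm]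
  have h6 : u * G₁ = (p : WittVector p R) ^ (n + a) • W'.e := by
    rw [hG₁, Matrix.mul_smul, h4, smul_smul, ← pow_add, add_comm]
  have h7 := pow_smul_Φ_quasiInverse hu hG₁p h5 h6
  -- The second factor `p^(n + a)` kills the torsion by which `G₁` fails to be fixed by `Φ`; this
  -- doubles the exponent.
  refine ⟨(p : WittVector p R) ^ (n + a) • G₁, ⟨hG₁p.smul _, ?_⟩, ?_, ?_⟩
  · rw [← Nat.cast_pow, Φ_natCast_smul _ hG₁p.fil, Nat.cast_pow, h7]
  · rw [Matrix.smul_mul, h5, smul_smul, ← pow_add, two_mul]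
  · rw [Matrix.mul_smul, h6, smul_smul, ← pow_add, two_mul]

/-- One-sided inverses between images of idempotent matrices of the same rank are two-sided. -/
theorem mul_eq_of_mul_eq {A : Type*} [CommRing A] {m n : Type*} [Fintype m] [Fintype n] {d : ℕ}
    {e : Matrix n n A} {e' : Matrix m m A} (he : LocRank e d) (he' : LocRank e' d)
    {x : Matrix m n A} {y : Matrix n m A} (hx : x * e = x) (hy : e * y = y)
    (hxy : x * y = e') (hx' : e' * x = x) (hy' : y * e' = y) : y * x = e := by
  refine matrix_eq_of_localization fun q _ => ?_
  obtain ⟨U, V, h1, h2⟩ := he q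
  obtain ⟨U', V', h3, h4⟩ := he' q
  have hx := congrArg (fun v => v.map (algebraMap A (Localization.AtPrime q))) hx
  have hy := congrArg (fun v => v.map (algebraMap A (Localization.AtPrime q))) hy
  have hxy := congrArg (fun v => v.map (algebraMap A (Localization.AtPrime q))) hxy
  have hx' := congrArg (fun v => v.map (algebraMap A (Localization.AtPrime q))) hx'
  have hy' := congrArg (fun v => v.map (algebraMap A (Localization.AtPrime q))) hy'
  simp only [matrix_map_mul, ← h1, ← h3] at hx hy hxy hx' hy' ⊢
  set X := x.map (algebraMap A (Localization.AtPrime q))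
  set Y := y.map (algebraMap A (Localization.AtPrime q))
  have h5 : (V' * X * U) * (V * Y * U') = 1 := by
    calc _ = V' * (X * (U * V)) * Y * U' := by simp only [Matrix.mul_assoc]
      _ = V' * (X * Y) * U' := by rw [hx]; simp only [Matrix.mul_assoc]
      _ = (V' * U') * (V' * U') := by rw [hxy]; simp only [Matrix.mul_assoc]
      _ = 1 := by rw [h4, Matrix.mul_one]
  have h6 := mul_eq_one_comm.1 h5
  calc Y * X = (U * V * Y) * (U' * V' * (X * (U * V))) := by rw [hx, hx', hy]
    _ = U * ((V * Y * U') * (V' * X * U)) * V := by simp only [Matrix.mul_assoc]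
    _ = U * V := by rw [h6, Matrix.mul_one]

/-- A morphism whose minors generate the unit ideal is an isomorphism. -/
theorem IsHom.exists_inverse {d c : ℕ} (hW : W.HasRanks d c)
    (hW' : W'.HasRanks d c) (hu : IsHom W W' u)
    (h : (1 : WittVector p R) ∈ minorIdeal (Fin d ⊕ Fin c) u) :
    ∃ G, IsHom W' W G ∧ G * u = W.e ∧ u * G = W'.e := by
  obtain ⟨G, h1, h2, h3, h4⟩ := exists_quasiInverse_of_mem hW hW' hu.toIsPre h
  rw [one_smul] at h3 h4
  set κ : WittVector p R →+* R := constantCoeff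
  have hu0 : u.toBlocks₁₂.map κ = 0 := by
    ext i j; exact mem_vIdeal_one.1 (hu.fil i j)
  -- Modulo `I_R` the matrix `u` is block lower triangular. Its diagonal block on `T` has a right
  -- inverse `G₁₁`, which is two-sided because the ranks agree, and it kills `G₁₂`; hence `G₁₂ = G₁₁
  -- u₁₁ G₁₂ = 0`.
  have hG0 : G.toBlocks₁₂.map κ = 0 := by
    have b1 : u.toBlocks₁₁.map κ * G.toBlocks₁₁.map κ = W'.eT.map κ := by
      simpa [(toBlocks_mul u G).1, Matrix.map_add _ (_root_.map_add κ), matrix_map_mul, hu0]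
        using congrArg (fun v => v.toBlocks₁₁.map κ) h4
    have b2 : u.toBlocks₁₁.map κ * G.toBlocks₁₂.map κ = 0 := by
      simpa [(toBlocks_mul u G).2.1, Matrix.map_add _ (_root_.map_add κ), matrix_map_mul, hu0,
        Matrix.map_zero κ (_root_.map_zero κ)]
        using congrArg (fun v => v.toBlocks₁₂.map κ) h4
    have c1 : u.toBlocks₁₁.map κ * W.eT.map κ = u.toBlocks₁₁.map κ := by
      simpa [(toBlocks_mul u W.e).1, matrix_map_mul]
        using congrArg (fun v => v.toBlocks₁₁.map κ) hu.right
    have c2 : W'.eT.map κ * u.toBlocks₁₁.map κ = u.toBlocks₁₁.map κ := by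
      simpa [(toBlocks_mul W'.e u).1, matrix_map_mul]
        using congrArg (fun v => v.toBlocks₁₁.map κ) hu.left
    have c3 : W.eT.map κ * G.toBlocks₁₁.map κ = G.toBlocks₁₁.map κ := by
      simpa [(toBlocks_mul W.e G).1, matrix_map_mul]
        using congrArg (fun v => v.toBlocks₁₁.map κ) h1
    have c4 : G.toBlocks₁₁.map κ * W'.eT.map κ = G.toBlocks₁₁.map κ := by
      simpa [(toBlocks_mul G W'.e).1, matrix_map_mul]
        using congrArg (fun v => v.toBlocks₁₁.map κ) h2
    have c5 : W.eT.map κ * G.toBlocks₁₂.map κ = G.toBlocks₁₂.map κ := by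
      simpa [(toBlocks_mul W.e G).2.1, matrix_map_mul]
        using congrArg (fun v => v.toBlocks₁₂.map κ) h1
    rw [← c5, ← mul_eq_of_mul_eq (hW.rankT.map κ) (hW'.rankT.map κ) c1 c3 b1 c2 c4,
      Matrix.mul_assoc, b2, Matrix.mul_zero]
  have hGp : IsPre W' W G := ⟨fun i j => mem_vIdeal_one.2 (congrFun₂ hG0 i j), h1, h2⟩
  refine ⟨G, ⟨hGp, ?_⟩, h3, h4⟩
  simpa using pow_smul_Φ_quasiInverse (k := 0) hu hGp (by simpa using h3) (by simpa using h4)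

end WindowMatrix

end QuasiInverse


/-! ### Matrices of linear maps between direct summands of free modules. -/

section Coordinates

open Matrix

/-- A presentation of a module as a direct summand of a free module with basis indexed by `t`. -/
structure ModCoords (A : Type*) [CommRing A] (M : Type*) [AddCommGroup M] [Module A M]
    (t : Type*) where
  /-- the coordinates -/
  s : M →ₗ[A] (t → A)
  /-- the projection -/
  r : (t → A) →ₗ[A] M
  r_s : ∀ x, r (s x) = x

namespace ModCoords

variable {A B : Type*} [CommRing A] [CommRing B] {M N K : Type*} [AddCommGroup M] [Module A M]
  [AddCommGroup N] [Module A N] [AddCommGroup K] [Module A K] {t l k : Type*}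

theorem exists_of_projective [Module.Finite A M] [Module.Projective A M] :
    ∃ n : ℕ, Nonempty (ModCoords A M (Fin n)) := by
  obtain ⟨n, f, g, -, -, h⟩ := Module.Finite.exists_comp_eq_id_of_projective A M
  exact ⟨n, ⟨⟨g, f, fun x => LinearMap.congr_fun h x⟩⟩⟩

/-- Coordinates on a direct sum. -/
def prod (C : ModCoords A M t) (D : ModCoords A N l) : ModCoords A (M × N) (t ⊕ l) where
  s :=
    { toFun := fun x => Sum.elim (C.s x.1) (D.s x.2)
      map_add' := fun x y => by ext (i | i) <;> simp
      map_smul' := fun a x => by ext (i | i) <;> simp }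
  r := (C.r.comp (LinearMap.funLeft A A Sum.inl)).prod (D.r.comp (LinearMap.funLeft A A Sum.inr))
  r_s x := Prod.ext (C.r_s x.1) (D.r_s x.2)

theorem prod_s_apply (C : ModCoords A M t) (D : ModCoords A N l) (x : M × N) :
    (C.prod D).s x = Sum.elim (C.s x.1) (D.s x.2) := rfl

/-- The coordinates of the base change. -/
def extS (f : A →+* B) (C : ModCoords A M t) : M →ₛₗ[f] (t → B) where
  toFun x := fun i => f (C.s x i)
  map_add' x y := by ext i; simp
  map_smul' a x := by ext i; simp

variable [Fintype t] [DecidableEq t] [Fintype l] [DecidableEq l] [Fintype k] [DecidableEq k]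

theorem sum_smul_r (C : ModCoords A M t) (v : t → A) :
    ∑ i, v i • C.r (Pi.single i 1) = C.r v := by
  conv_rhs => rw [pi_eq_sum_univ' v, map_sum]
  refine Finset.sum_congr rfl fun i _ => ?_
  rw [map_smul]

/-- Coordinates on the base change of a module. -/
def ext (f : A →+* B) (C : ModCoords A M t) : ModCoords B (ExtScalars f M) t where
  s := ExtScalars.lift (C.extS f)
  r := Fintype.linearCombination B fun i => ExtScalars.of f (C.r (Pi.single i 1))
  r_s x := by
    refine LinearMap.congr_fun (f := (Fintype.linearCombination B fun i =>
      ExtScalars.of f (C.r (Pi.single i 1))).comp (ExtScalars.lift (C.extS f)))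
      (g := LinearMap.id) (ExtScalars.hom_ext fun y => ?_) x
    rw [LinearMap.comp_apply, ExtScalars.lift_of, Fintype.linearCombination_apply]
    conv_rhs => rw [← C.r_s y, ← C.sum_smul_r, LinearMap.id_apply, map_sum]
    exact Finset.sum_congr rfl fun i _ => (LinearMap.map_smulₛₗ _ _ _).symm

theorem ext_s_of (f : A →+* B) (C : ModCoords A M t) (x : M) (i : t) :
    (C.ext f).s (ExtScalars.of f x) i = f (C.s x i) := by
  rw [ext, ExtScalars.lift_of]; rfl

theorem ext_r_single (f : A →+* B) (C : ModCoords A M t) (i : t) :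
    (C.ext f).r (Pi.single i 1) = ExtScalars.of f (C.r (Pi.single i 1)) := by
  rw [ext, Fintype.linearCombination_apply_single, one_smul]

theorem prod_r_inl (C : ModCoords A M t) (D : ModCoords A N l) (i : t) :
    (C.prod D).r (Pi.single (Sum.inl i) 1) = (C.r (Pi.single i 1), 0) := by
  have h1 : LinearMap.funLeft A A Sum.inl (Pi.single (Sum.inl i : t ⊕ l) 1) = Pi.single i 1 := by
    ext j; simp [LinearMap.funLeft_apply, Pi.single_apply]
  have h2 : LinearMap.funLeft A A Sum.inr (Pi.single (Sum.inl i : t ⊕ l) 1) = 0 := by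
    ext j; simp [LinearMap.funLeft_apply]
  change (C.r _, D.r _) = _
  rw [h1, h2, map_zero]

theorem prod_r_inr (C : ModCoords A M t) (D : ModCoords A N l) (i : l) :
    (C.prod D).r (Pi.single (Sum.inr i) 1) = (0, D.r (Pi.single i 1)) := by
  have h1 : LinearMap.funLeft A A Sum.inr (Pi.single (Sum.inr i : t ⊕ l) 1) = Pi.single i 1 := by
    ext j; simp [LinearMap.funLeft_apply, Pi.single_apply]
  have h2 : LinearMap.funLeft A A Sum.inl (Pi.single (Sum.inr i : t ⊕ l) 1) = 0 := by
    ext j; simp [LinearMap.funLeft_apply]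
  change (C.r _, D.r _) = _
  rw [h1, h2, map_zero]

/-- The matrix of a linear map. -/
def mat (C : ModCoords A M t) (D : ModCoords A N l) (φ : M →ₗ[A] N) : Matrix l t A :=
  LinearMap.toMatrix' ((D.s.comp φ).comp C.r)

theorem mat_apply (C : ModCoords A M t) (D : ModCoords A N l) (φ : M →ₗ[A] N) (i j) :
    mat C D φ i j = D.s (φ (C.r (Pi.single j 1))) i := rfl

theorem mat_comp (C : ModCoords A M t) (D : ModCoords A N l) (E : ModCoords A K k)
    (ψ : N →ₗ[A] K) (φ : M →ₗ[A] N) : mat C E (ψ.comp φ) = mat D E ψ * mat C D φ := by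
  rw [mat, mat, mat, ← LinearMap.toMatrix'_comp]
  congr 1
  ext x
  simp [D.r_s]

theorem mat_injective (C : ModCoords A M t) (D : ModCoords A N l) {φ ψ : M →ₗ[A] N}
    (h : mat C D φ = mat C D ψ) : φ = ψ := by
  have h1 := LinearMap.toMatrix'.injective h
  ext x
  have h2 := LinearMap.congr_fun h1 (C.s x)
  simp only [LinearMap.comp_apply, C.r_s] at h2
  rw [← D.r_s (φ x), h2, D.r_s]

theorem mat_id_mul (C : ModCoords A M t) (D : ModCoords A N l) (φ : M →ₗ[A] N) :
    mat D D LinearMap.id * mat C D φ = mat C D φ := by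
  rw [← mat_comp, LinearMap.id_comp]

theorem mat_mul_id (C : ModCoords A M t) (D : ModCoords A N l) (φ : M →ₗ[A] N) :
    mat C D φ * mat C C LinearMap.id = mat C D φ := by
  rw [← mat_comp, LinearMap.comp_id]

theorem mat_zero (C : ModCoords A M t) (D : ModCoords A N l) :
    mat C D (0 : M →ₗ[A] N) = 0 := by
  ext i j; simp [mat_apply]

theorem mat_smul (C : ModCoords A M t) (D : ModCoords A N l) (a : A) (φ : M →ₗ[A] N) :
    mat C D (a • φ) = a • mat C D φ := by
  ext i j; simp [mat_apply]

theorem mat_ext (f : A →+* B) (C : ModCoords A M t) (D : ModCoords A N l) (φ : M →ₗ[A] N) :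
    mat (C.ext f) (D.ext f) (ExtScalars.map f φ) = (mat C D φ).map f := by
  ext i j
  rw [mat_apply, ext_r_single, ExtScalars.map_of, ext_s_of, Matrix.map_apply, mat_apply]

theorem mat_prod {M' N' : Type*} [AddCommGroup M'] [Module A M'] [AddCommGroup N'] [Module A N']
    {t' l' : Type*} [Fintype t'] [DecidableEq t'] [Fintype l'] [DecidableEq l']
    (C : ModCoords A M t) (D : ModCoords A N l) (C' : ModCoords A M' t') (D' : ModCoords A N' l')
    (a : M →ₗ[A] M') (b : N →ₗ[A] M') (c : M →ₗ[A] N') (d : N →ₗ[A] N') :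
    mat (C.prod D) (C'.prod D') ((a.coprod b).prod (c.coprod d)) =
      fromBlocks (mat C C' a) (mat D C' b) (mat C D' c) (mat D D' d) := by
  ext (i | i) (j | j) <;> simp [mat_apply, prod_r_inl, prod_r_inr, prod_s_apply]

theorem mat_prod_id (C : ModCoords A M t) (D : ModCoords A N l) :
    mat (C.prod D) (C.prod D) LinearMap.id =
      fromBlocks (mat C C LinearMap.id) 0 0 (mat D D LinearMap.id) := by
  rw [← mat_zero C D, ← mat_zero D C, ← mat_prod]
  congr 1
  ext x <;> simp

/-- The linear map attached to a matrix. -/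
def ofMat (C : ModCoords A M t) (D : ModCoords A N l) (u : Matrix l t A) : M →ₗ[A] N :=
  (D.r.comp (Matrix.toLin' u)).comp C.s

theorem mat_ofMat (C : ModCoords A M t) (D : ModCoords A N l) (u : Matrix l t A) :
    mat C D (ofMat C D u) = mat D D LinearMap.id * u * mat C C LinearMap.id := by
  have h1 : u = LinearMap.toMatrix' (Matrix.toLin' u) := (LinearMap.toMatrix'_toLin' u).symm
  conv_rhs => rw [h1]
  rw [mat, mat, mat, ← LinearMap.toMatrix'_comp, ← LinearMap.toMatrix'_comp]
  rfl

end ModCoords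

end Coordinates

/-! ### Coordinates on windows, and their base change. -/

section WindowCoordinates

open Matrix ModCoords

variable {p : ℕ} {F G : Frame.{u} p}

/-- The coordinates of an element of `I ⊗ M`. -/
def filCoord {M : Type*} [AddCommGroup M] [Module F.carrier M] {t : Type*}
    (C : ModCoords F.carrier M t) (i : t) : F.fil ⊗[F.carrier] M →ₗ[F.carrier] F.fil :=
  (TensorProduct.rid F.carrier F.fil).toLinearMap.comp
    (LinearMap.lTensor F.fil ((LinearMap.proj i).comp C.s))

theorem filCoord_tmul {M : Type*} [AddCommGroup M] [Module F.carrier M] {t : Type*}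
    (C : ModCoords F.carrier M t) (i : t) (x : F.fil) (y : M) :
    filCoord C i (x ⊗ₜ y) = C.s y i • x := by
  simp [filCoord]

theorem s_act {M : Type*} [AddCommGroup M] [Module F.carrier M] {t : Type*}
    (C : ModCoords F.carrier M t) (i : t) (z : F.fil ⊗[F.carrier] M) :
    C.s (F.act M z) i = F.ι (filCoord C i z) := by
  induction z using TensorProduct.induction_on with
  | zero => simp
  | tmul x y => simp [filCoord_tmul, mul_comm]
  | add z w hz hw => rw [map_add, map_add, map_add, map_add, Pi.add_apply, hz, hw]

theorem s_divAct {M : Type*} [AddCommGroup M] [Module F.carrier M] {t : Type*} [Fintype t]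
    [DecidableEq t] (C : ModCoords F.carrier M t) (i : t) (z : F.fil ⊗[F.carrier] M) :
    (C.ext F.σ).s (F.divAct M z) i = F.σdiv (filCoord C i z) := by
  induction z using TensorProduct.induction_on with
  | zero => simp
  | tmul x y =>
    rw [Frame.divAct_tmul, map_smul, Pi.smul_apply, ext_s_of, filCoord_tmul,
      LinearMap.map_smulₛₗ, smul_eq_mul, smul_eq_mul, mul_comm]
  | add z w hz hw => rw [map_add, map_add, map_add, map_add, Pi.add_apply, hz, hw]

/-- Coordinates on a window. -/
structure WinCoords (P : Window F) (t l : Type*) where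
  /-- the coordinates of `T` -/
  T : ModCoords F.carrier P.T t
  /-- the coordinates of `L` -/
  L : ModCoords F.carrier P.L l

namespace WinCoords

theorem exists_winCoords (P : Window F) :
    ∃ m n : ℕ, Nonempty (WinCoords P (Fin m) (Fin n)) := by
  obtain ⟨m, ⟨C⟩⟩ := exists_of_projective (A := F.carrier) (M := P.T)
  obtain ⟨n, ⟨D⟩⟩ := exists_of_projective (A := F.carrier) (M := P.L)
  exact ⟨m, n, ⟨C, D⟩⟩

variable {P Q : Window F} {t l t' l' : Type*} [Fintype t] [DecidableEq t] [Fintype l]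
  [DecidableEq l] [Fintype t'] [DecidableEq t'] [Fintype l'] [DecidableEq l']

/-- The coordinates of `T ⊕ L`. -/
abbrev sum (C : WinCoords P t l) : ModCoords F.carrier (P.T × P.L) (t ⊕ l) := C.T.prod C.L

/-- The coordinates of `T^σ ⊕ L^σ`. -/
abbrev twist (C : WinCoords P t l) :
    ModCoords F.quot (ExtScalars F.σ P.T × ExtScalars F.σ P.L) (t ⊕ l) :=
  (C.T.ext F.σ).prod (C.L.ext F.σ)

/-- The matrix of `Ψ`. -/
def Ψ (C : WinCoords P t l) : Matrix (t ⊕ l) (t ⊕ l) F.quot :=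
  mat C.twist (C.sum.ext F.π) P.Ψ.toLinearMap

/-- The matrix of `Ψ⁻¹`. -/
def Ψi (C : WinCoords P t l) : Matrix (t ⊕ l) (t ⊕ l) F.quot :=
  mat (C.sum.ext F.π) C.twist P.Ψ.symm.toLinearMap

/-- The matrix of the upper right entry, with entries in `I`. -/
def filMat (C : WinCoords P t l) (D : WinCoords Q t' l') (f : Window.PreHom P Q) :
    Matrix t' l F.fil :=
  of fun i j => filCoord D.T i (f.b (C.L.r (Pi.single j 1)))

theorem mat_toLin (C : WinCoords P t l) (D : WinCoords Q t' l') (f : Window.PreHom P Q) :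
    mat C.sum D.sum f.toLin = fromBlocks (mat C.T D.T f.a) ((filMat C D f).map F.ι)
      (mat C.T D.L f.c) (mat C.L D.L f.d) := by
  rw [Window.PreHom.toLin, mat_prod]
  congr 1
  ext i j
  rw [mat_apply, LinearMap.comp_apply, s_act]
  rfl

theorem mat_sigma (C : WinCoords P t l) (D : WinCoords Q t' l') (f : Window.PreHom P Q) :
    mat C.twist D.twist f.sigma = fromBlocks ((mat C.T D.T f.a).map F.σ)
      ((filMat C D f).map F.σdiv) ((p : F.quot) • (mat C.T D.L f.c).map F.σ)
      ((mat C.L D.L f.d).map F.σ) := by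
  rw [Window.PreHom.sigma, mat_prod, mat_ext, mat_ext, mat_smul, mat_ext]
  congr 1
  ext i j
  rw [mat_apply, ext_r_single, ExtScalars.lift_of, LinearMap.comp_apply, s_divAct]
  rfl

theorem comm_iff (C : WinCoords P t l) (D : WinCoords Q t' l') (f : Window.PreHom P Q) :
    (ExtScalars.map F.π f.toLin).comp P.Ψ.toLinearMap = Q.Ψ.toLinearMap.comp f.sigma ↔
      (mat C.sum D.sum f.toLin).map F.π * C.Ψ = D.Ψ * mat C.twist D.twist f.sigma := by
  constructor
  · intro h
    have := congrArg (mat C.twist (D.sum.ext F.π)) h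
    rwa [mat_comp _ (C.sum.ext F.π), mat_comp _ D.twist, mat_ext] at this
  · intro h
    refine mat_injective C.twist (D.sum.ext F.π) ?_
    rwa [mat_comp _ (C.sum.ext F.π), mat_comp _ D.twist, mat_ext]

theorem Ψ_mul_Ψi (C : WinCoords P t l) :
    C.Ψ * C.Ψi = (mat C.sum C.sum LinearMap.id).map F.π := by
  rw [Ψ, Ψi, ← mat_comp, ← mat_ext, ExtScalars.map_id]
  congr 1
  ext x; simp

theorem Ψi_mul_Ψ (C : WinCoords P t l) :
    C.Ψi * C.Ψ = mat C.twist C.twist LinearMap.id := by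
  rw [Ψ, Ψi, ← mat_comp]
  congr 1
  refine LinearMap.ext fun x => ?_
  simp

theorem sum_r_inl (C : WinCoords P t l) (j : t) :
    C.sum.r (Pi.single (Sum.inl j) 1) = (C.T.r (Pi.single j 1), 0) := prod_r_inl _ _ _

theorem sum_r_inr (C : WinCoords P t l) (j : l) :
    C.sum.r (Pi.single (Sum.inr j) 1) = (0, C.L.r (Pi.single j 1)) := prod_r_inr _ _ _

theorem twist_r_inl (C : WinCoords P t l) (j : t) :
    C.twist.r (Pi.single (Sum.inl j) 1) = (ExtScalars.of F.σ (C.T.r (Pi.single j 1)), 0) := by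
  rw [← ext_r_single]; exact prod_r_inl _ _ _

theorem twist_r_inr (C : WinCoords P t l) (j : l) :
    C.twist.r (Pi.single (Sum.inr j) 1) = (0, ExtScalars.of F.σ (C.L.r (Pi.single j 1))) := by
  rw [← ext_r_single]; exact prod_r_inr _ _ _

/-- The coordinates of the base change of a window. -/
def baseChange (α : Frame.Hom F G) (C : WinCoords P t l) : WinCoords (P.baseChange α) t l where
  T := C.T.ext α.ring
  L := C.L.ext α.ring

theorem mat_toLin_baseChange (α : Frame.Hom F G) (C : WinCoords P t l) (D : WinCoords Q t' l')
    (f : Window.PreHom P Q) :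
    mat (C.baseChange α).sum (D.baseChange α).sum (f.baseChange α).toLin =
      (mat C.sum D.sum f.toLin).map α.ring := by
  ext i j
  have h : ∀ (x : P.T) (y : P.L), (D.baseChange α).sum.s ((f.baseChange α).toLin
      (ExtScalars.of α.ring x, ExtScalars.of α.ring y)) i =
        α.ring (D.sum.s (f.toLin (x, y)) i) := by
    intro x y
    rw [Window.PreHom.toLin_baseChange_of]
    rcases i with i | i
    · exact ext_s_of _ _ _ _
    · exact ext_s_of _ _ _ _
  rw [Matrix.map_apply, mat_apply, mat_apply]
  rcases j with j | j
  · have h1 := h (C.T.r (Pi.single j 1)) 0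
    rw [map_zero, ← ext_r_single] at h1
    rw [sum_r_inl, sum_r_inl]
    exact h1
  · have h1 := h 0 (C.L.r (Pi.single j 1))
    rw [map_zero, ← ext_r_single] at h1
    rw [sum_r_inr, sum_r_inr]
    exact h1

theorem Ψ_baseChange (α : Frame.Hom F G) (C : WinCoords P t l) :
    (C.baseChange α).Ψ = C.Ψ.map α.quot := by
  have h : ∀ (w : ExtScalars F.π (P.T × P.L)) (i), ((C.baseChange α).sum.ext G.π).s
      (Window.targetEquiv α P (ExtScalars.of α.quot w)) i =
      α.quot ((C.sum.ext F.π).s w i) := by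
    intro w i
    obtain ⟨w, rfl⟩ : ∃ v, ExtScalars.of F.π v = w := by
      induction w using ExtScalars.induction_on with
      | zero => exact ⟨0, map_zero _⟩
      | add z w hz hw =>
        obtain ⟨z, rfl⟩ := hz
        obtain ⟨w, rfl⟩ := hw
        exact ⟨z + w, map_add _ _ _⟩
      | smul_of s v =>
        obtain ⟨s, rfl⟩ := F.π_surjective s
        exact ⟨s • v, LinearMap.map_smulₛₗ _ _ _⟩
    rw [Window.targetEquiv_of, ext_s_of, ext_s_of]
    have h2 := RingHom.congr_fun α.π_ring (C.sum.s w i)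
    rw [RingHom.comp_apply, RingHom.comp_apply] at h2
    rw [← h2]
    congr 1
    rcases i with i | i
    · exact ext_s_of _ _ _ _
    · exact ext_s_of _ _ _ _
  ext i j
  rw [Matrix.map_apply, Ψ, Ψ, mat_apply, mat_apply, ← h]
  rcases j with j | j
  · have h1 : (C.baseChange α).T.r (Pi.single j 1) = ExtScalars.of α.ring (C.T.r (Pi.single j 1)) :=
      ext_r_single _ _ _
    have h2 := Window.sourceEquiv_of_left α P (C.T.r (Pi.single j 1))
    rw [twist_r_inl, twist_r_inl, h1]
    refine congrArg (fun v => ((C.baseChange α).sum.ext G.π).s v i) ?_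
    change Window.targetEquiv α P (ExtScalars.congr α.quot P.Ψ (Window.sourceEquiv α P
      (ExtScalars.of G.σ (ExtScalars.of α.ring (C.T.r (Pi.single j 1))), 0))) = _
    rw [h2, ExtScalars.congr_of]
    rfl
  · have h1 : (C.baseChange α).L.r (Pi.single j 1) = ExtScalars.of α.ring (C.L.r (Pi.single j 1)) :=
      ext_r_single _ _ _
    have h2 := Window.sourceEquiv_of_right α P (C.L.r (Pi.single j 1))
    rw [twist_r_inr, twist_r_inr, h1]
    refine congrArg (fun v => ((C.baseChange α).sum.ext G.π).s v i) ?_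
    change Window.targetEquiv α P (ExtScalars.congr α.quot P.Ψ (Window.sourceEquiv α P
      (0, ExtScalars.of G.σ (ExtScalars.of α.ring (C.L.r (Pi.single j 1)))))) = _
    rw [h2, ExtScalars.congr_of]
    rfl

end WinCoords

namespace Window

variable (α : Frame.Hom F G)

theorem map_lTensor {M N : Type u} [AddCommGroup M] [Module F.carrier M] [AddCommGroup N]
    [Module F.carrier N] (g : M →ₗ[F.carrier] N) (z : F.fil ⊗[F.carrier] M) :
    TensorProduct.map α.fil (ExtScalars.of α.ring) (LinearMap.lTensor F.fil g z) =
      LinearMap.lTensor G.fil (ExtScalars.map α.ring g)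
        (TensorProduct.map α.fil (ExtScalars.of α.ring) z) := by
  induction z using TensorProduct.induction_on with
  | zero => simp
  | tmul i x => simp
  | add z w hz hw => simp [hz, hw]

theorem PreHom.baseChange_comp {P Q R : Window F} (g : PreHom Q R) (f : PreHom P Q) :
    (g.comp f).baseChange α = (g.baseChange α).comp (f.baseChange α) := by
  refine PreHom.ext (ExtScalars.hom_ext fun x => ?_) (ExtScalars.hom_ext fun x => ?_)
    (ExtScalars.hom_ext fun x => ?_) (ExtScalars.hom_ext fun x => ?_) <;>
  simp [PreHom.comp, act_map, map_lTensor]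

theorem Hom.baseChange_comp {P Q R : Window F} (g : Hom Q R) (f : Hom P Q) :
    (g.comp f).baseChange α = (g.baseChange α).comp (f.baseChange α) := by
  have h := PreHom.baseChange_comp α g.toPreHom f.toPreHom
  exact Hom.ext (congrArg PreHom.a h) (congrArg PreHom.b h) (congrArg PreHom.c h)
    (congrArg PreHom.d h)

end Window

end WindowCoordinates


/-! ### Dictionary between displays and matrices. -/

section DisplayCoordinates

open WittVector Matrix ModCoords

variable {p : ℕ} [hp : Fact p.Prime] {R : Type u} [CommRing R]

namespace WinCoords

variable {P Q S : Display p R} {t l t' l' t'' l'' : Type*} [Fintype t] [DecidableEq t] [Fintype l]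
  [DecidableEq l] [Fintype t'] [DecidableEq t'] [Fintype l'] [DecidableEq l']
  [Fintype t''] [DecidableEq t''] [Fintype l''] [DecidableEq l'']

/-- The matrix of a homomorphism. -/
abbrev M (C : WinCoords P t l) (D : WinCoords Q t' l') (f : Window.PreHom P Q) :
    Matrix (t' ⊕ l') (t ⊕ l) (WittVector p R) :=
  mat C.sum D.sum f.toLin

theorem mat_sigma_eq_sig (C : WinCoords P t l) (D : WinCoords Q t' l') (f : Window.PreHom P Q) :
    mat C.twist D.twist f.sigma = sig (C.M D f) := by
  rw [mat_sigma, M, mat_toLin, sig]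
  exact fromBlocks_congr rfl rfl rfl rfl

theorem M_id (C : WinCoords P t l) :
    C.M C (Window.PreHom.id P) = fromBlocks (mat C.T C.T LinearMap.id) 0 0
      (mat C.L C.L LinearMap.id) := by
  rw [M, Window.PreHom.toLin_id, mat_prod_id]

theorem mat_twist_id (C : WinCoords P t l) :
    mat C.twist C.twist LinearMap.id = sig (fromBlocks (mat C.T C.T LinearMap.id) 0 0
      (mat C.L C.L LinearMap.id)) := by
  rw [← Window.PreHom.sigma_id, mat_sigma_eq_sig, M_id]

theorem map_π (u : Matrix t l (WittVector p R)) : u.map (wittFrame p R).π = u := by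
  ext i j; rfl

theorem mat_π_id (C : WinCoords P t l) :
    mat (C.sum.ext (wittFrame p R).π) (C.sum.ext (wittFrame p R).π) LinearMap.id =
      fromBlocks (mat C.T C.T LinearMap.id) 0 0 (mat C.L C.L LinearMap.id) := by
  rw [← ExtScalars.map_id, mat_ext, mat_prod_id]
  exact map_π _

/-- The matrices of a display. -/
def matrix (C : WinCoords P t l) : WindowMatrix p R t l where
  eT := mat C.T C.T LinearMap.id
  eL := mat C.L C.L LinearMap.id
  Ψ := C.Ψ
  Ψi := C.Ψi
  eT_mul := mat_id_mul _ _ _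
  eL_mul := mat_id_mul _ _ _
  e_mul_Ψ := by rw [← mat_π_id]; exact mat_id_mul _ _ _
  Ψ_mul_sig := by rw [← mat_twist_id]; exact mat_mul_id _ _ _
  sig_mul_Ψi := by rw [← mat_twist_id]; exact mat_id_mul _ _ _
  Ψi_mul_e := by rw [← mat_π_id]; exact mat_mul_id _ _ _
  Ψ_mul_Ψi := by rw [← mat_prod_id]; exact (Ψ_mul_Ψi C).trans (map_π _)
  Ψi_mul_Ψ := by rw [← mat_twist_id]; exact Ψi_mul_Ψ C

theorem matrix_e (C : WinCoords P t l) : C.matrix.e = mat C.sum C.sum LinearMap.id :=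
  (mat_prod_id _ _).symm

theorem isPre (C : WinCoords P t l) (D : WinCoords Q t' l') (f : Window.PreHom P Q) :
    WindowMatrix.IsPre C.matrix D.matrix (C.M D f) := by
  refine ⟨fun i j => ?_, ?_, ?_⟩
  · rw [M, mat_toLin, toBlocks_fromBlocks₁₂]
    exact mem_vIdeal_one.2 (filMat C D f i j).2
  · rw [matrix_e]; exact mat_id_mul _ _ _
  · rw [matrix_e]; exact mat_mul_id _ _ _

/-- Multiplying by `Ψ⁻¹` on the right turns compatibility into a fixed point equation; the
projections that appear are absorbed by the matrices of `f`. -/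
theorem comm_iff_Φ (C : WinCoords P t l) (D : WinCoords Q t' l') (f : Window.PreHom P Q) :
    (ExtScalars.map (wittFrame p R).π f.toLin).comp P.Ψ.toLinearMap =
      Q.Ψ.toLinearMap.comp f.sigma ↔
      WindowMatrix.Φ C.matrix D.matrix (C.M D f) = C.M D f := by
  rw [comm_iff C D, mat_sigma_eq_sig, map_π]
  change C.M D f * C.matrix.Ψ = D.matrix.Ψ * sig (C.M D f) ↔
    D.matrix.Ψ * sig (C.M D f) * C.matrix.Ψi = C.M D f
  constructor
  · intro h
    rw [← h, Matrix.mul_assoc, C.matrix.Ψ_mul_Ψi]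
    exact (isPre C D f).right
  · intro h
    conv_lhs => rw [← h]
    have h1 : sig (C.M D f) * sig (fromBlocks C.matrix.eT 0 0 C.matrix.eL) = sig (C.M D f) := by
      have h2 := sig_mul (isPre C D f).fil C.matrix.e_isFil
      rw [(isPre C D f).right] at h2
      exact h2.symm
    rw [Matrix.mul_assoc, C.matrix.Ψi_mul_Ψ, Matrix.mul_assoc, h1]

theorem isHom (C : WinCoords P t l) (D : WinCoords Q t' l') (f : Window.Hom P Q) :
    WindowMatrix.IsHom C.matrix D.matrix (C.M D f.toPreHom) :=
  ⟨isPre C D _, (comm_iff_Φ C D _).1 f.comm⟩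

theorem M_comp (C : WinCoords P t l) (D : WinCoords Q t' l') (E : WinCoords S t'' l'')
    (g : Window.PreHom Q S) (f : Window.PreHom P Q) :
    C.M E (g.comp f) = D.M E g * C.M D f := by
  rw [M, Window.PreHom.toLin_comp]
  exact mat_comp _ _ _ _ _

/-- Projective modules are flat. Hence the entry `L → I ⊗ T'` can be recovered from the matrix over
`W(R)`. -/
theorem act_injective (N : Type u) [AddCommGroup N] [Module (WittVector p R) N]
    [Module.Projective (WittVector p R) N] : Function.Injective ((wittFrame p R).act N) := by
  have h1 := Module.Flat.rTensor_preserves_injective_linearMap (M := N) (augIdeal p R).subtype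
    Subtype.val_injective
  have h2 : (wittFrame p R).act N = (TensorProduct.lid (WittVector p R) N).toLinearMap.comp
      ((augIdeal p R).subtype.rTensor N) := TensorProduct.ext' fun x y => by
    simp; rfl
  rw [h2]
  exact (TensorProduct.lid (WittVector p R) N).injective.comp h1

theorem preHom_ext {f g : Window.PreHom P Q} (h : f.toLin = g.toLin) : f = g := by
  have h1 : ∀ x, f.a x = g.a x ∧ f.c x = g.c x := fun x => by
    have := LinearMap.congr_fun h (x, 0)
    rw [Window.PreHom.toLin_apply, Window.PreHom.toLin_apply, Prod.mk.injEq] at this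
    simpa using this
  have h2 : ∀ x, (wittFrame p R).act Q.T (f.b x) = (wittFrame p R).act Q.T (g.b x) ∧
      f.d x = g.d x := fun x => by
    have := LinearMap.congr_fun h (0, x)
    rw [Window.PreHom.toLin_apply, Window.PreHom.toLin_apply, Prod.mk.injEq] at this
    simpa using this
  exact Window.PreHom.ext (LinearMap.ext fun x => (h1 x).1)
    (LinearMap.ext fun x => act_injective _ (h2 x).1) (LinearMap.ext fun x => (h1 x).2)
    (LinearMap.ext fun x => (h2 x).2)

theorem hom_ext_M (C : WinCoords P t l) (D : WinCoords Q t' l') {f g : Window.Hom P Q}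
    (h : C.M D f.toPreHom = C.M D g.toPreHom) : f = g := by
  have h1 := preHom_ext (mat_injective _ _ h)
  cases f; cases g; cases h1; rfl

theorem exists_preHom (C : WinCoords P t l) (D : WinCoords Q t' l')
    {u : Matrix (t' ⊕ l') (t ⊕ l) (WittVector p R)}
    (hu : WindowMatrix.IsPre C.matrix D.matrix u) : ∃ f : Window.PreHom P Q, C.M D f = u := by
  set b' : t' → P.L →ₗ[WittVector p R] augIdeal p R := fun i =>
    LinearMap.codRestrict (augIdeal p R)
      ((LinearMap.proj i).comp ((Matrix.toLin' u.toBlocks₁₂).comp C.L.s)) (fun y => by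
        rw [LinearMap.comp_apply, LinearMap.comp_apply, Matrix.toLin'_apply, LinearMap.proj_apply,
          Matrix.mulVec, dotProduct]
        refine sum_mem fun j _ => Ideal.mul_mem_right _ _ ?_
        exact mem_vIdeal_one.1 (hu.fil i j)) with hb'
  -- The upper right block as a map into `I ⊗ T'`: the `i`-th coordinate, which lies in `I_R`, is
  -- tensored with the `i`-th generator of `T'`.
  set b : P.L →ₗ[WittVector p R] augIdeal p R ⊗[WittVector p R] Q.T :=
    ∑ i, ((TensorProduct.mk (WittVector p R) (augIdeal p R) Q.T).flip
      (D.T.r (Pi.single i 1))).comp (b' i) with hb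
  have hact : ((wittFrame p R).act Q.T).comp b = ofMat C.L D.T u.toBlocks₁₂ := by
    ext y
    change (wittFrame p R).act Q.T (b y) = D.T.r (u.toBlocks₁₂ *ᵥ C.L.s y)
    rw [hb, LinearMap.sum_apply, map_sum, ← sum_smul_r]
    rfl
  set f : Window.PreHom P Q := ⟨ofMat C.T D.T u.toBlocks₁₁, b, ofMat C.T D.L u.toBlocks₂₁,
    ofMat C.L D.L u.toBlocks₂₂⟩ with hf
  refine ⟨f, ?_⟩
  have h1 : C.M D f = D.matrix.e * u * C.matrix.e := by
    rw [M, Window.PreHom.toLin, mat_prod]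
    conv_rhs => rw [← fromBlocks_toBlocks u]
    change fromBlocks (mat C.T D.T (ofMat _ _ _)) (mat C.L D.T (((wittFrame p R).act Q.T).comp b))
      (mat C.T D.L (ofMat _ _ _)) (mat C.L D.L (ofMat _ _ _)) = _
    rw [hact, mat_ofMat, mat_ofMat, mat_ofMat, mat_ofMat, WindowMatrix.e, WindowMatrix.e,
      fromBlocks_multiply, fromBlocks_multiply]
    simp only [Matrix.zero_mul, Matrix.mul_zero, add_zero, zero_add]
    rfl
  rw [h1, hu.left, hu.right]

theorem exists_hom (C : WinCoords P t l) (D : WinCoords Q t' l')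
    {u : Matrix (t' ⊕ l') (t ⊕ l) (WittVector p R)}
    (hu : WindowMatrix.IsHom C.matrix D.matrix u) :
    ∃ f : Window.Hom P Q, C.M D f.toPreHom = u := by
  obtain ⟨f, rfl⟩ := exists_preHom C D hu.toIsPre
  exact ⟨⟨f, (comm_iff_Φ C D f).2 hu.fixed⟩, rfl⟩

theorem frobIter_frobenius (e : ℕ) (x : WittVector p R) :
    Display.frobIter p R e (frobenius x) = frobenius (Display.frobIter p R e x) := by
  induction e generalizing x with
  | zero => rfl
  | succ e ih =>
    change Display.frobIter p R e (frobenius (frobenius x)) =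
      frobenius (Display.frobIter p R e (frobenius x))
    rw [ih]

theorem ext_comp_s {A A' A'' : Type*} [CommRing A] [CommRing A'] [CommRing A''] {N : Type*}
    [AddCommGroup N] [Module A N] (E : ModCoords A N l) (f : A →+* A') (g : A' →+* A'')
    (h : A →+* A'') (e : g.comp f = h) (x : ExtScalars g (ExtScalars f N)) :
    (E.ext h).s (ExtScalars.comp f g h e N x) = ((E.ext f).ext g).s x := by
  refine LinearMap.congr_fun (f := (E.ext h).s.comp (ExtScalars.comp f g h e N).toLinearMap)
    (g := ((E.ext f).ext g).s) (ExtScalars.hom_ext₂ fun x => ?_) x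
  ext i
  rw [LinearMap.comp_apply, LinearEquiv.coe_coe, ExtScalars.comp_of_of, ext_s_of, ext_s_of,
    ext_s_of, ← e, RingHom.comp_apply]

theorem mat_zBreve (C : WinCoords P t l) :
    mat C.L (C.L.ext frobenius) (Display.zBreve P) = C.matrix.Ψi.toBlocks₂₂ := by
  ext1 i j
  rw [mat_apply]
  change _ = C.Ψi (Sum.inr i) (Sum.inr j)
  rw [Ψi, mat_apply, ext_r_single, sum_r_inr]
  rfl

/-- Both sides are `F^{e-1}(z̆) ⋯ z̆`, but the left one grows by a factor on the left and `zeta` by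
a factor on the right; `hz` reconciles the two recursions. -/
theorem mat_zBreveIter (C : WinCoords P t l) (e : ℕ) :
    mat C.L (C.L.ext (Display.frobIter p R e)) (Display.zBreveIter P e) =
      zeta C.matrix.eL C.matrix.Ψi.toBlocks₂₂ e := by
  have h0 : C.matrix.Ψi.toBlocks₂₂ * C.matrix.eL = C.matrix.Ψi.toBlocks₂₂ := by
    have := congrArg toBlocks₂₂ C.matrix.Ψi_mul_e
    rw [(toBlocks_mul _ _).2.2.2] at this
    simpa using this
  have h0' : C.matrix.eL.map frobenius * C.matrix.Ψi.toBlocks₂₂ = C.matrix.Ψi.toBlocks₂₂ := by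
    have := congrArg toBlocks₂₂ C.matrix.sig_mul_Ψi
    rw [(toBlocks_mul _ _).2.2.2] at this
    simpa [sig, Matrix.map_zero WittVector.frobenius (map_zero WittVector.frobenius)] using this
  have hz : ∀ e, C.matrix.Ψi.toBlocks₂₂.map (Display.frobIter p R e) *
      zeta C.matrix.eL C.matrix.Ψi.toBlocks₂₂ e =
        zeta C.matrix.eL C.matrix.Ψi.toBlocks₂₂ (e + 1) := by
    intro e
    induction e with
    | zero =>
      change C.matrix.Ψi.toBlocks₂₂ * C.matrix.eL = C.matrix.eL.map frobenius * _
      rw [h0, h0']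
    | succ e ih =>
      have h1 : C.matrix.Ψi.toBlocks₂₂.map (Display.frobIter p R (e + 1)) =
          (C.matrix.Ψi.toBlocks₂₂.map (Display.frobIter p R e)).map frobenius := by
        ext1 i j
        exact frobIter_frobenius e _
      rw [h1]
      conv_lhs => rw [zeta]
      rw [← Matrix.mul_assoc, ← matrix_map_mul, ih, ← zeta]
  induction e with
  | zero =>
    ext1 i j
    rw [mat_apply]
    exact ext_s_of (RingHom.id _) C.L (C.L.r (Pi.single j 1)) i
  | succ e ih =>
    rw [← hz, ← ih, ← mat_zBreve, ← mat_ext, ← mat_comp]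
    ext1 i j
    rw [mat_apply, mat_apply]
    exact congrFun (ext_comp_s _ _ _ _ rfl _) i

theorem isResidual_of_residueMap {x : WittVector p R} (hx : Display.residueMap p R x = 0) :
    IsResidual x := by
  have h1 : x.coeff 0 ∈ Ideal.span {(p : R)} := Ideal.Quotient.eq_zero_iff_mem.1 hx
  obtain ⟨b, hb⟩ := Ideal.mem_span_singleton'.1 h1
  -- With `x₀ = b p`, the difference `x - p [b]` has zeroth coefficient zero, so it lies in the
  -- image of `V`.
  refine ⟨teichmuller p b, vinv (x - p * teichmuller p b), ?_⟩
  rw [verschiebung_vinv, add_sub_cancel]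
  rw [coeff_zero_sub, coeff_zero_mul, coeff_zero_natCast, teichmuller_coeff_zero, ← hb, mul_comm,
    sub_self]

theorem isNilpotentOfOrder (C : WinCoords P t l) {e : ℕ} (h : P.NilpotentOfOrderLE e) :
    C.matrix.IsNilpotentOfOrder e := by
  intro i j
  refine isResidual_of_residueMap ?_
  rw [← mat_zBreveIter]
  have h1 := mat_ext (Display.residueMap p R) C.L (C.L.ext (Display.frobIter p R e))
    (Display.zBreveIter P e)
  rw [h, mat_zero] at h1
  exact (congrFun₂ h1 i j).symm

/-! #### Truncations -/

theorem entriesIn_of_map_truncate {m n : Type*} {k : ℕ} {u : Matrix m n (WittVector p R)}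
    (h : u.map (WittVector.truncate (p := p) (R := R) k) = 0) : EntriesIn (vIdeal p R k) u :=
  fun i j => mem_vIdeal.2 (truncate_eq_zero_iff.1 (congrFun₂ h i j))

theorem truncFrameMap_fil_surjective (n : ℕ) :
    Function.Surjective (truncFrameMap p R n).fil := by
  rintro ⟨x, hx⟩
  obtain ⟨z, rfl⟩ := exists_of_mem_truncAugIdeal hx
  exact ⟨⟨verschiebung z, verschiebung_mem_augIdeal z⟩, rfl⟩

theorem truncFrameMap_ring_surjective (n : ℕ) :
    Function.Surjective (truncFrameMap p R n).ring :=
  Ideal.Quotient.mk_surjective.comp (WittVector.truncate_surjective p (n + 1) R)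

theorem truncFrameMap_π_ring (n : ℕ) (x : WittVector p R) :
    (truncWittFrame p R n).π ((truncFrameMap p R n).ring x) = WittVector.truncate n x :=
  RingHom.congr_fun (truncFrameMap p R n).π_ring x

theorem matrix_e_map {S : Frame.{u} p} (α : Frame.Hom (wittFrame p R) S) (C : WinCoords P t l) :
    C.matrix.e.map α.ring = mat (C.baseChange α).sum (C.baseChange α).sum LinearMap.id := by
  rw [mat_prod_id, WindowMatrix.e, fromBlocks_map_diag]
  change fromBlocks ((mat C.T C.T LinearMap.id).map α.ring) 0 0
    ((mat C.L C.L LinearMap.id).map α.ring) = fromBlocks (mat (C.T.ext α.ring) (C.T.ext α.ring)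
      LinearMap.id) 0 0 (mat (C.L.ext α.ring) (C.L.ext α.ring) LinearMap.id)
  rw [← mat_ext, ← mat_ext, ExtScalars.map_id, ExtScalars.map_id]

/-- Morphisms of truncated displays lift to matrices that are approximately fixed. -/
theorem exists_isPre_of_truncate (C : WinCoords P t l) (D : WinCoords Q t' l') {n : ℕ}
    (f : Window.Hom (Display.truncate n P) (Display.truncate n Q)) :
    ∃ u, WindowMatrix.IsPre C.matrix D.matrix u ∧
      EntriesIn (vIdeal p R n) (u - WindowMatrix.Φ C.matrix D.matrix u) ∧
      u.map (truncFrameMap p R n).ring = mat (C.baseChange (truncFrameMap p R n)).sum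
        (D.baseChange (truncFrameMap p R n)).sum f.toLin := by
  set α := truncFrameMap p R n with hα
  set C' := C.baseChange α with hC'
  set D' := D.baseChange α with hD'
  have hr := truncFrameMap_ring_surjective (p := p) (R := R) n
  choose a ha using fun i j => hr (mat C'.T D'.T f.a i j)
  -- The upper right entries are lifted within `I_R`, so that `V⁻¹` of the lift reduces to the
  -- divided Frobenius of the truncated entry.
  choose b hb using fun i j => truncFrameMap_fil_surjective n (filMat C' D' f.toPreHom i j)
  choose c hc using fun i j => hr (mat C'.T D'.L f.c i j)
  choose d hd using fun i j => hr (mat C'.L D'.L f.d i j)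
  set v : Matrix (t' ⊕ l') (t ⊕ l) (WittVector p R) :=
    fromBlocks (of a) (of fun i j => (b i j : WittVector p R)) (of c) (of d) with hv
  have hvfil : IsFil v := fun i j => mem_vIdeal_one.2 (b i j).2
  have hv1 : v.map α.ring = mat C'.sum D'.sum f.toLin := by
    rw [mat_toLin, hv, fromBlocks_map]
    refine fromBlocks_congr ?_ ?_ ?_ ?_
    · ext i j; exact ha i j
    · ext i j
      rw [Matrix.map_apply, Matrix.map_apply, ← hb i j]
      rfl
    · ext i j; exact hc i j
    · ext i j; exact hd i j
  have hσ : ∀ x, WittVector.truncate n (frobenius x) =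
      (truncWittFrame p R n).σ (α.ring x) := fun x =>
    (RingHom.congr_fun α.σ_ring x).symm
  have hv2 : (sig v).map (WittVector.truncate n) = mat C'.twist D'.twist f.sigma := by
    rw [mat_sigma, sig, fromBlocks_map]
    refine fromBlocks_congr ?_ ?_ ?_ ?_
    · ext1 i j
      rw [Matrix.map_apply, Matrix.map_apply, Matrix.map_apply, hσ]
      exact congrArg _ (ha i j)
    · ext1 i j
      rw [Matrix.map_apply, Matrix.map_apply, Matrix.map_apply, ← hb i j]
      exact (α.σdiv_fil (b i j)).symm
    · ext1 i j
      rw [Matrix.map_apply, Matrix.smul_apply, Matrix.smul_apply, smul_eq_mul, smul_eq_mul,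
        _root_.map_mul, map_natCast, Matrix.map_apply, Matrix.map_apply, hσ]
      exact congrArg _ (congrArg _ (hc i j))
    · ext1 i j
      rw [Matrix.map_apply, Matrix.map_apply, Matrix.map_apply, hσ]
      exact congrArg _ (hd i j)
  -- The entrywise lift need not respect the summands. The projection does not change its
  -- truncation.
  set u := D.matrix.e * v * C.matrix.e with hu
  have hup : WindowMatrix.IsPre C.matrix D.matrix u := by
    refine ⟨(D.matrix.e_isFil.mul hvfil).mul C.matrix.e_isFil, ?_, ?_⟩
    · rw [hu, ← Matrix.mul_assoc, ← Matrix.mul_assoc, D.matrix.e_mul_e]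
    · rw [hu, Matrix.mul_assoc, C.matrix.e_mul_e]
  have hu1 : u.map α.ring = mat C'.sum D'.sum f.toLin := by
    rw [hu, matrix_map_mul, matrix_map_mul, hv1, matrix_e_map, matrix_e_map, mat_id_mul,
      mat_mul_id]
  refine ⟨u, hup, entriesIn_of_map_truncate ?_, hu1⟩
  have hΦ : WindowMatrix.Φ C.matrix D.matrix u = D.Ψ * sig v * C.Ψi := by
    rw [WindowMatrix.Φ, phi, hu, sig_mul (D.matrix.e_isFil.mul hvfil) C.matrix.e_isFil,
      sig_mul D.matrix.e_isFil hvfil]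
    calc _ = D.matrix.Ψ * sig D.matrix.e * sig v * (sig C.matrix.e * C.matrix.Ψi) := by
          simp only [Matrix.mul_assoc]
      _ = D.matrix.Ψ * sig v * C.matrix.Ψi := by
          rw [WindowMatrix.e, WindowMatrix.e, D.matrix.Ψ_mul_sig, C.matrix.sig_mul_Ψi]
      _ = _ := rfl
  have hut : u.map (WittVector.truncate n) =
      (mat C'.sum D'.sum f.toLin).map (truncWittFrame p R n).π := by
    rw [← hu1]
    ext1 i j
    exact (truncFrameMap_π_ring n _).symm
  -- The compatibility of the truncated morphism is an equation over `W_n(R)`, which explains the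
  -- depth `n`.
  have hcomm := (comm_iff C' D' f.toPreHom).1 f.comm
  rw [← hut, ← hv2, hC', hD', Ψ_baseChange, Ψ_baseChange] at hcomm
  change u.map (WittVector.truncate n) * C.Ψ.map (WittVector.truncate n) =
    D.Ψ.map (WittVector.truncate n) * (sig v).map (WittVector.truncate n) at hcomm
  have hee : C.Ψ * C.Ψi = C.matrix.e := C.matrix.Ψ_mul_Ψi
  rw [Matrix.map_sub _ (_root_.map_sub (WittVector.truncate n)), hΦ,
    matrix_map_mul _ (D.Ψ * sig v), matrix_map_mul _ D.Ψ, ← hcomm, ← matrix_map_mul,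
        ← matrix_map_mul, Matrix.mul_assoc, hee, hup.right,
    sub_self]

end WinCoords

end DisplayCoordinates


/-! ### Divisibility of the top exterior power in terms of minors. -/

section TopExteriorPower

open Matrix ModCoords

variable {A : Type*} [CommRing A] {N N' : Type*} [AddCommGroup N] [Module A N]
  [AddCommGroup N'] [Module A N'] {n : ℕ}

theorem alternatingMap_eq_det_smul (b : Module.Basis (Fin n) A N) (f : N [⋀^Fin n]→ₗ[A] N')
    (v : Fin n → N) : f v = b.det v • f b := by
  have h : f = (LinearMap.toSpanSingleton A N' (f b)).compAlternatingMap b.det := by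
    refine b.ext_alternating fun i hi => ?_
    obtain ⟨σ, rfl⟩ : ∃ σ : Equiv.Perm (Fin n), i = σ :=
      ⟨Equiv.ofBijective i (Finite.injective_iff_bijective.1 hi), rfl⟩
    have h1 : (fun j => b (σ j)) = b ∘ σ := rfl
    rw [h1, AlternatingMap.map_perm, AlternatingMap.map_perm]
    simp [b.det_self]
  conv_lhs => rw [h]
  rfl

/-- On top exterior powers the map is multiplication by the determinant. Evaluating `b'.det` on the
image of the wedge of `b` extracts it; conversely, a quotient of the determinant scales the map that
sends `b` to `b'`. -/
theorem exteriorPower_map_eq_smul_iff (b : Module.Basis (Fin n) A N)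
    (b' : Module.Basis (Fin n) A N') (φ : N →ₗ[A] N') (x : A) :
    (∃ ψ, exteriorPower.map n φ = x • ψ) ↔ x ∣ b'.det (φ ∘ b) := by
  constructor
  · rintro ⟨ψ, h⟩
    have h1 := congrArg (fun f => exteriorPower.alternatingMapLinearEquiv b'.det
      (f (exteriorPower.ιMulti A n b))) h
    simp only [exteriorPower.map_apply_ιMulti, LinearMap.smul_apply, _root_.map_smul,
      exteriorPower.alternatingMapLinearEquiv_apply_ιMulti] at h1
    exact ⟨_, h1⟩
  · rintro ⟨y, h⟩
    refine ⟨y • exteriorPower.map n (b.equiv b' (Equiv.refl _)).toLinearMap,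
      exteriorPower.linearMap_ext (AlternatingMap.ext fun v => ?_)⟩
    refine (alternatingMap_eq_det_smul b _ v).trans (Eq.trans (congrArg _ ?_)
      (alternatingMap_eq_det_smul b _ v).symm)
    have h2 : ((b.equiv b' (Equiv.refl _)).toLinearMap : N → N') ∘ b = b' := by
      ext i; simp
    change exteriorPower.map n φ (exteriorPower.ιMulti A n b) =
      x • y • exteriorPower.map n _ (exteriorPower.ιMulti A n b)
    rw [exteriorPower.map_apply_ιMulti, exteriorPower.map_apply_ιMulti, h2]
    rw [alternatingMap_eq_det_smul b', h, mul_smul]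

variable {t t' : Type*} [Fintype t] [DecidableEq t] [Fintype t'] [DecidableEq t']

/-- The coordinates given by a basis. -/
def basisCoords {H : Type*} [Fintype H] (b : Module.Basis H A N) : ModCoords A N H where
  s := b.equivFun
  r := b.equivFun.symm
  r_s := b.equivFun.symm_apply_apply

theorem mat_basisCoords {H H' : Type*} [Fintype H] [Fintype H'] [DecidableEq H] [DecidableEq H']
    (b : Module.Basis H A N) (b' : Module.Basis H' A N') (φ : N →ₗ[A] N') :
    mat (basisCoords b) (basisCoords b') φ = LinearMap.toMatrix b b' φ := by
  ext i j
  rw [mat_apply, LinearMap.toMatrix_apply]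
  simp [basisCoords]

theorem mat_basisCoords_id {H : Type*} [Fintype H] [DecidableEq H]
    (b : Module.Basis H A N) : mat (basisCoords b) (basisCoords b) LinearMap.id = 1 := by
  rw [mat_basisCoords, LinearMap.toMatrix_id]

theorem splitRank_of_basis {H : Type*} [Fintype H] [DecidableEq H]
    (b : Module.Basis H A N) (C : ModCoords A N t) : SplitRank (mat C C LinearMap.id) H :=
  ⟨mat (basisCoords b) C LinearMap.id, mat C (basisCoords b) LinearMap.id,
    by rw [← mat_comp, LinearMap.comp_id], by
      rw [← mat_comp, LinearMap.comp_id, mat_basisCoords_id]⟩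

theorem mat_eq_basis_mul {H H' : Type*} [Fintype H] [Fintype H'] [DecidableEq H] [DecidableEq H']
    (b : Module.Basis H A N) (b' : Module.Basis H' A N') (C : ModCoords A N t)
    (C' : ModCoords A N' t') (φ : N →ₗ[A] N') :
    mat C C' φ = mat (basisCoords b') C' LinearMap.id * LinearMap.toMatrix b b' φ *
      mat C (basisCoords b) LinearMap.id := by
  rw [← mat_basisCoords, ← mat_comp, ← mat_comp, LinearMap.id_comp, LinearMap.comp_id]

theorem toMatrix_eq_mat_mul {H H' : Type*} [Fintype H] [Fintype H'] [DecidableEq H]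
    [DecidableEq H'] (b : Module.Basis H A N) (b' : Module.Basis H' A N') (C : ModCoords A N t)
    (C' : ModCoords A N' t') (φ : N →ₗ[A] N') :
    LinearMap.toMatrix b b' φ = mat C' (basisCoords b') LinearMap.id * mat C C' φ *
      mat (basisCoords b) C LinearMap.id := by
  rw [← mat_basisCoords, ← mat_comp, ← mat_comp, LinearMap.id_comp, LinearMap.comp_id]

/-- The matrix in bases and the matrix in redundant coordinates factor through each other, so `x`
divides the determinant exactly when it divides all minors of that size. -/
theorem exteriorPower_map_eq_smul_iff_minors {H : Type*} [Fintype H] [DecidableEq H]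
    (e : Fin n ≃ H) (b : Module.Basis (Fin n) A N) (b' : Module.Basis (Fin n) A N')
    (C : ModCoords A N t) (C' : ModCoords A N' t') (φ : N →ₗ[A] N') (x : A) :
    (∃ ψ, exteriorPower.map n φ = x • ψ) ↔
      ∀ (I : H → t') (J : H → t), x ∣ ((mat C C' φ).submatrix I J).det := by
  rw [exteriorPower_map_eq_smul_iff b b']
  have h1 : b'.det (φ ∘ b) = (LinearMap.toMatrix b b' φ).det := by
    rw [Module.Basis.det_apply]
    congr 1
    ext i j
    rw [Module.Basis.toMatrix_apply, LinearMap.toMatrix_apply, Function.comp_apply]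
  rw [h1]
  constructor
  · intro h I J
    rw [mat_eq_basis_mul b b' C C', submatrix_mul _ _ I id J Function.bijective_id,
      submatrix_mul _ _ I id id Function.bijective_id, ← det_submatrix_equiv_self e,
      submatrix_mul _ _ _ id _ Function.bijective_id,
      submatrix_mul _ _ _ id _ Function.bijective_id, det_mul, det_mul]
    simp only [submatrix_submatrix, Function.comp_id, submatrix_id_id]
    exact Dvd.dvd.mul_right (Dvd.dvd.mul_left h _) _
  · intro h
    rw [← Ideal.mem_span_singleton, toMatrix_eq_mat_mul b b' C C']
    have h2 : minorIdeal (Fin n) (mat C C' φ) ≤ Ideal.span {x} := by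
      rw [minorIdeal, Ideal.span_le]
      rintro _ ⟨⟨I, J⟩, rfl⟩
      have h3 := h (I ∘ e.symm) (J ∘ e.symm)
      rw [← det_submatrix_equiv_self e, submatrix_submatrix] at h3
      simp only [Function.comp_assoc, Equiv.symm_comp_self, Function.comp_id] at h3
      exact Ideal.mem_span_singleton.2 h3
    exact h2 (minorIdeal_mul_le _ _ _ (by
      simpa using minor_mem (H := Fin n) (mat C' (basisCoords b') LinearMap.id * mat C C' φ *
        mat (basisCoords b) C LinearMap.id) id id))

/-- Over a local ring the base change is free, and its rank is read off at the closed point. It is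
used for localizations and for `W(k)`. -/
theorem exists_basis_extScalars {B : Type*} [CommRing B] [IsLocalRing B] (f : A →+* B)
    [Module.Finite A N] [Module.Projective A N]
    (h : ∀ q, Module.rankAtStalk (R := A) N q = n) :
    Nonempty (Module.Basis (Fin n) B (ExtScalars f N)) := by
  let _ := f.toAlgebra
  have : Module.Free B (B ⊗[A] N) := Module.free_of_flat_of_isLocalRing
  have h1 : Module.finrank B (B ⊗[A] N) = n := by
    have := Module.rankAtStalk_baseChange (R := A) (M := N) (IsLocalRing.closedPoint B)
    rw [h, Module.rankAtStalk_eq_finrank_of_free] at this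
    exact this
  exact ⟨(Module.finBasisOfFinrankEq B (B ⊗[A] N) h1 :)⟩

theorem locRank_mat [Module.Finite A N] [Module.Projective A N] (C : ModCoords A N t)
    (h : ∀ q, Module.rankAtStalk (R := A) N q = n) : LocRank (mat C C LinearMap.id) n := by
  intro q hq
  obtain ⟨b⟩ := exists_basis_extScalars (algebraMap A (Localization.AtPrime q)) h
  rw [← mat_ext, ExtScalars.map_id]
  exact splitRank_of_basis b _

end TopExteriorPower


/-! ### Valuations of determinants at geometric points, and isomorphisms. -/

section GeometricPoints

open WittVector Matrix ModCoords

variable {p : ℕ} [hp : Fact p.Prime] {R : Type u} [CommRing R]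

theorem geomPoint_eq_zero_iff (x : PrimeSpectrum R) (r : R) :
    Display.geomPoint x r = 0 ↔ r ∈ x.asIdeal := by
  rw [Display.geomPoint, IsScalarTower.algebraMap_apply R x.asIdeal.ResidueField,
    map_eq_zero_iff _ (algebraMap x.asIdeal.ResidueField _).injective,
    Ideal.algebraMap_residueField_eq_zero]

theorem charP_geomPoint {a : ℕ} (ha : (p : R) ^ a = 0) (x : PrimeSpectrum R) :
    CharP (AlgebraicClosure x.asIdeal.ResidueField) p := by
  refine (CharP.charP_iff_prime_eq_zero hp.out).2 ?_
  rw [← map_natCast (Display.geomPoint x), geomPoint_eq_zero_iff]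
  exact x.2.mem_of_pow_mem a (by rw [ha]; exact x.asIdeal.zero_mem)

/-- The admissible exponents are closed downwards, so a finite supremum is attained and its
successor is not admissible. -/
theorem exists_eq_smul_of_iSup_eq {A M N : Type*} [CommRing A] [AddCommGroup M] [Module A M]
    [AddCommGroup N] [Module A N] (z : A) (u : M →ₗ[A] N) {m : ℕ} (h : (⨆ (j : ℕ)
        (_ : ∃ ψ : M →ₗ[A] N, u = z ^ j • ψ), (j : ℕ∞)) = m) :
    (∃ ψ : M →ₗ[A] N, u = z ^ m • ψ) ∧ ¬ ∃ ψ : M →ₗ[A] N, u = z ^ (m + 1) • ψ := by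
  constructor
  · by_contra hm
    have h1 : ∀ j : ℕ, (∃ ψ : M →ₗ[A] N, u = z ^ j • ψ) → j < m := by
      rintro j ⟨ψ, hψ⟩
      by_contra hj
      exact hm ⟨z ^ (j - m) • ψ, by
        rw [hψ, smul_smul, ← pow_add, Nat.add_sub_cancel' (not_lt.1 hj)]⟩
    -- The exponent `0` is always admissible, so `m` is positive and `m - 1` is an honest
    -- predecessor.
    have h2 := h1 0 ⟨u, by rw [pow_zero, one_smul]⟩
    have h3 : (⨆ (j : ℕ) (_ : ∃ ψ : M →ₗ[A] N, u = z ^ j • ψ), (j : ℕ∞)) ≤ ((m - 1 : ℕ) : ℕ∞) :=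
      iSup₂_le fun j hj => by exact_mod_cast Nat.le_sub_one_of_lt (h1 j hj)
    rw [h] at h3
    have : m ≤ m - 1 := by exact_mod_cast h3
    omega
  · intro hm
    have h3 : ((m + 1 : ℕ) : ℕ∞) ≤ (⨆ (j : ℕ) (_ : ∃ ψ : M →ₗ[A] N, u = z ^ j • ψ), (j : ℕ∞)) :=
      le_iSup₂_of_le (m + 1) hm le_rfl
    rw [h] at h3
    have : m + 1 ≤ m := by exact_mod_cast h3
    omega

theorem comp_eq_pow_succ_smul {A M N K : Type*} [CommRing A] [AddCommGroup M] [Module A M]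
    [AddCommGroup N] [Module A N] [AddCommGroup K] [Module A K] {z : A} {m : ℕ} {u ψ : M →ₗ[A] N}
    {v χ : N →ₗ[A] K} (hu : u = z ^ 1 • ψ) (hv : v = z ^ m • χ) :
    v.comp u = z ^ (m + 1) • χ.comp ψ := by
  rw [hu, hv, LinearMap.smul_comp, LinearMap.comp_smul, smul_smul, pow_one, pow_succ]

theorem span_eq_top_of_forall_prime {ι : Type*} {v : ι → R}
    (h : ∀ x : PrimeSpectrum R, ∃ i, v i ∉ x.asIdeal) : Ideal.span (Set.range v) = ⊤ := by
  by_contra hne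
  obtain ⟨m, hm, hle⟩ := Ideal.exists_le_maximal _ hne
  obtain ⟨i, hi⟩ := h ⟨m, hm.isPrime⟩
  exact hi (hle (Ideal.subset_span ⟨i, rfl⟩))

namespace WinCoords

variable {P Q S : Display p R} {t l t' l' t'' l'' : Type*} [Fintype t] [DecidableEq t] [Fintype l]
  [DecidableEq l] [Fintype t'] [DecidableEq t'] [Fintype l'] [DecidableEq l']
  [Fintype t''] [DecidableEq t''] [Fintype l''] [DecidableEq l'']

theorem hasRanks (C : WinCoords P t l) {d c : ℕ} (h : P.HasDimCodim d c) :
    C.matrix.HasRanks d c :=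
  ⟨locRank_mat C.T h.1, locRank_mat C.L h.2⟩

/-- Since `k` is perfect of characteristic `p`, divisibility by `p^j` in `W(k)` is the vanishing of
the first `j` coefficients. The kernel of `R → k` is the prime `x`. -/
theorem detAt_eq_smul_iff {a : ℕ} (ha : (p : R) ^ a = 0) (C : WinCoords P t l)
    (D : WinCoords Q t' l') {d c : ℕ} (hP : P.HasDimCodim d c) (hQ : Q.HasDimCodim d c)
    (g : Window.Hom P Q) (x : PrimeSpectrum R) (j : ℕ) :
    (∃ ψ, Display.detAt g (d + c) x =
      (p : WittVector p (AlgebraicClosure x.asIdeal.ResidueField)) ^ j • ψ) ↔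
      ∀ (I : Fin d ⊕ Fin c → t' ⊕ l') (J : Fin d ⊕ Fin c → t ⊕ l), ∀ i < j,
        ((C.M D g.toPreHom).submatrix I J).det.coeff i ∈ x.asIdeal := by
  have := charP_geomPoint ha x
  have hP' : ∀ q, Module.rankAtStalk (R := WittVector p R) (P.T × P.L) q = d + c := fun q => by
    rw [Module.rankAtStalk_prod, Pi.add_apply, hP.1, hP.2]
  have hQ' : ∀ q, Module.rankAtStalk (R := WittVector p R) (Q.T × Q.L) q = d + c := fun q => by
    rw [Module.rankAtStalk_prod, Pi.add_apply, hQ.1, hQ.2]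
  obtain ⟨b⟩ := exists_basis_extScalars (WittVector.map (p := p) (Display.geomPoint x)) hP'
  obtain ⟨b'⟩ := exists_basis_extScalars (WittVector.map (p := p) (Display.geomPoint x)) hQ'
  rw [Display.detAt, exteriorPower_map_eq_smul_iff_minors finSumFinEquiv.symm b b'
    (C.sum.ext (WittVector.map (p := p) (Display.geomPoint x)))
    (D.sum.ext (WittVector.map (p := p) (Display.geomPoint x))), mat_ext]
  refine forall_congr' fun I => forall_congr' fun J => ?_
  rw [← Ideal.mem_span_singleton, mem_span_p_pow_iff_le_coeff_eq_zero,
    submatrix_map, ← RingHom.mapMatrix_apply, ← RingHom.map_det]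
  refine forall_congr' fun i => forall_congr' fun _ => ?_
  rw [map_coeff, geomPoint_eq_zero_iff]

theorem detVal_dvd {g : Window.Hom P Q} {h m : ℕ} {x : PrimeSpectrum R}
    (hg : Display.detVal g h x = m) : ∃ ψ, Display.detAt g h x =
      (p : WittVector p (AlgebraicClosure x.asIdeal.ResidueField)) ^ m • ψ :=
  (exists_eq_smul_of_iSup_eq _ (Display.detAt g h x) hg).1

theorem detVal_not_dvd {g : Window.Hom P Q} {h m : ℕ} {x : PrimeSpectrum R}
    (hg : Display.detVal g h x = m) : ¬ ∃ ψ, Display.detAt g h x =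
      (p : WittVector p (AlgebraicClosure x.asIdeal.ResidueField)) ^ (m + 1) • ψ :=
  (exists_eq_smul_of_iSup_eq _ (Display.detAt g h x) hg).2

theorem detAt_comp (g : Window.Hom Q S) (f : Window.Hom P Q) (h : ℕ) (x : PrimeSpectrum R) :
    Display.detAt (g.comp f) h x = (Display.detAt g h x).comp (Display.detAt f h x) := by
  have h1 : (g.comp f).toLin = g.toLin.comp f.toLin :=
    Window.PreHom.toLin_comp g.toPreHom f.toPreHom
  rw [Display.detAt, h1, ExtScalars.map_comp]
  exact exteriorPower.map_comp _ _

/-- The minors of an isogeny of height `m` generate an ideal that contains a power of `p`. -/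
theorem p_pow_mem_minorIdeal {a : ℕ} (ha : (p : R) ^ a = 0) (C : WinCoords P t l)
    (D : WinCoords Q t' l') {d c : ℕ} (hP : P.HasDimCodim d c) (hQ : Q.HasDimCodim d c)
    {g : Window.Hom P Q} {m : ℕ} (hg : ∀ x, Display.detVal g (d + c) x = m) :
    (p : WittVector p R) ^ (a * (m + c)) ∈
      minorIdeal (Fin d ⊕ Fin c) (C.M D g.toPreHom) := by
  -- Valuation at least `m` everywhere makes the lower coefficients nilpotent. If all `m`-th
  -- coefficients vanished at some point, the valuation there would exceed `m`.
  refine (isHom C D g).p_pow_mem_minorIdeal ha (C.hasRanks hP) (D.hasRanks hQ)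
    (fun I J k hk => ?_) (span_eq_top_of_forall_prime fun x => ?_)
  · rw [nilpotent_iff_mem_prime]
    exact fun q hq => (detAt_eq_smul_iff ha C D hP hQ g ⟨q, hq⟩ m).1 (detVal_dvd (hg _)) I J k hk
  · by_contra! hx
    refine detVal_not_dvd (hg x) ((detAt_eq_smul_iff ha C D hP hQ g x (m + 1)).2
      fun I J i hi => ?_)
    rcases Nat.lt_succ_iff_lt_or_eq.1 hi with hi | rfl
    · exact (detAt_eq_smul_iff ha C D hP hQ g x m).1 (detVal_dvd (hg _)) I J i hi
    · exact hx (I, J)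

/-- If `p` divided `det f` at a point, then `p^{m+1}` would divide `det g = det g' · det f` there.
So the zeroth coefficients of the minors of `f` generate the unit ideal, and then so do the minors.
-/
theorem isIso_of_comp_eq {a : ℕ} (ha : (p : R) ^ a = 0) {d c : ℕ} (hP : P.HasDimCodim d c)
    (hQ : Q.HasDimCodim d c) {g : Window.Hom P S} {g' : Window.Hom Q S}
    {m : ℕ} (hg : ∀ x, Display.detVal g (d + c) x = m)
    (hg' : ∀ x, Display.detVal g' (d + c) x = m) {f : Window.Hom P Q} (h : g'.comp f = g) :
    f.IsIso := by
  obtain ⟨_, _, ⟨C⟩⟩ := WinCoords.exists_winCoords P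
  obtain ⟨_, _, ⟨D⟩⟩ := WinCoords.exists_winCoords Q
  have hu : Ideal.span (Set.range fun q : (Fin d ⊕ Fin c → _) × (Fin d ⊕ Fin c → _) =>
      ((C.M D f.toPreHom).submatrix q.1 q.2).det.coeff 0) = ⊤ := by
    refine span_eq_top_of_forall_prime fun x => ?_
    by_contra! hx
    obtain ⟨ψ, hψ⟩ := (detAt_eq_smul_iff ha C D hP hQ f x 1).2 fun I J i hi => by
      rw [Nat.lt_one_iff.1 hi]
      exact hx (I, J)
    obtain ⟨χ, hχ⟩ := detVal_dvd (hg' x)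
    refine detVal_not_dvd (hg x) ⟨χ.comp ψ, ?_⟩
    rw [← h, detAt_comp]
    exact comp_eq_pow_succ_smul hψ hχ
  have h1 := span_range_eq_top_of_coeff_zero (fun x => isUnit_of_coeff_zero ha) hu
  obtain ⟨G, hG, hGu, huG⟩ := (isHom C D f).exists_inverse (C.hasRanks hP) (D.hasRanks hQ)
    ((Ideal.eq_top_iff_one _).1 h1)
  obtain ⟨f', rfl⟩ := exists_hom D C hG
  refine ⟨f', hom_ext_M C C ?_, hom_ext_M D D ?_⟩
  · exact (M_comp C D C _ _).trans (hGu.trans ((matrix_e C).trans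
      (congrArg _ (Window.PreHom.toLin_id P).symm)))
  · exact (M_comp D C D _ _).trans (huG.trans ((matrix_e D).trans
      (congrArg _ (Window.PreHom.toLin_id Q).symm)))

end WinCoords

end GeometricPoints


/-! ### Comparison of the codimension over `R` with that over the perfect field. -/

section Codimension

open WittVector

theorem rankAtStalk_extScalars {A B : Type*} [CommRing A] [CommRing B] (f : A →+* B) {M : Type*}
    [AddCommGroup M] [Module A M] [Module.Finite A M] [Module.Projective A M]
    (q : PrimeSpectrum B) :
    Module.rankAtStalk (R := B) (ExtScalars f M) q =
      Module.rankAtStalk (R := A) M (PrimeSpectrum.comap f q) := by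
  let _ := f.toAlgebra
  exact Module.rankAtStalk_baseChange q

variable {p : ℕ} [hp : Fact p.Prime] {R : Type u} [CommRing R]

theorem of_constantCoeff_act {N : Type u} [AddCommGroup N] [Module (WittVector p R) N]
    (z : augIdeal p R ⊗[WittVector p R] N) :
    ExtScalars.of (constantCoeff : WittVector p R →+* R) ((wittFrame p R).act N z) = 0 := by
  induction z using TensorProduct.induction_on with
  | zero => rw [map_zero, map_zero]
  | tmul i x =>
    have h : (wittFrame p R).act N (i ⊗ₜ x) = (i : WittVector p R) • x := rfl
    have h0 : (constantCoeff : WittVector p R →+* R) (i : WittVector p R) = 0 :=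
      mem_augIdeal.1 i.2
    rw [h, LinearMap.map_smulₛₗ, h0, zero_smul]
  | add z w hz hw => rw [map_add, map_add, hz, hw, add_zero]

/-- The upper right entries die modulo `I_R`, so the lower right entry is multiplicative there.
Hence isomorphic displays have isomorphic `L / I_R L`. -/
theorem constantCoeff_d_comp {P Q : Display p R} {f : Window.Hom P Q} {g : Window.Hom Q P}
    (h : g.comp f = Window.Hom.id P) :
    (ExtScalars.map (constantCoeff : WittVector p R →+* R) g.d).comp
      (ExtScalars.map (constantCoeff : WittVector p R →+* R) f.d) = LinearMap.id := by
  refine ExtScalars.hom_ext fun x => ?_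
  have h1 : (g.comp f).d x = x := by rw [h]; rfl
  have h2 : (g.comp f).d x = g.c ((wittFrame p R).act Q.T (f.b x)) + g.d (f.d x) := rfl
  rw [h2] at h1
  have h3 := congrArg (ExtScalars.of (constantCoeff : WittVector p R →+* R)) h1
  rw [map_add, ← ExtScalars.map_of (constantCoeff : WittVector p R →+* R) g.c] at h3
  rw [LinearMap.comp_apply, ExtScalars.map_of, ExtScalars.map_of, LinearMap.id_apply]
  refine Eq.trans ?_ h3
  rw [of_constantCoeff_act, map_zero, zero_add]

theorem rankAtStalk_L_eq_of_isIso {P Q : Display p R} {i : Window.Hom P Q} (hi : i.IsIso)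
    (q : PrimeSpectrum R) :
    Module.rankAtStalk (R := WittVector p R) P.L (PrimeSpectrum.comap constantCoeff q) =
      Module.rankAtStalk (R := WittVector p R) Q.L (PrimeSpectrum.comap constantCoeff q) := by
  obtain ⟨j, h1, h2⟩ := hi
  have h3 : Module.rankAtStalk (R := R)
      (ExtScalars (constantCoeff : WittVector p R →+* R) P.L) q = Module.rankAtStalk (R := R)
      (ExtScalars (constantCoeff : WittVector p R →+* R) Q.L) q :=
    congrFun (Module.rankAtStalk_eq_of_equiv (LinearEquiv.ofLinearMap
      (ExtScalars.map constantCoeff i.d) (ExtScalars.map constantCoeff j.d)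
      (constantCoeff_d_comp h2) (constantCoeff_d_comp h1))) q
  rwa [rankAtStalk_extScalars, rankAtStalk_extScalars] at h3

theorem rankAtStalk_L_baseChange {S : Type u} [CommRing S] (φ : R →+* S) (P : Display p R)
    (q : PrimeSpectrum (WittVector p S)) :
    Module.rankAtStalk (R := WittVector p S) (P.baseChange φ).L q =
      Module.rankAtStalk (R := WittVector p R) P.L
        (PrimeSpectrum.comap (WittVector.map φ) q) :=
  rankAtStalk_extScalars (WittVector.map φ) q

theorem natCast_p_pow_eq_zero (a : ℕ) (F : Type u) [CommRing F]
    [Algebra (WittVector p F ⧸ Ideal.span {(p : WittVector p F) ^ a}) R] : (p : R) ^ a = 0 := by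
  rw [← map_natCast (structureMap p a F R), ← map_pow, structureMap, RingHom.comp_apply,
    Ideal.Quotient.eq_zero_iff_mem.2 (Ideal.mem_span_singleton_self _), map_zero]

/-- `p` is nilpotent in `R`, so every point of `Spec R` lies over the closed point of `W(F)`. -/
theorem structureMap_mem_iff (a : ℕ) (F : Type u) [Field F] [CharP F p] [PerfectField F]
    [Algebra (WittVector p F ⧸ Ideal.span {(p : WittVector p F) ^ a}) R] (x : PrimeSpectrum R)
    (y : WittVector p F) : structureMap p a F R y ∈ x.asIdeal ↔ y.coeff 0 = 0 := by
  constructor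
  · intro h
    by_contra h0
    exact x.2.ne_top (Ideal.eq_top_of_isUnit_mem _ h ((isUnit_of_coeff_zero_ne_zero y h0).map _))
  · intro h
    have : ExpChar F p := ExpChar.prime hp.out
    have h1 : y ∈ Ideal.span {(p ^ 1 : WittVector p F)} :=
      (mem_span_p_pow_iff_le_coeff_eq_zero y 1).2 fun k hk => by rwa [Nat.lt_one_iff.1 hk]
    obtain ⟨z, rfl⟩ := Ideal.mem_span_singleton.1 h1
    rw [pow_one, map_mul, map_natCast]
    refine x.asIdeal.mul_mem_right _ (x.2.mem_of_pow_mem a ?_)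
    rw [natCast_p_pow_eq_zero a F]
    exact x.asIdeal.zero_mem

/-- The codimension of a lift is the codimension over the residue field. -/
theorem codim_eq_of_lift {a : ℕ} {F : Type u} [Field F] [CharP F p] [PerfectField F]
    {P₀ : Display p F} {c : ℕ} (hc : ∀ q, Module.rankAtStalk (R := WittVector p F) P₀.L q = c)
    {Q₀ : Display p (WittVector p F)} {i : Window.Hom (Q₀.baseChange WittVector.constantCoeff) P₀}
    (hi : i.IsIso) [Algebra (WittVector p F ⧸ Ideal.span {(p : WittVector p F) ^ a}) R]
    [Nontrivial R] {d c' : ℕ} (h : (Q₀.baseChange (structureMap p a F R)).HasDimCodim d c') :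
    c' = c := by
  obtain ⟨x⟩ : Nonempty (PrimeSpectrum R) := inferInstance
  let b : PrimeSpectrum F := ⟨⊥, Ideal.isPrime_bot⟩
  rw [← h.2 (PrimeSpectrum.comap constantCoeff x), ← hc (PrimeSpectrum.comap constantCoeff b),
    ← rankAtStalk_L_eq_of_isIso hi, rankAtStalk_L_baseChange, rankAtStalk_L_baseChange]
  -- Two points of `Spec W(W(F))` are compared: one comes from `x` through `W(R)`, the other from
  -- the zero ideal of `F` through `W(F)`. Both consist of the `y` with `(y₀)₀ = 0`.
  congr 1
  refine PrimeSpectrum.ext (Ideal.ext fun y => ?_)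
  change (WittVector.map (structureMap p a F R) y).coeff 0 ∈ x.asIdeal ↔
    (WittVector.map (constantCoeff : WittVector p F →+* F) y).coeff 0 ∈ (⊥ : Ideal F)
  rw [map_coeff, map_coeff, structureMap_mem_iff, Ideal.mem_bot]
  rfl

end Codimension

/-! ### Quasi-inverses, uniqueness and existence of factorizations of displays. -/

section Rigidity

open WittVector Matrix ModCoords WinCoords

variable {p : ℕ} [hp : Fact p.Prime] {R : Type u} [CommRing R] {P P' Q : Display p R}

/-- `g'` has a quasi-inverse `G` with `G g' = p ^ M` and `g' G = p ^ M`. -/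
def HasQuasiInverse (g' : Window.Hom P' Q) (M : ℕ) : Prop :=
  ∃ G : Window.Hom Q P',
    G.toLin.comp g'.toLin = (p : WittVector p R) ^ M • LinearMap.id ∧
      g'.toLin.comp G.toLin = (p : WittVector p R) ^ M • LinearMap.id

theorem hasQuasiInverse_of_isogeny {a : ℕ} (ha : (p : R) ^ a = 0) {d c m : ℕ}
    (hP : P'.HasDimCodim d c) (hQ : Q.HasDimCodim d c) {g' : Window.Hom P' Q}
    (hg' : ∀ x, Display.detVal g' (d + c) x = m) :
    HasQuasiInverse g' (2 * (a * (m + c) + a)) := by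
  obtain ⟨_, _, ⟨C⟩⟩ := WinCoords.exists_winCoords P'
  obtain ⟨_, _, ⟨D⟩⟩ := WinCoords.exists_winCoords Q
  obtain ⟨G, hG, h1, h2⟩ := (isHom C D g').exists_quasiInverse ha (C.hasRanks hP) (D.hasRanks hQ)
    (p_pow_mem_minorIdeal ha C D hP hQ hg')
  obtain ⟨G, rfl⟩ := exists_hom D C hG
  refine ⟨G, mat_injective C.sum C.sum ?_, mat_injective D.sum D.sum ?_⟩
  · rw [mat_comp _ D.sum, mat_smul, ← matrix_e, ← h1]
  · rw [mat_comp _ C.sum, mat_smul, ← matrix_e, ← h2]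

/-- Over the zero ring the rank conditions are vacuous and do not determine the codimension, so this
case needs its own argument; all matrices are zero. -/
theorem hasQuasiInverse_of_subsingleton [Subsingleton R] (g' : Window.Hom P' Q) (M : ℕ) :
    HasQuasiInverse g' M := by
  have : Subsingleton (WittVector p R) :=
    ⟨fun x y => WittVector.ext fun i => Subsingleton.elim _ _⟩
  obtain ⟨_, _, ⟨C⟩⟩ := WinCoords.exists_winCoords P'
  obtain ⟨_, _, ⟨D⟩⟩ := WinCoords.exists_winCoords Q
  obtain ⟨G, -⟩ := exists_hom D C (u := 0) ⟨⟨fun i j => zero_mem _, Subsingleton.elim _ _,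
    Subsingleton.elim _ _⟩, Subsingleton.elim _ _⟩
  exact ⟨G, mat_injective C.sum C.sum (Subsingleton.elim _ _),
    mat_injective D.sum D.sum (Subsingleton.elim _ _)⟩

/-- Composing with `G` gives `p^M (f - f') = 0`, and rigidity applies. -/
theorem comp_injective_of_hasQuasiInverse {a : ℕ} (ha : (p : R) ^ a = 0) {e : ℕ}
    (hP : P.NilpotentOfOrderLE e) {g' : Window.Hom P' Q} {M : ℕ} (hg' : HasQuasiInverse g' M)
    {f f' : Window.Hom P P'} (h : g'.comp f = g'.comp f') : f = f' := by
  obtain ⟨_, _, ⟨C⟩⟩ := WinCoords.exists_winCoords P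
  obtain ⟨_, _, ⟨D⟩⟩ := WinCoords.exists_winCoords P'
  obtain ⟨G, h1, -⟩ := hg'
  refine hom_ext_M C D (sub_eq_zero.1 (((isHom C D f).sub (isHom C D f')).eq_zero ha
    (C.isNilpotentOfOrder hP) (k := M) ?_))
  have h2 : g'.toLin.comp f.toLin = g'.toLin.comp f'.toLin := by
    have h3 := congrArg (fun k : Window.Hom P Q => k.toLin) h
    exact (Window.PreHom.toLin_comp _ _).symm.trans (h3.trans (Window.PreHom.toLin_comp _ _))
  have h4 : (p : WittVector p R) ^ M • f.toLin = (p : WittVector p R) ^ M • f'.toLin := by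
    have h5 := congrArg (fun k => G.toLin.comp k) h2
    simp only [← LinearMap.comp_assoc, h1] at h5
    simpa only [LinearMap.smul_comp, LinearMap.id_comp] using h5
  rw [smul_sub, sub_eq_zero, ← mat_smul, ← mat_smul, h4]

theorem exists_comp_eq_of_truncate {a : ℕ} (ha : (p : R) ^ a = 0) {e : ℕ}
    (hP : P.NilpotentOfOrderLE e) {g : Window.Hom P Q} {g' : Window.Hom P' Q} {N n : ℕ}
    (hg' : HasQuasiInverse g' N) (hn : 2 * (N * (e + 1)) + 3 ≤ n)
    {k : Window.Hom (P.truncate n) (P'.truncate n)}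
    (h : (Display.Hom.truncate n g').comp k = Display.Hom.truncate n g) :
    ∃ f : Window.Hom P P', g'.comp f = g := by
  obtain ⟨_, _, ⟨C⟩⟩ := WinCoords.exists_winCoords P
  obtain ⟨_, _, ⟨D⟩⟩ := WinCoords.exists_winCoords P'
  obtain ⟨_, _, ⟨E⟩⟩ := WinCoords.exists_winCoords Q
  obtain ⟨G, h1, h2⟩ := hg'
  obtain ⟨u, hu, hu₁, hu₂⟩ := exists_isPre_of_truncate C D k
  obtain ⟨f, hf, hf'⟩ := WindowMatrix.exists_isHom_mul_eq ha (C.isNilpotentOfOrder hP)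
    (isHom C E g) (isHom D E g') (isHom E D G) (M := N)
    (by rw [← M_comp, M, Window.PreHom.toLin_comp, h1, mat_smul, matrix_e])
    (by rw [← M_comp, M, Window.PreHom.toLin_comp, h2, mat_smul, matrix_e]) hn hu hu₁ (by
      have h3 : (D.M E g'.toPreHom * u).map (truncFrameMap p R n).ring =
          (C.M E g.toPreHom).map (truncFrameMap p R n).ring := by
        rw [matrix_map_mul, hu₂, ← mat_toLin_baseChange, ← mat_toLin_baseChange, ← mat_comp]
        congr 1
        have h4 := congrArg (fun k => Window.PreHom.toLin (Window.Hom.toPreHom k)) h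
        exact (Window.PreHom.toLin_comp _ _).symm.trans h4
      refine entriesIn_of_map_truncate ?_
      ext1 i j
      -- The equation holds over `𝒲_n(R)`; its image in `W_n(R)` says that the difference lies in
      -- `V^n W(R)`.
      have h5 := congrArg (truncWittFrame p R n).π (congrFun₂ h3 i j)
      rw [Matrix.map_apply, Matrix.map_apply, truncFrameMap_π_ring, truncFrameMap_π_ring] at h5
      rw [Matrix.map_apply, Matrix.sub_apply, map_sub, h5, sub_self, Matrix.zero_apply])
  obtain ⟨f, rfl⟩ := exists_hom C D hf
  exact ⟨f, hom_ext_M C E ((M_comp C D E _ _).trans hf')⟩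

end Rigidity

end ZinkDisplay

end

/-! ### The main theorem. -/

theorem mainTheorem10 (p : ℕ) [Fact p.Prime] (a e c m : ℕ) :
    ∃ n : ℕ, ∀ (F : Type u) [Field F] [CharP F p] [PerfectField F]
      (P₀ : ZinkDisplay.Display p F)
      (hP₀ : P₀.NilpotentOfOrderLE e)
      (hc : ∀ q, Module.rankAtStalk (R := WittVector p F) P₀.L q = c)
      (Q₀ : ZinkDisplay.Display p (WittVector p F))
      (hQ₀ : ∃ i : ZinkDisplay.Window.Hom (Q₀.baseChange WittVector.constantCoeff) P₀, i.IsIso)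
      (R : Type u) [CommRing R]
      [Algebra (WittVector p F ⧸ Ideal.span {(p : WittVector p F) ^ a}) R]
      (P P' : ZinkDisplay.Display p R)
      (hP : P.NilpotentOfOrderLE e) (hP' : P'.NilpotentOfOrderLE e)
      (g : ZinkDisplay.Window.Hom P (Q₀.baseChange (ZinkDisplay.structureMap p a F R)))
      (g' : ZinkDisplay.Window.Hom P' (Q₀.baseChange (ZinkDisplay.structureMap p a F R)))
      (hg : ZinkDisplay.Display.IsIsogenyOfHeight g m)
      (hg' : ZinkDisplay.Display.IsIsogenyOfHeight g' m),
      ((∃ f : ZinkDisplay.Window.Hom P P', g'.comp f = g) ↔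
        ∃ fₙ : ZinkDisplay.Window.Hom (P.truncate n) (P'.truncate n),
          (ZinkDisplay.Display.Hom.truncate n g').comp fₙ =
            ZinkDisplay.Display.Hom.truncate n g) ∧
      ∀ f : ZinkDisplay.Window.Hom P P', g'.comp f = g →
        f.IsIso ∧ ∀ f' : ZinkDisplay.Window.Hom P P', g'.comp f' = g → f' = f := by
  -- With `M = 2 (a (m + c) + a)` the exponent of the quasi-inverse of `g'`, this is `2 M (e + 1) +
  -- 3`. The dimension does not enter, since only the block of size `c` in `diag(1, p)` contributes.
  refine ⟨2 * (2 * (a * (m + c) + a) * (e + 1)) + 3, ?_⟩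
  intro F _ _ _ P₀ hP₀ hc Q₀ hQ₀ R _ _ P P' hP hP' g g' hg hg'
  have ha : (p : R) ^ a = 0 := ZinkDisplay.natCast_p_pow_eq_zero a F
  obtain ⟨i, hi⟩ := hQ₀
  have hinv : ZinkDisplay.HasQuasiInverse g' (2 * (a * (m + c) + a)) := by
    cases subsingleton_or_nontrivial R with
    | inl h => exact ZinkDisplay.hasQuasiInverse_of_subsingleton g' _
    | inr h =>
      obtain ⟨d, c', hP'd, hQd, hg'm⟩ := hg'
      obtain rfl := ZinkDisplay.codim_eq_of_lift hc hi hQd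
      exact ZinkDisplay.hasQuasiInverse_of_isogeny ha hP'd hQd hg'm
  refine ⟨⟨fun ⟨f, hf⟩ => ⟨ZinkDisplay.Display.Hom.truncate _ f, ?_⟩, fun ⟨k, hk⟩ =>
    ZinkDisplay.exists_comp_eq_of_truncate ha hP hinv le_rfl hk⟩, fun f hf => ⟨?_, fun f' hf' =>
    ZinkDisplay.comp_injective_of_hasQuasiInverse ha hP hinv (hf'.trans hf.symm)⟩⟩
  · rw [← hf]
    exact (ZinkDisplay.Window.Hom.baseChange_comp _ g' f).symm
  · obtain ⟨d, c₁, hPd, hQd, hgm⟩ := hg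
    obtain ⟨d', c₂, hP'd, hQd', hg'm⟩ := hg'
    -- The ranks attached to `g` and `g'` can be compared only at a point, so the equality is kept
    -- relative to `q` in order to include the zero ring.
    have hd : ∀ q : PrimeSpectrum (WittVector p R), d' = d ∧ c₂ = c₁ := fun q =>
      ⟨(hQd'.1 q).symm.trans (hQd.1 q), (hQd'.2 q).symm.trans (hQd.2 q)⟩
    refine ZinkDisplay.WinCoords.isIso_of_comp_eq ha hPd
      ⟨fun q => (hP'd.1 q).trans (hd q).1, fun q => (hP'd.2 q).trans (hd q).2⟩ hgm (fun x => ?_) hf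
    obtain ⟨rfl, rfl⟩ := hd (PrimeSpectrum.comap WittVector.constantCoeff x)
    exact hg'm x
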